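/- Let $\Gamma=\mathrm{SL}_2(\mathbb Z)$, $q=e^{2\pi i z}$ and $\mathbb L=\log|q|=-2\pi\,\mathrm{Im}(z)$ on the upper half-plane $\mathfrak H$. For $k\in\mathbb Z$ let $M^!_k$ be the space of weakly holomorphic modular forms of weight $k$ for $\Gamma$, with Fourier expansions $f=\sum_{m\ge -N}a_m(f)q^m$, and let $D=q\,\frac{d}{dq}$. For $r,s\in\mathbb Z$ let $\mathcal M^!_{r,s}$ be the space of real analytic $F:\mathfrak H\to\mathbb C$ with $F(\gamma z)=(cz+d)^r(c\overline z+d)^sF(z)$ for $\gamma=\begin{pmatrix}a&b\\c&d\end{pmatrix}\in\Gamma$ which have an expansion $F=\sum_{|k|\le M}\mathbb L^k\sum_{i,j\ge -N}a^{(k)}_{i,j}q^i\overline q^{\,j}$; the constant part of $F$ is $F^0=\sum_k a^{(k)}_{0,0}\mathbb L^k$. On functions of weights $(r,s)$ put $\partial=(z-\overline z)\frac{\partial}{\partial z}+r$ and $\overline\partial=(\overline z-z)\frac{\partial}{\partial\overline z}+s$, which have weights $(r+1,s-1)$ and $(r-1,s+1)$, and on functions of total weight $w=r+s$ put, for $m\ge1$,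 $T_mF(z)=m^{w-1}\sum_{ad=m,\ a,d>0}d^{-w}\sum_{0\le b<d}F\big(\frac{az+b}{d}\big)$. Let $n\ge 0$, let $f,g\in M^!_{n+2}$, and let $X_{r,s}\in\mathcal M^!_{r,s}$ ($r,s\ge0$, $r+s=n$) satisfy $$\partial X_{n,0}=\mathbb L f,\quad \partial X_{r,s}=(r+1)X_{r+1,s-1}\ (s\ge1),\quad \overline\partial X_{r,s}=(s+1)X_{r-1,s+1}\ (r\ge1),\quad \overline\partial X_{0,n}=\mathbb L\overline g .$$ Let $(\lambda_m)_{m\ge1}$ be complex numbers with $T_mf-\lambda_mf\in D^{n+1}M^!_{-n}$ for all $m\ge1$. Then there is $\alpha\in\mathbb C$ such that the following hold. (1) For all $r,s\ge0$ with $r+s=n$, $$X^0_{r,s}=\frac{a_0(f)}{n+1}\,\mathbb L+\alpha(-1)^r\binom nr\mathbb L^{-n};$$ in particular, $X^0_{r,s}=\alpha(-1)^r\binom nr\mathbb L^{-n}$ if $f$ is cuspidal, i.e. $a_0(f)=0$. (2) For every $m\ge1$ there are $\psi_m,\phi_m\in M^!_{-n}$ with $$(T_m-\lambda_m)f=\tfrac1{n!}\mathbb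 L^{-n-1}\partial^{n+1}\psi_m,\qquad (T_m-\overline{\lambda_m})g=\tfrac1{n!}\mathbb L^{-n-1}\partial^{n+1}\phi_m,$$ $$\Big(T_m-\frac{\lambda_m}{m}\Big)X_{r,s}=\frac1m\mathbb L^{-n}\Big(\frac{\partial^r}{r!}\psi_m+\frac{\overline\partial^s}{s!}\overline{\phi_m}\Big)\quad\text{for all }r,s\ge0\text{ with }r+s=n,$$ and for every such pair $(\psi_m,\phi_m)$ $$(\sigma_{n+1}(m)-\lambda_m)\,\alpha=a_0(\psi_m)+\overline{a_0(\phi_m)} .$$ (3) If $f$ is cuspidal and its class in $M^!_{n+2}/D^{n+1}M^!_{-n}$ is nonzero, then for all sufficiently large $m$ one has $\sigma_{n+1}(m)-\lambda_m\ne0$ and, for every pair $(\psi_m,\phi_m)$ as in (2), $$\alpha=\frac{a_0(\psi_m)+\overline{a_0(\phi_m)}}{\sigma_{n+1}(m)-\lambda_m}.$$ -/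

import Mathlib

open UpperHalfPlane Filter
open scoped ComplexConjugate Manifold LaurentPolynomial

noncomputable section

namespace RealAnalyticCusp

/-- The nome `q = exp (2πiz)`. -/
def nome (z : ℍ) : ℂ := Complex.exp (2 * Real.pi * Complex.I * (z : ℂ))

/-- `𝕃 = log |q| = πi (z - z̄) = -2π Im z`, as a complex-valued function on `ℍ`. -/
def LL (z : ℍ) : ℂ := ((-2 * Real.pi * z.im : ℝ) : ℂ)

/-- `F` is modular of weights `(r, s)` for `SL₂(ℤ)`:
`F (γz) = (cz + d)^r (c z̄ + d)^s F z`. -/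
def IsModular (r s : ℤ) (F : ℍ → ℂ) : Prop :=
  ∀ (γ : Matrix.SpecialLinearGroup (Fin 2) ℤ) (z : ℍ),
    F (γ • z) = ((γ 1 0 : ℂ) * z + (γ 1 1 : ℂ)) ^ r *
      ((γ 1 0 : ℂ) * conj (z : ℂ) + (γ 1 1 : ℂ)) ^ s * F z

/-! ### Weakly holomorphic modular forms -/

/-- `f = ∑_{m ≥ -N} a m q ^ m` on `ℍ`, for some `N`. -/
def HasQExpansion (f : ℍ → ℂ) (a : ℤ → ℂ) : Prop :=
  (∃ N : ℤ, ∀ m, m < -N → a m = 0) ∧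
    ∀ z : ℍ, HasSum (fun m : ℤ => a m * nome z ^ m) (f z)

/-- Membership in `M^!_k`: holomorphic on `ℍ`, modular of weight `k` for `SL₂(ℤ)`, with at worst a
pole at the cusp. -/
structure IsWeaklyHolomorphic (k : ℤ) (f : ℍ → ℂ) : Prop where
  holo : MDifferentiable 𝓘(ℂ) 𝓘(ℂ) f
  modular : IsModular k 0 f
  expansion : ∃ a, HasQExpansion f a

open Classical in
/-- The Fourier coefficient `a_m(f)` of a function with a `q`-expansion
(see `HasQExpansion.qCoeff_eq`). -/
def qCoeff (f : ℍ → ℂ) (m : ℤ) : ℂ :=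
  if h : ∃ a, HasQExpansion f a then h.choose m else 0

theorem HasQExpansion.unique {f : ℍ → ℂ} {a b : ℤ → ℂ}
    (ha : HasQExpansion f a) (hb : HasQExpansion f b) : a = b := by
  obtain ⟨⟨N, hN⟩, hsa⟩ := ha
  obtain ⟨⟨N', hN'⟩, hsb⟩ := hb
  by_contra hne
  set c : ℤ → ℂ := fun m => a m - b m with hc
  have hs : ∀ z : ℍ, HasSum (fun m : ℤ => c m * nome z ^ m) 0 := fun z => by
    simpa [hc, sub_mul] using (hsa z).sub (hsb z)
  have hbdd : ∀ m, c m ≠ 0 → min (-N) (-N') ≤ m := by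
    intro m hm
    by_contra hlt
    rw [not_le, lt_min_iff] at hlt
    exact hm (by simp [hc, hN m hlt.1, hN' m hlt.2])
  have hex : ∃ m, c m ≠ 0 := by
    obtain ⟨m, hm⟩ := Function.ne_iff.mp hne
    exact ⟨m, sub_ne_zero.mpr hm⟩
  obtain ⟨k, hk, hmin⟩ := Int.exists_least_of_bdd (P := fun m => c m ≠ 0) ⟨_, hbdd⟩ hex
  let Z : ℕ → ℍ := fun j => ⟨((j : ℂ) + 1) * Complex.I, by simp; positivity⟩
  have hq : ∀ j, nome (Z j) = ((Real.exp (-(2 * Real.pi * (j + 1))) : ℝ) : ℂ) := by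
    intro j
    simp only [nome, Z, Complex.ofReal_exp]
    congr 1
    push_cast
    linear_combination (2 * (Real.pi : ℂ) * (j + 1)) * Complex.I_mul_I
  have hq0 : ∀ j, nome (Z j) ≠ 0 := fun j => Complex.exp_ne_zero _
  have hs' : ∀ j, HasSum (fun m : ℤ => c m * nome (Z j) ^ (m - k)) 0 := fun j => by
    have := (hs (Z j)).mul_right (nome (Z j) ^ (-k))
    simpa only [mul_assoc, ← zpow_add₀ (hq0 j), sub_eq_add_neg, zero_mul] using this
  have hlim : Tendsto (fun j => ∑' m : ℤ, c m * nome (Z j) ^ (m - k)) atTop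
      (nhds (∑' m : ℤ, if m = k then c k else 0)) := by
    refine tendsto_tsum_of_dominated_convergence (hs' 0).summable.norm ?_ ?_
    · intro m
      by_cases hmk : m = k
      · subst hmk; simp
      · simp only [hmk, if_false]
        by_cases hcm : c m = 0
        · simp [hcm]
        · have hlt : k < m := lt_of_le_of_ne (hmin m hcm) (Ne.symm hmk)
          obtain ⟨t, ht⟩ := Int.eq_ofNat_of_zero_le (sub_pos.mpr hlt).le
          have ht0 : t ≠ 0 := by rintro rfl; simp at ht; omega
          have h1 : Tendsto (fun j => nome (Z j)) atTop (nhds 0) := by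
            simp only [hq]
            rw [← Complex.ofReal_zero]
            refine (Complex.continuous_ofReal.tendsto 0).comp ?_
            refine Real.tendsto_exp_neg_atTop_nhds_zero.comp ?_
            refine Tendsto.const_mul_atTop (by positivity) ?_
            exact tendsto_atTop_add_const_right _ _ tendsto_natCast_atTop_atTop
          have h2 := (h1.pow t).const_mul (c m)
          simpa [ht, ht0] using h2
    · refine Eventually.of_forall fun j m => ?_
      by_cases hcm : c m = 0
      · simp [hcm]
      · rw [norm_mul, norm_mul]
        refine mul_le_mul_of_nonneg_left ?_ (norm_nonneg _)
        obtain ⟨t, ht⟩ := Int.eq_ofNat_of_zero_le (sub_nonneg.mpr (hmin m hcm))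
        rw [ht, zpow_natCast, zpow_natCast, norm_pow, norm_pow]
        refine pow_le_pow_left₀ (norm_nonneg _) ?_ t
        rw [hq, hq, Complex.norm_real, Complex.norm_real, Real.norm_of_nonneg (Real.exp_pos _).le,
          Real.norm_of_nonneg (Real.exp_pos _).le]
        refine Real.exp_le_exp.mpr (neg_le_neg ?_)
        have := Real.pi_pos
        push_cast
        gcongr
        positivity
  have h0 : ∀ j, ∑' m : ℤ, c m * nome (Z j) ^ (m - k) = 0 := fun j => (hs' j).tsum_eq
  simp only [h0, tsum_ite_eq] at hlim
  exact hk (tendsto_nhds_unique hlim tendsto_const_nhds)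

theorem HasQExpansion.qCoeff_eq {f : ℍ → ℂ} {a : ℤ → ℂ} (ha : HasQExpansion f a) (m : ℤ) :
    qCoeff f m = a m := by
  have h : ∃ a, HasQExpansion f a := ⟨a, ha⟩
  rw [qCoeff, dif_pos h, h.choose_spec.unique ha]

/-- Membership in `D^{n+1} M^!_{-n}`, where `D = q d/dq = (2πi)⁻¹ d/dz`. -/
def IsBolImage (n : ℕ) (h : ℍ → ℂ) : Prop :=
  ∃ p : ℍ → ℂ, IsWeaklyHolomorphic (-n) p ∧
    h = Derivative.normalizedDerivOfComplex^[n + 1] p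

/-! ### Real analytic modular forms -/

/-- `F = ∑_{|k| ≤ M} 𝕃^k ∑_{i, j ≥ -N} a k i j q^i q̄^j` on `ℍ`, for some `M` and `N`. -/
def HasLExpansion (F : ℍ → ℂ) (a : ℤ → ℤ → ℤ → ℂ) : Prop :=
  ∃ M N : ℤ, (∀ k i j, a k i j ≠ 0 → |k| ≤ M ∧ -N ≤ i ∧ -N ≤ j) ∧
    ∀ z : ℍ, ∃ S : ℤ → ℂ,
      (∀ k, HasSum (fun p : ℤ × ℤ => a k p.1 p.2 * nome z ^ p.1 * conj (nome z) ^ p.2) (S k)) ∧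
      F z = ∑ k ∈ Finset.Icc (-M) M, LL z ^ k * S k

/-- Membership in `𝓜^!_{r,s}`. -/
structure IsRealAnalyticModular (r s : ℤ) (F : ℍ → ℂ) : Prop where
  analytic : AnalyticOnNhd ℝ (F ∘ ofComplex) upperHalfPlaneSet
  modular : IsModular r s F
  expansion : ∃ a, HasLExpansion F a

/-- The Laurent polynomial `p ∈ ℂ[𝕃, 𝕃⁻¹]` (`T` stands for `𝕃`) is the constant part `F⁰` of `F`:
`F` has an expansion, and `p = ∑ₖ a k 0 0 𝕃^k` for every expansion `a` of `F`. -/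
def IsConstantPart (F : ℍ → ℂ) (p : ℂ[T;T⁻¹]) : Prop :=
  (∃ a, HasLExpansion F a) ∧ ∀ a, HasLExpansion F a → ∀ k, p.coeff k = a k 0 0

/-- `∂F/∂z = (∂F/∂x - i ∂F/∂y) / 2`. -/
def dz (F : ℍ → ℂ) (z : ℍ) : ℂ :=
  (fderiv ℝ (F ∘ ofComplex) (z : ℂ) 1 - Complex.I * fderiv ℝ (F ∘ ofComplex) (z : ℂ) Complex.I) / 2

/-- `∂F/∂z̄ = (∂F/∂x + i ∂F/∂y) / 2`. -/
def dzbar (F : ℍ → ℂ) (z : ℍ) : ℂ :=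
  (fderiv ℝ (F ∘ ofComplex) (z : ℂ) 1 + Complex.I * fderiv ℝ (F ∘ ofComplex) (z : ℂ) Complex.I) / 2

/-- `∂_r = (z - z̄) ∂/∂z + r`. -/
def del (r : ℤ) (F : ℍ → ℂ) (z : ℍ) : ℂ := ((z : ℂ) - conj (z : ℂ)) * dz F z + r * F z

/-- `∂̄_s = (z̄ - z) ∂/∂z̄ + s`. -/
def delbar (s : ℤ) (F : ℍ → ℂ) (z : ℍ) : ℂ := (conj (z : ℂ) - (z : ℂ)) * dzbar F z + s * F z

/-- `∂^k = ∂_{r+k-1} ⋯ ∂_{r+1} ∂_r` on functions of first weight `r`. -/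
def delPow (r : ℤ) : ℕ → (ℍ → ℂ) → ℍ → ℂ
  | 0, F => F
  | k + 1, F => del (r + k) (delPow r k F)

/-- `∂̄^k = ∂̄_{s+k-1} ⋯ ∂̄_{s+1} ∂̄_s` on functions of second weight `s`. -/
def delbarPow (s : ℤ) : ℕ → (ℍ → ℂ) → ℍ → ℂ
  | 0, F => F
  | k + 1, F => delbar (s + k) (delbarPow s k F)

/-- The Hecke operator `T_m` on functions of total weight `w`:
`T_m F (z) = m^{w-1} ∑_{ad = m} d^{-w} ∑_{0 ≤ b < d} F ((az + b)/d)`. -/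
def hecke (w : ℤ) (m : ℕ) (F : ℍ → ℂ) (z : ℍ) : ℂ :=
  (m : ℂ) ^ (w - 1) * ∑ p ∈ m.divisorsAntidiagonal, (p.2 : ℂ) ^ (-w) *
    ∑ b ∈ Finset.range p.2, F (ofComplex (((p.1 : ℂ) * z + b) / p.2))

/-! ### Modular primitives and weak Hecke eigenforms -/

/-- `X r s`, for `r + s = n`, is the system in `𝓜^!` generated by a modular primitive `X n 0` of
`𝕃 f`, and `g ∈ M^!_{n+2}` is the form with `∂̄ X_{0,n} = 𝕃 ḡ`. -/
structure IsPrimitiveSystem (n : ℕ) (f g : ℍ → ℂ) (X : ℕ → ℕ → ℍ → ℂ) : Prop where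
  hol_f : IsWeaklyHolomorphic (n + 2) f
  hol_g : IsWeaklyHolomorphic (n + 2) g
  mem : ∀ r s, r + s = n → IsRealAnalyticModular r s (X r s)
  del_top : ∀ z, del n (X n 0) z = LL z * f z
  del_eq : ∀ r s, r + (s + 1) = n → ∀ z, del r (X r (s + 1)) z = (r + 1) * X (r + 1) s z
  delbar_eq : ∀ r s, (r + 1) + s = n → ∀ z, delbar s (X (r + 1) s) z = (s + 1) * X r (s + 1) z
  delbar_bot : ∀ z, delbar n (X 0 n) z = LL z * conj (g z)

/-- `T_m f ≡ λ_m f` modulo `D^{n+1} M^!_{-n}` for all `m ≥ 1`. -/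
def HasWeakHeckeEigenvalues (n : ℕ) (f : ℍ → ℂ) (lam : ℕ → ℂ) : Prop :=
  ∀ m : ℕ, 1 ≤ m → IsBolImage n (fun z => hecke (n + 2) m f z - lam m * f z)

/-- `ψ, φ ∈ M^!_{-n}` are the forms that measure the failure of `f`, `g` and the `X r s` to be
eigenfunctions of `T_m`. Conjugating `∂̄` of the identity for `X 0 n` turns `λ_m` into its conjugate
in the identity for `g`; the two agree for eigenvalues of a nonzero class, which are real. -/
structure IsHeckeDefect (n : ℕ) (f g : ℍ → ℂ) (X : ℕ → ℕ → ℍ → ℂ) (lam : ℕ → ℂ) (m : ℕ)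
    (ψ φ : ℍ → ℂ) : Prop where
  hol_psi : IsWeaklyHolomorphic (-n) ψ
  hol_phi : IsWeaklyHolomorphic (-n) φ
  on_f : ∀ z, hecke (n + 2) m f z - lam m * f z =
    1 / (n.factorial : ℂ) * LL z ^ (-(n : ℤ) - 1) * delPow (-n) (n + 1) ψ z
  on_g : ∀ z, hecke (n + 2) m g z - conj (lam m) * g z =
    1 / (n.factorial : ℂ) * LL z ^ (-(n : ℤ) - 1) * delPow (-n) (n + 1) φ z
  on_X : ∀ r s, r + s = n → ∀ z, hecke n m (X r s) z - lam m / m * X r s z =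
    1 / (m : ℂ) * LL z ^ (-(n : ℤ)) *
      (delPow (-n) r ψ z / (r.factorial : ℂ) +
        delbarPow (-n) s (fun w => conj (φ w)) z / (s.factorial : ℂ))

end RealAnalyticCusp

end

noncomputable section

namespace RealAnalyticCusp

local notation "𝒟" => Derivative.normalizedDerivOfComplex

/-! ### Points of the upper half-plane and elementary functions -/

/-! Everything about constant parts is read off from the zeroth Fourier mode, the integral of F(x +
iy) over one period in x. Integration keeps only the diagonal terms q^i q̄^i of an expansion. A
series in powers of y and of e^{-4πy} determines its coefficients (`eq_zero_of_hasSum_zero`), so a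
zeroth mode which is a Laurent polynomial in 𝕃 is the constant part (`isConstantPart_of_zeroMode`).

Part (1) is then an ordinary differential equation. The x-derivative of a periodic function has mean
zero, so ∂_r and ∂̄_r both act on zeroth modes as y d/dy + r (`zeroMode_del_delbar`). The equation
∂X_{n,0} = 𝕃f leaves one free constant α, and the lowering equations carry the solution to every
other component (`IsPrimitiveSystem.exists_zeroMode`).

For part (2), Bol's identity ∂^{n+1}p = (2𝕃)^{n+1} D^{n+1}p (`delPow_bol`) converts the hypothesis
on T_m f into the form ψ_m. Hecke operators commute with ∂ and ∂̄ and preserve modularity. Hence m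
𝕃^n (T_m - λ_m/m) X_{n,0} - ∂^n ψ_m / n! is killed by ∂_0: it is antiholomorphic, and its conjugate
is φ_m (`IsPrimitiveSystem.exists_defect`). Repeated ∂̄ gives the identities for all components and
for g. On zeroth modes T_m multiplies 𝕃^{-n} by σ_{n+1}(m)/m, and comparing the coefficients of
𝕃^{-n} yields the relation for α (`IsHeckeDefect.relation`).

Part (3) needs σ_{n+1}(m) ≠ λ_m for large m. As σ_{n+1}(m) ≥ m^{n+1}, it is enough that λ_m = O(m^n)
(`exists_eigenvalue_bound`). For odd n there are no nonzero forms, and for n = 0 every form of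
weight 2 is a derivative, so n is even and at least 2. The class of f is unchanged by subtracting
Bol images. When the polar term of order N cannot be removed in this way, there is a cusp form h of
weight n+2 beginning with q^N. The residue pairing with h kills Bol images, because a weakly
holomorphic form of weight 2 has no constant term. Pairing T_m f with h thus gives a nonzero
multiple of λ_m, and the trivial bound for the coefficients of h bounds it by a constant times m^n.
If no pole is left, f is a cuspidal eigenform and its own coefficients bound λ_m. -/

theorem nome_ne_zero (z : ℍ) : nome z ≠ 0 := Complex.exp_ne_zero _

theorem norm_nome (z : ℍ) : ‖nome z‖ = Real.exp (-(2 * Real.pi * z.im)) := by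
  rw [nome, Complex.norm_exp]
  simp

theorem real_exp_zpow (x : ℝ) (k : ℤ) : Real.exp x ^ k = Real.exp (k * x) := by
  rw [← Real.rpow_intCast, ← Real.exp_mul, mul_comm]

theorem continuous_nome : Continuous nome := by
  unfold nome
  fun_prop

theorem LL_ne_zero (z : ℍ) : LL z ≠ 0 := by
  have h : -2 * Real.pi * z.im ≠ 0 := by
    have := Real.pi_pos
    have := z.im_pos
    simp only [neg_mul, ne_eq, neg_eq_zero]
    positivity
  exact Complex.ofReal_ne_zero.mpr h

theorem LL_eq (z : ℍ) : LL z = Real.pi * Complex.I * ((z : ℂ) - conj (z : ℂ)) := by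
  rw [Complex.sub_conj, LL]
  push_cast
  rw [UpperHalfPlane.coe_im]
  linear_combination (-2 * (Real.pi : ℂ) * z.im) * Complex.I_mul_I

theorem conj_LL (z : ℍ) : conj (LL z) = LL z := Complex.conj_ofReal _

theorem continuous_LL : Continuous LL := by
  unfold LL
  fun_prop

theorem coe_ofComplex {w : ℂ} (hw : 0 < w.im) : ((ofComplex w : ℍ) : ℂ) = w := by
  rw [ofComplex_apply_of_im_pos hw]

theorem im_line (x y : ℝ) : ((x : ℂ) + y * Complex.I).im = y := by simp

theorem coe_line (x : ℝ) {y : ℝ} (hy : 0 < y) :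
    ((ofComplex ((x : ℂ) + y * Complex.I) : ℍ) : ℂ) = x + y * Complex.I :=
  coe_ofComplex (by rwa [im_line])

theorem im_ofComplex_line (x : ℝ) {y : ℝ} (hy : 0 < y) :
    (ofComplex ((x : ℂ) + y * Complex.I) : ℍ).im = y := by
  rw [← UpperHalfPlane.coe_im, coe_line x hy, im_line]

theorem continuous_line {y : ℝ} (hy : 0 < y) :
    Continuous fun x : ℝ => (ofComplex ((x : ℂ) + y * Complex.I) : ℍ) := by
  rw [isEmbedding_coe.continuous_iff]
  simp only [Function.comp_def, coe_line _ hy]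
  fun_prop

theorem LL_line (x : ℝ) {y : ℝ} (hy : 0 < y) :
    LL (ofComplex ((x : ℂ) + y * Complex.I)) = ((-2 * Real.pi * y : ℝ) : ℂ) := by
  rw [LL, im_ofComplex_line x hy]

theorem nome_line (x : ℝ) {y : ℝ} (hy : 0 < y) :
    nome (ofComplex ((x : ℂ) + y * Complex.I)) =
      Complex.exp (-(2 * Real.pi * y)) * Complex.exp (2 * Real.pi * Complex.I * x) := by
  rw [nome, coe_line x hy, ← Complex.exp_add]
  congr 1
  linear_combination (2 * (Real.pi : ℂ) * y) * Complex.I_mul_I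

/-! ### The zeroth Fourier mode -/

/-- The zeroth Fourier mode `∫₀¹ F (x + iy) dx` of a function on the upper half-plane. -/
def zeroMode (F : ℍ → ℂ) (y : ℝ) : ℂ :=
  ∫ x in (0 : ℝ)..1, F (ofComplex ((x : ℂ) + y * Complex.I))

theorem intervalIntegrable_line {F : ℍ → ℂ} (hF : Continuous F) {y : ℝ} (hy : 0 < y) (a b : ℝ) :
    IntervalIntegrable (fun x : ℝ => F (ofComplex ((x : ℂ) + y * Complex.I)))
      MeasureTheory.volume a b :=
  (hF.comp (continuous_line hy)).intervalIntegrable _ _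

theorem zeroMode_add {F G : ℍ → ℂ} (hF : Continuous F) (hG : Continuous G) {y : ℝ} (hy : 0 < y) :
    zeroMode (fun z => F z + G z) y = zeroMode F y + zeroMode G y :=
  intervalIntegral.integral_add (intervalIntegrable_line hF hy 0 1)
    (intervalIntegrable_line hG hy 0 1)

theorem zeroMode_sub {F G : ℍ → ℂ} (hF : Continuous F) (hG : Continuous G) {y : ℝ} (hy : 0 < y) :
    zeroMode (fun z => F z - G z) y = zeroMode F y - zeroMode G y :=
  intervalIntegral.integral_sub (intervalIntegrable_line hF hy 0 1)
    (intervalIntegrable_line hG hy 0 1)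

theorem zeroMode_sum {ι : Type*} (s : Finset ι) {F : ι → ℍ → ℂ} (hF : ∀ i ∈ s, Continuous (F i))
    {y : ℝ} (hy : 0 < y) :
    zeroMode (fun z => ∑ i ∈ s, F i z) y = ∑ i ∈ s, zeroMode (F i) y :=
  intervalIntegral.integral_finsetSum fun i hi => intervalIntegrable_line (hF i hi) hy 0 1

theorem zeroMode_const_mul (c : ℂ) (F : ℍ → ℂ) (y : ℝ) :
    zeroMode (fun z => c * F z) y = c * zeroMode F y :=
  intervalIntegral.integral_const_mul _ _

/-- Factors depending only on the height come out of the zeroth mode. -/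
theorem zeroMode_LL_zpow_mul (F : ℍ → ℂ) (k : ℤ) {y : ℝ} (hy : 0 < y) :
    zeroMode (fun z => LL z ^ k * F z) y = ((-2 * Real.pi * y : ℝ) : ℂ) ^ k * zeroMode F y := by
  simp only [zeroMode, LL_line _ hy]
  exact intervalIntegral.integral_const_mul _ _

theorem zeroMode_conj (F : ℍ → ℂ) (y : ℝ) :
    zeroMode (fun z => conj (F z)) y = conj (zeroMode F y) := by
  simp only [zeroMode, intervalIntegral.integral_of_le zero_le_one]
  exact integral_conj

theorem norm_zeroMode_le {F : ℍ → ℂ} {y C : ℝ} (hy : 0 < y) (hC : ∀ z : ℍ, z.im = y → ‖F z‖ ≤ C) :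
    ‖zeroMode F y‖ ≤ C := by
  have := intervalIntegral.norm_integral_le_of_norm_le_const (a := (0 : ℝ)) (b := 1)
    (f := fun x : ℝ => F (ofComplex ((x : ℂ) + y * Complex.I))) (C := C)
    fun x _ => hC _ (im_ofComplex_line x hy)
  simpa [zeroMode] using this

theorem integral_exp_two_pi_int (e : ℤ) :
    ∫ x in (0 : ℝ)..1, Complex.exp (2 * Real.pi * Complex.I * e * x) = if e = 0 then 1 else 0 := by
  split_ifs with h
  · simp [h]
  · have h0 : 2 * Real.pi * Complex.I * e ≠ 0 := by
      simp [Real.pi_ne_zero, h]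
    rw [integral_exp_mul_complex h0]
    have : Complex.exp (2 * Real.pi * Complex.I * e) = 1 := by
      rw [Complex.exp_eq_one_iff]
      exact ⟨e, by ring⟩
    simp [this]

/-- The integral over a period of an absolutely convergent trigonometric series is the sum of the
terms of frequency zero. -/
theorem hasSum_integral_of_frequencies {ι : Type*} [Countable ι] {c : ι → ℂ} {e : ι → ℤ}
    (hc : Summable fun i => ‖c i‖) {F : ℝ → ℂ}
    (hF : ∀ x : ℝ, HasSum (fun i => c i * Complex.exp (2 * Real.pi * Complex.I * e i * x)) (F x)) :
    HasSum (fun i => if e i = 0 then c i else 0) (∫ x in (0 : ℝ)..1, F x) := by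
  have h := intervalIntegral.hasSum_integral_of_dominated_convergence
    (μ := MeasureTheory.volume) (a := (0 : ℝ)) (b := 1)
    (F := fun i x => c i * Complex.exp (2 * Real.pi * Complex.I * e i * x)) (f := F)
    (fun i _ => ‖c i‖) (fun i => by
      refine Continuous.aestronglyMeasurable ?_
      fun_prop) (fun i => Eventually.of_forall fun x _ => ?_)
    (Eventually.of_forall fun _ _ => hc) intervalIntegrable_const
    (Eventually.of_forall fun x _ => hF x)
  · convert! h using 2 with i
    rw [intervalIntegral.integral_const_mul, integral_exp_two_pi_int]
    simp
  · rw [norm_mul]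
    have : 2 * Real.pi * Complex.I * e i * x = ((2 * Real.pi * e i * x : ℝ) : ℂ) * Complex.I := by
      push_cast
      ring
    rw [this, Complex.norm_exp_ofReal_mul_I, mul_one]

/-! ### `q`-expansions -/

theorem HasQExpansion.summable_norm {f : ℍ → ℂ} {a : ℤ → ℂ} (h : HasQExpansion f a) (z : ℍ) :
    Summable fun m : ℤ => ‖a m * nome z ^ m‖ := (h.2 z).summable.norm

theorem HasQExpansion.mul_nome_zpow {f : ℍ → ℂ} {a : ℤ → ℂ} (h : HasQExpansion f a) (k : ℤ) :
    HasQExpansion (fun z => f z * nome z ^ k) (fun m => a (m - k)) := by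
  obtain ⟨⟨N, hN⟩, hs⟩ := h
  refine ⟨⟨N - k, fun m hm => hN _ (by omega)⟩, fun z => ?_⟩
  have := (hs z).mul_right (nome z ^ k)
  rw [← (Equiv.subRight k).hasSum_iff] at this
  convert! this using 2 with m
  simp [mul_assoc, ← zpow_add₀ (nome_ne_zero z)]

theorem HasQExpansion.zeroMode_eq {f : ℍ → ℂ} {a : ℤ → ℂ} (h : HasQExpansion f a) {y : ℝ}
    (hy : 0 < y) : zeroMode f y = a 0 := by
  have key : ∀ (m : ℤ) (x : ℝ), a m * nome (ofComplex ((x : ℂ) + y * Complex.I)) ^ m =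
      a m * Complex.exp (-(2 * Real.pi * y)) ^ m *
        Complex.exp (2 * Real.pi * Complex.I * m * x) := by
    intro m x
    rw [nome_line x hy, mul_zpow, ← Complex.exp_int_mul (2 * Real.pi * Complex.I * x)]
    ring_nf
  have hs := h.summable_norm (ofComplex (((0 : ℝ) : ℂ) + y * Complex.I))
  simp only [key] at hs
  simp only [Complex.ofReal_zero, mul_zero, Complex.exp_zero, mul_one] at hs
  have := hasSum_integral_of_frequencies (c := fun m => a m * Complex.exp (-(2 * Real.pi * y)) ^ m)
    (e := fun m : ℤ => m) hs (F := fun x => f (ofComplex ((x : ℂ) + y * Complex.I)))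
    fun x => by simpa only [key] using h.2 (ofComplex ((x : ℂ) + y * Complex.I))
  rw [zeroMode, ← this.tsum_eq, tsum_eq_single 0 fun m hm => by simp [hm]]
  simp

/-- Since the height y is arbitrary, limits and bounds for f on any chosen horizontal line pass to
its coefficients. -/
theorem HasQExpansion.coeff_eq_zeroMode {f : ℍ → ℂ} {a : ℤ → ℂ} (h : HasQExpansion f a) (m : ℤ)
    {y : ℝ} (hy : 0 < y) : zeroMode (fun z => f z * nome z ^ (-m)) y = a m := by
  rw [(h.mul_nome_zpow (-m)).zeroMode_eq hy]
  simp

theorem HasQExpansion.add {f g : ℍ → ℂ} {a b : ℤ → ℂ} (hf : HasQExpansion f a)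
    (hg : HasQExpansion g b) : HasQExpansion (fun z => f z + g z) (fun m => a m + b m) := by
  obtain ⟨⟨N, hN⟩, hs⟩ := hf
  obtain ⟨⟨N', hN'⟩, hs'⟩ := hg
  refine ⟨⟨max N N', fun m hm => ?_⟩, fun z => ?_⟩
  · simp [hN m (by omega), hN' m (by omega)]
  · simpa only [add_mul] using (hs z).add (hs' z)

theorem HasQExpansion.const_mul {f : ℍ → ℂ} {a : ℤ → ℂ} (hf : HasQExpansion f a) (c : ℂ) :
    HasQExpansion (fun z => c * f z) (fun m => c * a m) := by
  obtain ⟨⟨N, hN⟩, hs⟩ := hf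
  refine ⟨⟨N, fun m hm => by simp [hN m hm]⟩, fun z => ?_⟩
  simpa only [mul_assoc] using (hs z).mul_left c

theorem HasQExpansion.sub {f g : ℍ → ℂ} {a b : ℤ → ℂ} (hf : HasQExpansion f a)
    (hg : HasQExpansion g b) : HasQExpansion (fun z => f z - g z) (fun m => a m - b m) := by
  simpa [sub_eq_add_neg] using hf.add (hg.const_mul (-1))

theorem hasQExpansion_zero : HasQExpansion (fun _ => 0) 0 :=
  ⟨⟨0, fun _ _ => rfl⟩, fun z => by simp⟩

/-! ### Growth at the cusp -/

/-- At most exponential growth in the imaginary part at the cusp. -/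
def ExpGrowth (F : ℍ → ℂ) : Prop :=
  ∃ K : ℝ, F =O[atImInfty] fun z : ℍ => Real.exp (K * z.im)

theorem exp_isBigO_exp {K K' : ℝ} (h : K ≤ K') :
    (fun z : ℍ => Real.exp (K * z.im)) =O[atImInfty] fun z : ℍ => Real.exp (K' * z.im) := by
  refine Asymptotics.IsBigO.of_bound 1 (Eventually.of_forall fun z => ?_)
  rw [one_mul, Real.norm_of_nonneg (Real.exp_pos _).le, Real.norm_of_nonneg (Real.exp_pos _).le]
  have := z.im_pos
  gcongr

theorem ExpGrowth.add {F G : ℍ → ℂ} (hF : ExpGrowth F) (hG : ExpGrowth G) :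
    ExpGrowth fun z => F z + G z := by
  obtain ⟨K, hK⟩ := hF
  obtain ⟨K', hK'⟩ := hG
  exact ⟨max K K', (hK.trans (exp_isBigO_exp (le_max_left _ _))).add
    (hK'.trans (exp_isBigO_exp (le_max_right _ _)))⟩

theorem ExpGrowth.mul {F G : ℍ → ℂ} (hF : ExpGrowth F) (hG : ExpGrowth G) :
    ExpGrowth fun z => F z * G z := by
  obtain ⟨K, hK⟩ := hF
  obtain ⟨K', hK'⟩ := hG
  refine ⟨K + K', ?_⟩
  simp only [add_mul, Real.exp_add]
  exact hK.mul hK'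

theorem expGrowth_const (c : ℂ) : ExpGrowth fun _ => c := by
  refine ⟨0, ?_⟩
  simpa using Asymptotics.isBigO_const_const c (one_ne_zero (α := ℝ)) atImInfty

theorem ExpGrowth.const_mul {F : ℍ → ℂ} (hF : ExpGrowth F) (c : ℂ) : ExpGrowth fun z => c * F z :=
  (expGrowth_const c).mul hF

theorem ExpGrowth.sub {F G : ℍ → ℂ} (hF : ExpGrowth F) (hG : ExpGrowth G) :
    ExpGrowth fun z => F z - G z := by
  simpa [sub_eq_add_neg] using hF.add (hG.const_mul (-1))

theorem ExpGrowth.sum {ι : Type*} (s : Finset ι) {F : ι → ℍ → ℂ} (hF : ∀ i ∈ s, ExpGrowth (F i)) :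
    ExpGrowth fun z => ∑ i ∈ s, F i z := by
  classical
  induction s using Finset.induction_on with
  | empty => simpa using expGrowth_const 0
  | insert i s hi ih =>
    simp only [Finset.sum_insert hi]
    exact (hF i (Finset.mem_insert_self i s)).add
      (ih fun j hj => hF j (Finset.mem_insert_of_mem hj))

theorem ExpGrowth.conj {F : ℍ → ℂ} (hF : ExpGrowth F) : ExpGrowth fun z => conj (F z) := by
  obtain ⟨K, hK⟩ := hF
  refine ⟨K, ?_⟩
  rw [← Asymptotics.isBigO_norm_left] at hK ⊢
  simpa using hK

theorem expGrowth_LL_zpow (k : ℤ) : ExpGrowth fun z => LL z ^ k := by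
  refine ⟨1, ?_⟩
  have h1 := (isLittleO_zpow_exp_pos_mul_atTop k (one_pos)).isBigO.comp_tendsto
    (tendsto_comap : Tendsto UpperHalfPlane.im atImInfty atTop)
  have h2 : (fun z : ℍ => LL z ^ k) = fun z : ℍ =>
      ((-2 * Real.pi : ℝ) : ℂ) ^ k * ((z.im ^ k : ℝ) : ℂ) := by
    funext z
    rw [LL]
    push_cast
    rw [mul_zpow]
  rw [h2]
  refine Asymptotics.IsBigO.const_mul_left ?_ _
  rw [← Asymptotics.isBigO_norm_left]
  simp only [Complex.norm_real]
  rw [Asymptotics.isBigO_norm_left]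
  exact h1

theorem expGrowth_nome_zpow (k : ℤ) : ExpGrowth fun z => nome z ^ k := by
  refine ⟨-(2 * Real.pi * k), ?_⟩
  refine Asymptotics.IsBigO.of_bound 1 (Eventually.of_forall fun z => ?_)
  rw [norm_zpow, norm_nome, real_exp_zpow, one_mul, Real.norm_of_nonneg (Real.exp_pos _).le]
  exact le_of_eq (by ring_nf)

theorem eventually_atImInfty_le_im (A : ℝ) : ∀ᶠ z : ℍ in atImInfty, A ≤ z.im :=
  tendsto_comap.eventually (eventually_ge_atTop A)

/-- A series in powers of `|q|` with exponents bounded below by `-N` is `O(|q|^(-N))`. -/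
theorem exists_bound_of_exponents {ι : Type*} {c : ι → ℂ} {e : ι → ℤ} {N : ℤ}
    (he : ∀ i, c i ≠ 0 → -N ≤ e i)
    (hc : Summable fun i => ‖c i‖ * ‖nome UpperHalfPlane.I‖ ^ e i) :
    ∃ C : ℝ, ∀ z : ℍ, 1 ≤ z.im → Summable (fun i => ‖c i‖ * ‖nome z‖ ^ e i) ∧
      ∑' i, ‖c i‖ * ‖nome z‖ ^ e i ≤ C * ‖nome z‖ ^ (-N) := by
  have hpos : ∀ z : ℍ, 0 < ‖nome z‖ := fun z => norm_pos_iff.mpr (nome_ne_zero z)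
  set t := ‖nome UpperHalfPlane.I‖ with ht
  -- For im z ≥ 1 the nonnegative power |q|^{e i + N} is at most its value at z = i; summing gives
  -- this constant.
  refine ⟨(∑' i, ‖c i‖ * t ^ e i) * t ^ N, fun z hz => ?_⟩
  have hle : ‖nome z‖ ≤ t := by
    rw [ht, norm_nome, norm_nome]
    gcongr
    simpa using hz
  have hterm : ∀ i, ‖c i‖ * ‖nome z‖ ^ e i ≤ ‖c i‖ * t ^ e i * (t ^ N * ‖nome z‖ ^ (-N)) := by
    intro i
    by_cases h0 : c i = 0
    · simp [h0]
    · obtain ⟨j, hj⟩ := Int.eq_ofNat_of_zero_le (sub_nonneg.mpr (he i h0))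
      have e1 : e i = (j : ℤ) + (-N) := by omega
      rw [e1, zpow_add₀ (hpos z).ne', zpow_add₀ (hpos _).ne', zpow_natCast, zpow_natCast]
      have : t ^ (-N) * t ^ N = 1 := by rw [← zpow_add₀ (hpos _).ne']; simp
      calc ‖c i‖ * (‖nome z‖ ^ j * ‖nome z‖ ^ (-N)) ≤ ‖c i‖ * (t ^ j * ‖nome z‖ ^ (-N)) := by
            have := hpos z
            gcongr
        _ = ‖c i‖ * (t ^ j * (t ^ (-N) * t ^ N) * ‖nome z‖ ^ (-N)) := by rw [this, mul_one]
        _ = _ := by ring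
  have hs := hc.mul_right (t ^ N * ‖nome z‖ ^ (-N))
  have hsum : Summable fun i => ‖c i‖ * ‖nome z‖ ^ e i :=
    hs.of_nonneg_of_le (fun i => by have := hpos z; positivity) hterm
  refine ⟨hsum, (hsum.tsum_le_tsum hterm hs).trans_eq ?_⟩
  rw [tsum_mul_right]
  ring

theorem HasQExpansion.exists_bound {f : ℍ → ℂ} {a : ℤ → ℂ} (h : HasQExpansion f a) {N : ℤ}
    (hN : ∀ m, m < -N → a m = 0) :
    ∃ C : ℝ, ∀ z : ℍ, 1 ≤ z.im → ‖f z‖ ≤ C * ‖nome z‖ ^ (-N) := by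
  have h1 := h.summable_norm UpperHalfPlane.I
  simp only [norm_mul, norm_zpow] at h1
  obtain ⟨C, hC⟩ := exists_bound_of_exponents (e := fun m : ℤ => m) (N := N)
    (fun m hm => not_lt.mp fun hlt => hm (hN m hlt)) h1
  refine ⟨C, fun z hz => ?_⟩
  obtain ⟨hs, hle⟩ := hC z hz
  rw [← (h.2 z).tsum_eq]
  refine (norm_tsum_le_tsum_norm (h.summable_norm z)).trans ?_
  simpa only [norm_mul, norm_zpow] using hle

theorem HasQExpansion.expGrowth {f : ℍ → ℂ} {a : ℤ → ℂ} (h : HasQExpansion f a) : ExpGrowth f := by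
  obtain ⟨N, hN⟩ := h.1
  obtain ⟨C, hC⟩ := h.exists_bound hN
  obtain ⟨K, hK⟩ := expGrowth_nome_zpow (-N)
  refine ⟨K, Asymptotics.IsBigO.trans ?_ hK⟩
  refine Asymptotics.IsBigO.of_bound C ?_
  filter_upwards [eventually_atImInfty_le_im 1] with z hz
  simpa using hC z hz

theorem tendsto_nome : Tendsto nome atImInfty (nhds 0) := by
  rw [tendsto_zero_iff_norm_tendsto_zero]
  simp only [norm_nome]
  refine Real.tendsto_exp_neg_atTop_nhds_zero.comp ?_
  exact Tendsto.const_mul_atTop (by positivity) tendsto_comap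

/-- The leading coefficient of a `q`-expansion as a limit at the cusp. -/
theorem HasQExpansion.coeff_eq_of_tendsto {f : ℍ → ℂ} {a : ℤ → ℂ} (h : HasQExpansion f a)
    (hf : Continuous f) {m : ℤ} {c : ℂ}
    (hc : Tendsto (fun z => f z * nome z ^ (-m)) atImInfty (nhds c)) : a m = c := by
  have hcont : Continuous fun z => f z * nome z ^ (-m) :=
    hf.mul (continuous_nome.zpow₀ _ fun z => Or.inl (nome_ne_zero z))
  rw [← sub_eq_zero, ← norm_le_zero_iff]
  refine le_of_forall_pos_le_add fun ε hε => ?_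
  rw [Metric.tendsto_nhds] at hc
  have := hc ε hε
  rw [Filter.Eventually, atImInfty_mem] at this
  obtain ⟨A, hA⟩ := this
  have hy : 0 < max A 1 := lt_max_of_lt_right one_pos
  -- The coefficient is the mean of f q^{-m} over every horizontal line, so a line high enough puts
  -- it within ε of the limit.
  have e : a m - c = zeroMode (fun z => f z * nome z ^ (-m) - c) (max A 1) := by
    rw [zeroMode_sub hcont continuous_const hy, h.coeff_eq_zeroMode m hy]
    simp [zeroMode]
  rw [e, zero_add]
  refine norm_zeroMode_le hy fun z hz => ?_
  have := hA z (by rw [hz]; exact le_max_left _ _)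
  rw [← dist_eq_norm]
  exact le_of_lt this

theorem HasQExpansion.coeff_eq_zero_of_tendsto {f : ℍ → ℂ} {a : ℤ → ℂ} (h : HasQExpansion f a)
    (hf : Continuous f) {m j : ℤ} {c : ℂ} (hj : j < m)
    (hc : Tendsto (fun z => f z * nome z ^ (-m)) atImInfty (nhds c)) : a j = 0 := by
  refine h.coeff_eq_of_tendsto hf ?_
  obtain ⟨t, ht⟩ := Int.eq_ofNat_of_zero_le (sub_nonneg.mpr hj.le)
  have ht0 : t ≠ 0 := by omega
  have h2 := hc.mul (tendsto_nome.pow t)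
  rw [zero_pow ht0, mul_zero] at h2
  refine h2.congr fun z => ?_
  rw [mul_assoc, ← zpow_natCast, ← zpow_add₀ (nome_ne_zero z)]
  congr 2
  omega

/-- Multiplying by q^N with N ≥ K/(2π) makes f bounded at the cusp; the ordinary q-expansion of the
product is then shifted back by N. -/
theorem hasQExpansion_of_expGrowth {f : ℍ → ℂ} (hf : MDifferentiable 𝓘(ℂ) 𝓘(ℂ) f)
    (hper : Function.Periodic (f ∘ ofComplex) 1) (hg : ExpGrowth f) : ∃ a, HasQExpansion f a := by
  obtain ⟨K, hK⟩ := hg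
  obtain ⟨N, hN⟩ := exists_nat_ge (K / (2 * Real.pi))
  have hq : ∀ z : ℍ, nome z = Function.Periodic.qParam 1 z := fun z => by
    simp [nome, Function.Periodic.qParam]
  set g : ℍ → ℂ := fun z => f z * nome z ^ N with hgdef
  have hnome : MDifferentiable 𝓘(ℂ) 𝓘(ℂ) nome := by
    rw [UpperHalfPlane.mdifferentiable_iff]
    refine DifferentiableOn.congr (f := fun z => Complex.exp (2 * Real.pi * Complex.I * z)) ?_ ?_
    · fun_prop
    · intro z hz
      simp [nome, coe_ofComplex hz]
  have hgd : MDifferentiable 𝓘(ℂ) 𝓘(ℂ) g := hf.mul (hnome.pow N)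
  have hgper : Function.Periodic (g ∘ ofComplex) ((1 : ℝ) : ℂ) := by
    intro w
    have h1 := hper w
    simp only [Function.comp_apply, hgdef, Complex.ofReal_one] at h1 ⊢
    rw [h1]
    by_cases hw : 0 < w.im
    · have hw' : 0 < (w + 1).im := by simpa using hw
      congr 2
      rw [nome, nome, coe_ofComplex hw, coe_ofComplex hw', mul_add, Complex.exp_add, mul_one,
        Complex.exp_two_pi_mul_I, mul_one]
    · rw [ofComplex_apply_eq_of_im_nonpos (w := w + 1) (w' := w) (by simpa using hw)
        (by simpa using hw)]
  have hbd : IsBoundedAtImInfty g := by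
    have h1 : (fun z => nome z ^ N) =O[atImInfty] fun z : ℍ => Real.exp (-K * z.im) := by
      refine Asymptotics.IsBigO.of_bound 1 (Eventually.of_forall fun z => ?_)
      rw [norm_pow, norm_nome, ← Real.exp_nat_mul, one_mul,
        Real.norm_of_nonneg (Real.exp_pos _).le]
      refine Real.exp_le_exp.mpr ?_
      rw [div_le_iff₀ (by positivity)] at hN
      nlinarith [z.im_pos]
    have h2 := hK.mul h1
    simp only [← Real.exp_add, ← add_mul, add_neg_cancel, zero_mul, Real.exp_zero] at h2
    exact h2
  have hs := hasSum_qExpansion one_pos hgper hgd hbd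
  refine ⟨fun m => if 0 ≤ m + N then (qExpansion 1 g).coeff (m + N).toNat else 0,
    ⟨N, fun m hm => if_neg (by omega)⟩, fun z => ?_⟩
  have h3 := (hs z).mul_right (nome z ^ (-(N : ℤ)))
  have h4 : g z * nome z ^ (-(N : ℤ)) = f z := by
    rw [hgdef, zpow_neg, zpow_natCast, mul_inv_cancel_right₀ (pow_ne_zero _ (nome_ne_zero z))]
  rw [h4] at h3
  have hinj : Function.Injective fun j : ℕ => (j : ℤ) - N := fun i j hij => by
    simpa using hij
  rw [← hinj.hasSum_iff]
  · convert! h3 using 2 with j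
    simp [← hq, mul_assoc, zpow_sub₀ (nome_ne_zero z), div_eq_mul_inv]
  · intro m hm
    have h0 : ¬ 0 ≤ m + N := fun h0 => hm ⟨(m + N).toNat, by simp [h0]⟩
    simp [h0]

/-- Termwise differentiation of `q`-expansions. -/
theorem HasQExpansion.normalizedDeriv {f : ℍ → ℂ} {a : ℤ → ℂ} (h : HasQExpansion f a) :
    MDifferentiable 𝓘(ℂ) 𝓘(ℂ) f ∧
      HasQExpansion (Derivative.normalizedDerivOfComplex f) (fun m => m * a m) := by
  have hF : ∀ m : ℤ, Differentiable ℂ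
      fun w : ℂ => a m * Complex.exp (2 * Real.pi * Complex.I * w) ^ m := by
    intro m w
    simp only [← Complex.exp_int_mul]
    fun_prop
  have hderiv : ∀ (m : ℤ) (w : ℂ),
      deriv (fun w : ℂ => a m * Complex.exp (2 * Real.pi * Complex.I * w) ^ m) w =
        2 * Real.pi * Complex.I * (m * a m * Complex.exp (2 * Real.pi * Complex.I * w) ^ m) := by
    intro m w
    simp only [← Complex.exp_int_mul]
    have := (((hasDerivAt_id w).const_mul (2 * Real.pi * Complex.I)).const_mul (m : ℂ)).cexp
    have := (this.const_mul (a m)).deriv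
    simp only [id_eq] at this
    rw [this]
    ring
  have key : ∀ z : ℍ, DifferentiableAt ℂ (f ∘ ofComplex) z ∧
      HasSum (fun m : ℤ => (m : ℂ) * a m * nome z ^ m)
        (Derivative.normalizedDerivOfComplex f z) := by
    intro z
    -- On this strip |q^m| is largest at the lower edge for m ≥ 0 and at the upper edge for m ≤ 0.
    -- The sum of the two edge values is therefore a majorant for either sign.
    let U : Set ℂ := {w | z.im / 2 < w.im ∧ w.im < 2 * z.im}
    have hz := z.im_pos
    have hUo : IsOpen U := (isOpen_lt continuous_const Complex.continuous_im).inter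
      (isOpen_lt Complex.continuous_im continuous_const)
    have hzU : (z : ℂ) ∈ U := by
      simp only [U, Set.mem_ofPred_eq, UpperHalfPlane.coe_im]
      constructor <;> linarith
    let z₁ : ℍ := ofComplex (((0 : ℝ) : ℂ) + (z.im / 2 : ℝ) * Complex.I)
    let z₂ : ℍ := ofComplex (((0 : ℝ) : ℂ) + (2 * z.im : ℝ) * Complex.I)
    have h1 : z₁.im = z.im / 2 := im_ofComplex_line _ (by positivity)
    have h2 : z₂.im = 2 * z.im := im_ofComplex_line _ (by positivity)
    have hu := (h.summable_norm z₁).add (h.summable_norm z₂)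
    have hle : ∀ (m : ℤ) (w : ℂ), w ∈ U →
        ‖a m * Complex.exp (2 * Real.pi * Complex.I * w) ^ m‖ ≤
          ‖a m * nome z₁ ^ m‖ + ‖a m * nome z₂ ^ m‖ := by
      intro m w hw
      have e1 : ‖Complex.exp (2 * Real.pi * Complex.I * w)‖ = Real.exp (-(2 * Real.pi * w.im)) := by
        rw [Complex.norm_exp]
        simp
      rw [norm_mul, norm_mul, norm_mul, norm_zpow, norm_zpow, norm_zpow, ← mul_add, norm_nome,
        norm_nome, e1, h1, h2, real_exp_zpow, real_exp_zpow, real_exp_zpow]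
      refine mul_le_mul_of_nonneg_left ?_ (norm_nonneg _)
      obtain ⟨hw1, hw2⟩ := hw
      have hpi := Real.pi_pos
      rcases le_total 0 m with hm | hm
      · have hm' : (0 : ℝ) ≤ m := by exact_mod_cast hm
        refine le_add_of_le_of_nonneg (Real.exp_le_exp.mpr ?_) (Real.exp_pos _).le
        refine mul_le_mul_of_nonneg_left ?_ hm'
        nlinarith
      · have hm' : (m : ℝ) ≤ 0 := by exact_mod_cast hm
        refine le_add_of_nonneg_of_le (Real.exp_pos _).le (Real.exp_le_exp.mpr ?_)
        refine mul_le_mul_of_nonpos_left ?_ hm'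
        nlinarith
    have hd := Complex.differentiableOn_tsum_of_summable_norm hu
      (fun m => (hF m).differentiableOn) hUo hle
    have hs := Complex.hasSum_deriv_of_summable_norm hu (fun m => (hF m).differentiableOn) hUo hle
      hzU
    have heq : f ∘ ofComplex =ᶠ[nhds (z : ℂ)]
        fun w => ∑' m : ℤ, a m * Complex.exp (2 * Real.pi * Complex.I * w) ^ m := by
      filter_upwards [hUo.mem_nhds hzU] with w hw
      have hw0 : 0 < w.im := lt_trans (by positivity) hw.1
      have := (h.2 (ofComplex w)).tsum_eq
      rw [Function.comp_apply, ← this]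
      simp [nome, coe_ofComplex hw0]
    refine ⟨(hd.differentiableAt (hUo.mem_nhds hzU)).congr_of_eventuallyEq heq, ?_⟩
    rw [Derivative.normalizedDerivOfComplex, heq.deriv_eq]
    have hs2 := hs.mul_left (2 * Real.pi * Complex.I)⁻¹
    convert! hs2 using 2 with m
    rw [hderiv, nome, inv_mul_cancel_left₀ (by simp [Real.pi_ne_zero])]
  refine ⟨fun z => mdifferentiableAt_iff.mpr (key z).1, ?_, fun z => (key z).2⟩
  obtain ⟨N, hN⟩ := h.1
  exact ⟨N, fun m hm => by simp [hN m hm]⟩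

theorem HasQExpansion.iterate_normalizedDeriv {f : ℍ → ℂ} {a : ℤ → ℂ} (h : HasQExpansion f a)
    (k : ℕ) :
    HasQExpansion (Derivative.normalizedDerivOfComplex^[k] f) (fun m => (m : ℂ) ^ k * a m) := by
  induction k with
  | zero => simpa using h
  | succ k ih =>
    rw [Function.iterate_succ_apply']
    convert! ih.normalizedDeriv.2 using 2 with m
    ring

/-! ### Expansions in `𝕃`, `q` and `q̄` -/

theorem norm_nome_zpow_mul_conj (z : ℍ) (c : ℂ) (i j : ℤ) :
    ‖c * nome z ^ i * conj (nome z) ^ j‖ = ‖c‖ * ‖nome z‖ ^ (i + j) := by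
  rw [norm_mul, norm_mul, norm_zpow, norm_zpow, Complex.norm_conj,
    zpow_add₀ (norm_ne_zero_iff.mpr (nome_ne_zero z)), mul_assoc]

/-- This growth of X_{n,0} is what gives the second defect form at worst a pole at the cusp. The
exponents of |q| are the sums i + j ≥ -2N, and the finitely many powers of 𝕃 are themselves of
exponential growth. -/
theorem HasLExpansion.expGrowth {F : ℍ → ℂ} {a : ℤ → ℤ → ℤ → ℂ} (h : HasLExpansion F a) :
    ExpGrowth F := by
  obtain ⟨M, N, hMN, hF⟩ := h
  have hsum : ∀ z k, Summable fun p : ℤ × ℤ => ‖a k p.1 p.2‖ * ‖nome z‖ ^ (p.1 + p.2) := by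
    intro z k
    obtain ⟨S, hS, -⟩ := hF z
    simpa only [norm_nome_zpow_mul_conj] using (hS k).summable.norm
  have hFz : F = fun z => ∑ k ∈ Finset.Icc (-M) M, LL z ^ k *
      ∑' p : ℤ × ℤ, a k p.1 p.2 * nome z ^ p.1 * conj (nome z) ^ p.2 := by
    funext z
    obtain ⟨S, hS, hz⟩ := hF z
    rw [hz]
    exact Finset.sum_congr rfl fun k _ => by rw [(hS k).tsum_eq]
  rw [hFz]
  refine ExpGrowth.sum _ fun k _ => (expGrowth_LL_zpow k).mul ?_
  obtain ⟨C, hC⟩ := exists_bound_of_exponents (c := fun p : ℤ × ℤ => a k p.1 p.2)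
    (e := fun p => p.1 + p.2) (N := 2 * N)
    (fun p hp => by have := hMN k p.1 p.2 hp; omega) (hsum UpperHalfPlane.I k)
  obtain ⟨K, hK⟩ := expGrowth_nome_zpow (-(2 * N))
  refine ⟨K, Asymptotics.IsBigO.trans ?_ hK⟩
  refine Asymptotics.IsBigO.of_bound C ?_
  filter_upwards [eventually_atImInfty_le_im 1] with z hz
  refine (norm_tsum_le_tsum_norm ?_).trans ?_
  · simpa only [norm_nome_zpow_mul_conj] using hsum z k
  · simpa only [norm_nome_zpow_mul_conj, norm_zpow] using (hC z hz).2

/-- The zeroth Fourier mode of an expansion is given by its diagonal terms. -/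
theorem hasSum_zeroMode {F : ℍ → ℂ} {a : ℤ → ℤ → ℤ → ℂ} {M : ℤ}
    (hF : ∀ z : ℍ, ∃ S : ℤ → ℂ,
      (∀ k, HasSum (fun p : ℤ × ℤ => a k p.1 p.2 * nome z ^ p.1 * conj (nome z) ^ p.2) (S k)) ∧
      F z = ∑ k ∈ Finset.Icc (-M) M, LL z ^ k * S k) {y : ℝ} (hy : 0 < y) :
    (∀ k, Summable fun i : ℤ => a k i i * Complex.exp (-(4 * Real.pi * y)) ^ i) ∧
    HasSum (fun i : ℤ => ∑ k ∈ Finset.Icc (-M) M, ((-2 * Real.pi * y : ℝ) : ℂ) ^ k *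
      (a k i i * Complex.exp (-(4 * Real.pi * y)) ^ i)) (zeroMode F y) := by
  have hexp : Complex.exp (-(2 * Real.pi * y)) ≠ 0 := Complex.exp_ne_zero _
  have key : ∀ (k : ℤ) (p : ℤ × ℤ) (x : ℝ),
      a k p.1 p.2 * nome (ofComplex ((x : ℂ) + y * Complex.I)) ^ p.1 *
        conj (nome (ofComplex ((x : ℂ) + y * Complex.I))) ^ p.2 =
      a k p.1 p.2 * Complex.exp (-(2 * Real.pi * y)) ^ (p.1 + p.2) *
        Complex.exp (2 * Real.pi * Complex.I * ((p.1 - p.2 : ℤ) : ℂ) * x) := by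
    intro k p x
    rw [nome_line x hy, map_mul, ← Complex.exp_conj, ← Complex.exp_conj]
    simp only [map_neg, map_mul, Complex.conj_ofReal, Complex.conj_I, map_ofNat]
    rw [mul_zpow, mul_zpow, zpow_add₀ hexp, ← Complex.exp_int_mul (2 * Real.pi * Complex.I * x),
      ← Complex.exp_int_mul (2 * Real.pi * -Complex.I * x)]
    have : Complex.exp (2 * Real.pi * Complex.I * ((p.1 - p.2 : ℤ) : ℂ) * x) =
        Complex.exp (p.1 * (2 * Real.pi * Complex.I * x)) *
          Complex.exp (p.2 * (2 * Real.pi * -Complex.I * x)) := by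
      rw [← Complex.exp_add]
      push_cast
      ring_nf
    rw [this]
    ring
  have hdiag : Function.Injective fun i : ℤ => (i, i) := fun i j h => by simpa using h
  have hnorm : ∀ k, Summable fun p : ℤ × ℤ =>
      ‖a k p.1 p.2 * Complex.exp (-(2 * Real.pi * y)) ^ (p.1 + p.2)‖ := by
    intro k
    obtain ⟨S, hS, -⟩ := hF (ofComplex (((0 : ℝ) : ℂ) + y * Complex.I))
    have := (hS k).summable.norm
    simp only [key] at this
    simpa using this
  have hsq : ∀ i : ℤ, Complex.exp (-(2 * Real.pi * y)) ^ (i + i) =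
      Complex.exp (-(4 * Real.pi * y)) ^ i := by
    intro i
    rw [← Complex.exp_int_mul, ← Complex.exp_int_mul]
    push_cast
    ring_nf
  refine ⟨fun k => ?_, ?_⟩
  · have := (hnorm k).of_norm.comp_injective hdiag
    simpa only [Function.comp_def, hsq] using this
  · have h1 := hasSum_integral_of_frequencies
      (c := fun p : ℤ × ℤ => ∑ k ∈ Finset.Icc (-M) M, ((-2 * Real.pi * y : ℝ) : ℂ) ^ k *
        (a k p.1 p.2 * Complex.exp (-(2 * Real.pi * y)) ^ (p.1 + p.2)))
      (e := fun p => p.1 - p.2)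
      (F := fun x => F (ofComplex ((x : ℂ) + y * Complex.I)))
      (by
        refine Summable.norm (summable_sum fun k _ => ?_)
        exact (hnorm k).of_norm.mul_left _) (fun x => by
        obtain ⟨S, hS, hz⟩ := hF (ofComplex ((x : ℂ) + y * Complex.I))
        simp only [hz]
        have := hasSum_sum (s := Finset.Icc (-M) M) fun k _ =>
          (hS k).mul_left (LL (ofComplex ((x : ℂ) + y * Complex.I)) ^ k)
        convert! this using 2 with p
        rw [Finset.sum_mul]
        refine Finset.sum_congr rfl fun k _ => ?_
        rw [key, LL_line x hy]
        ring)
    rw [zeroMode]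
    rw [← hdiag.hasSum_iff] at h1
    · convert! h1 using 2 with i
      simp [hsq]
    · intro p hp
      refine if_neg fun h => hp ⟨p.1, ?_⟩
      ext
      · rfl
      · simp only
        omega

/-- A convergent series `∑ᵢ ∑ₖ L^k c k i e^(-4πiy)`, `L = -2πy`, which vanishes identically has
vanishing coefficients. -/
theorem eq_zero_of_hasSum_zero {c : ℤ → ℤ → ℂ} {M N : ℤ}
    (hc : ∀ k i, c k i ≠ 0 → |k| ≤ M ∧ -N ≤ i)
    (hs : ∀ y : ℝ, 0 < y → ∀ k,
      Summable fun i : ℤ => c k i * Complex.exp (-(4 * Real.pi * y)) ^ i)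
    (h0 : ∀ y : ℝ, 0 < y → HasSum (fun i : ℤ => ∑ k ∈ Finset.Icc (-M) M,
      ((-2 * Real.pi * y : ℝ) : ℂ) ^ k * (c k i * Complex.exp (-(4 * Real.pi * y)) ^ i)) 0) :
    ∀ k i, c k i = 0 := by
  by_contra hne
  push Not at hne
  obtain ⟨k₁, i₁, hki⟩ := hne
  -- The dominant term as y → ∞ has the least exponent i₀ of e^{-4πy} and, for that i₀, the greatest
  -- power K of y. Dividing by its size leaves a series with limit c K i₀, which must therefore be
  -- zero.
  obtain ⟨i₀, ⟨k₂, hk₂⟩, hmin⟩ := Int.exists_least_of_bdd (P := fun i => ∃ k, c k i ≠ 0)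
    ⟨-N, fun i ⟨k, hk⟩ => (hc k i hk).2⟩ ⟨i₁, k₁, hki⟩
  obtain ⟨K, hK, hmax⟩ := Int.exists_greatest_of_bdd (P := fun k => c k i₀ ≠ 0)
    ⟨M, fun k hk => (abs_le.mp (hc k i₀ hk).1).2⟩ ⟨k₂, hk₂⟩
  have hKM : K ∈ Finset.Icc (-M) M := Finset.mem_Icc.mpr (abs_le.mp (hc K i₀ hK).1)
  have hexp : ∀ y : ℝ, Complex.exp (-(4 * Real.pi * y)) ≠ 0 := fun y => Complex.exp_ne_zero _
  have hL : ∀ y : ℝ, 0 < y → ((-2 * Real.pi * y : ℝ) : ℂ) ≠ 0 := fun y hy => by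
    rw [Complex.ofReal_ne_zero]
    have := Real.pi_pos
    have : 0 < 2 * Real.pi * y := by positivity
    linarith
  -- the normalized terms
  let T : ℝ → ℤ → ℂ := fun y i => ∑ k ∈ Finset.Icc (-M) M,
    ((-2 * Real.pi * y : ℝ) : ℂ) ^ (k - K) * (c k i * Complex.exp (-(4 * Real.pi * y)) ^ (i - i₀))
  have hT : ∀ y : ℝ, 0 < y → HasSum (T y) 0 := by
    intro y hy
    have := (h0 y hy).mul_right
      (((-2 * Real.pi * y : ℝ) : ℂ) ^ (-K) * Complex.exp (-(4 * Real.pi * y)) ^ (-i₀))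
    rw [zero_mul] at this
    convert! this using 2 with i
    rw [Finset.sum_mul]
    refine Finset.sum_congr rfl fun k _ => ?_
    rw [sub_eq_add_neg, sub_eq_add_neg, zpow_add₀ (hL y hy), zpow_add₀ (hexp y)]
    ring
  -- elementary limits
  have hLtop : Tendsto (fun y : ℝ => 2 * Real.pi * y) atTop atTop :=
    Tendsto.const_mul_atTop (by positivity) tendsto_id
  have hnormL : ∀ y : ℝ, 0 < y → ‖((-2 * Real.pi * y : ℝ) : ℂ)‖ = 2 * Real.pi * y := by
    intro y hy
    rw [Complex.norm_real, Real.norm_eq_abs, neg_mul, neg_mul, abs_neg, abs_of_pos]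
    positivity
  have hnormE : ∀ y : ℝ, ‖Complex.exp (-(4 * Real.pi * y))‖ = Real.exp (-(4 * Real.pi * y)) := by
    intro y
    rw [Complex.norm_exp]
    simp
  -- A power of y costs at most a factor e^{2πy}, half of the decay e^{-4πy} by which any i > i₀ is
  -- separated from i₀.
  have hbound : ∀ k : ℤ, ∃ B : ℝ, 0 ≤ B ∧ ∀ᶠ y : ℝ in atTop,
      (2 * Real.pi * y) ^ k ≤ B * Real.exp (2 * Real.pi * y) := by
    intro k
    have h1 := ((isLittleO_zpow_exp_pos_mul_atTop k one_pos).isBigO.comp_tendsto hLtop).bound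
    obtain ⟨B, hB⟩ := h1
    refine ⟨|B|, abs_nonneg B, ?_⟩
    filter_upwards [hB] with y hy
    simp only [Function.comp_apply, one_mul] at hy
    refine (le_abs_self _).trans (hy.trans ?_)
    rw [Real.norm_of_nonneg (Real.exp_pos _).le]
    gcongr
    exact le_abs_self B
  choose B hB0 hB using hbound
  have hBall : ∀ᶠ y : ℝ in atTop, ∀ k ∈ Finset.Icc (-M) M,
      (2 * Real.pi * y) ^ (k - K) ≤ B (k - K) * Real.exp (2 * Real.pi * y) := by
    rw [eventually_all_finset]
    exact fun k _ => hB (k - K)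
  have hlim : Tendsto (fun y => ∑' i, T y i) atTop
      (nhds (∑' i : ℤ, if i = i₀ then c K i₀ else 0)) := by
    -- The majorant is the series at height 1/2: for i > i₀ and y ≥ 1 one has e^{2πy - 4πy(i - i₀)}
    -- ≤ e^{-2π(i - i₀)}. The summand 1 in 1 + B covers i = i₀, where only k ≤ K occurs.
    refine tendsto_tsum_of_dominated_convergence
      (bound := fun i : ℤ => ∑ k ∈ Finset.Icc (-M) M, (1 + B (k - K)) *
        (‖c k i * Complex.exp (-(4 * Real.pi * ((1 / 2 : ℝ) : ℂ))) ^ i‖ *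
          Real.exp (2 * Real.pi * i₀))) ?_ ?_ ?_
    · refine summable_sum fun k _ => Summable.mul_left _ (Summable.mul_right _ ?_)
      exact (hs (1 / 2) (by norm_num) k).norm
    · intro i
      by_cases hi : i = i₀
      · subst hi
        rw [if_pos rfl]
        have : (c K i) = ∑ k ∈ Finset.Icc (-M) M, if k = K then c K i else 0 := by
          rw [Finset.sum_ite_eq' _ _ _, if_pos hKM]
        rw [this]
        refine tendsto_finsetSum _ fun k _ => ?_
        simp only [sub_self, zpow_zero, mul_one]
        by_cases hk : k = K
        · subst hk
          simp
        · rw [if_neg hk]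
          by_cases hck : c k i = 0
          · simp [hck]
          · have hlt : k < K := lt_of_le_of_ne (hmax k hck) hk
            rw [← zero_mul (c k i)]
            refine Tendsto.mul_const _ ?_
            rw [tendsto_zero_iff_norm_tendsto_zero]
            have h2 := (tendsto_zpow_atTop_zero (𝕜 := ℝ) (n := k - K) (by omega)).comp hLtop
            refine h2.congr' ?_
            filter_upwards [eventually_gt_atTop 0] with y hy
            rw [norm_zpow, hnormL y hy, Function.comp_apply]
      · rw [if_neg hi]
        have : (0 : ℂ) = ∑ k ∈ Finset.Icc (-M) M, 0 := by simp
        rw [this]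
        refine tendsto_finsetSum _ fun k _ => ?_
        by_cases hck : c k i = 0
        · simp [hck]
        have hlt : i₀ < i := lt_of_le_of_ne (hmin i ⟨k, hck⟩) (Ne.symm hi)
        obtain ⟨t, ht⟩ := Int.eq_ofNat_of_zero_le (sub_nonneg.mpr hlt.le)
        have ht1 : (1 : ℝ) ≤ t := by exact_mod_cast (by omega : 1 ≤ t)
        rw [tendsto_zero_iff_norm_tendsto_zero]
        have h3 : Tendsto (fun y : ℝ => B (k - K) * ‖c k i‖ * Real.exp (-(2 * Real.pi * y))) atTop
            (nhds 0) := by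
          have := (Real.tendsto_exp_neg_atTop_nhds_zero.comp hLtop).const_mul (B (k - K) * ‖c k i‖)
          simpa using this
        refine squeeze_zero' (Eventually.of_forall fun y => norm_nonneg _) ?_ h3
        filter_upwards [eventually_gt_atTop 0, hB (k - K)] with y hy hBy
        rw [norm_mul, norm_mul, norm_zpow, norm_zpow, hnormL y hy, hnormE, ht, zpow_natCast,
          ← Real.exp_nat_mul]
        have h4 : Real.exp (t * -(4 * Real.pi * y)) ≤ Real.exp (-(4 * Real.pi * y)) := by
          refine Real.exp_le_exp.mpr ?_
          have : 0 < 4 * Real.pi * y := by positivity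
          nlinarith
        have h5 : Real.exp (-(4 * Real.pi * y)) =
            Real.exp (-(2 * Real.pi * y)) * Real.exp (-(2 * Real.pi * y)) := by
          rw [← Real.exp_add]
          ring_nf
        calc (2 * Real.pi * y) ^ (k - K) * (‖c k i‖ * Real.exp (t * -(4 * Real.pi * y)))
            ≤ B (k - K) * Real.exp (2 * Real.pi * y) * (‖c k i‖ *
              (Real.exp (-(2 * Real.pi * y)) * Real.exp (-(2 * Real.pi * y)))) := by
              rw [← h5]
              have := hB0 (k - K)
              gcongr
          _ = B (k - K) * ‖c k i‖ * (Real.exp (2 * Real.pi * y) * Real.exp (-(2 * Real.pi * y))) *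
              Real.exp (-(2 * Real.pi * y)) := by ring
          _ = _ := by rw [← Real.exp_add]; simp
    · filter_upwards [eventually_ge_atTop 1, hBall] with y hy hBy i
      refine (norm_sum_le _ _).trans (Finset.sum_le_sum fun k hk => ?_)
      by_cases hck : c k i = 0
      · simp [hck]
      have hy0 : 0 < y := by linarith
      have hge : i₀ ≤ i := hmin i ⟨k, hck⟩
      have hE : ‖Complex.exp (-(4 * Real.pi * ((1 / 2 : ℝ) : ℂ))) ^ i‖ =
          Real.exp (-(2 * Real.pi * i)) := by
        rw [norm_zpow, hnormE, real_exp_zpow]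
        ring_nf
      rw [norm_mul, norm_mul, norm_mul, norm_zpow, norm_zpow, hnormL y hy0, hnormE, hE,
        real_exp_zpow]
      have hprod : Real.exp (-(2 * Real.pi * i)) * Real.exp (2 * Real.pi * i₀) =
          Real.exp (-(2 * Real.pi * (i - i₀))) := by
        rw [← Real.exp_add]
        ring_nf
      rw [mul_assoc ‖c k i‖, hprod]
      push_cast
      rw [mul_left_comm, mul_left_comm (1 + B (k - K))]
      refine mul_le_mul_of_nonneg_left ?_ (norm_nonneg _)
      rcases hge.eq_or_lt with rfl | hlt
      · have hkK : k ≤ K := hmax k hck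
        have : (2 * Real.pi * y) ^ (k - K) ≤ 1 := by
          refine zpow_le_one_of_nonpos₀ ?_ (by omega)
          have := Real.pi_gt_three
          nlinarith
        have := hB0 (k - K)
        simp only [sub_self, zero_mul, mul_zero, neg_zero, Real.exp_zero, mul_one]
        linarith
      · have h1 : (1 : ℝ) ≤ (i : ℝ) - i₀ := by exact_mod_cast (by omega : (1 : ℤ) ≤ i - i₀)
        have h6 : Real.exp (2 * Real.pi * y) * Real.exp (((i : ℝ) - i₀) * -(4 * Real.pi * y)) ≤
            Real.exp (-(2 * Real.pi * (i - i₀))) := by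
          rw [← Real.exp_add]
          refine Real.exp_le_exp.mpr ?_
          have hpi := Real.pi_pos
          have : y ≤ ((i : ℝ) - i₀) * y := by nlinarith
          have : ((i : ℝ) - i₀) ≤ ((i : ℝ) - i₀) * y := by nlinarith
          nlinarith
        calc (2 * Real.pi * y) ^ (k - K) * Real.exp (((i : ℝ) - i₀) * -(4 * Real.pi * y))
            ≤ B (k - K) * Real.exp (2 * Real.pi * y) *
              Real.exp (((i : ℝ) - i₀) * -(4 * Real.pi * y)) := by
              gcongr
              exact hBy k hk
          _ ≤ B (k - K) * Real.exp (-(2 * Real.pi * (i - i₀))) := by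
              rw [mul_assoc]
              exact mul_le_mul_of_nonneg_left h6 (hB0 _)
          _ ≤ _ := by
              gcongr
              linarith
  have hz : Tendsto (fun y => ∑' i, T y i) atTop (nhds 0) := by
    refine tendsto_const_nhds.congr' ?_
    filter_upwards [eventually_gt_atTop 0] with y hy
    exact (hT y hy).tsum_eq.symm
  rw [tsum_ite_eq] at hlim
  exact hK (tendsto_nhds_unique hlim hz)

/-- The constant part of `F` is determined by its zeroth Fourier mode, if the latter is a Laurent
polynomial in `𝕃`. -/
theorem isConstantPart_of_zeroMode {F : ℍ → ℂ} (hF : ∃ a, HasLExpansion F a) (p : ℂ[T;T⁻¹])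
    (hp : ∀ y : ℝ, 0 < y → zeroMode F y =
      ∑ k ∈ p.coeff.support, p.coeff k * ((-2 * Real.pi * y : ℝ) : ℂ) ^ k) :
    IsConstantPart F p := by
  refine ⟨hF, fun a ha k₀ => ?_⟩
  obtain ⟨M, N, hMN, hS⟩ := ha
  obtain ⟨M', hM'⟩ : ∃ M' : ℤ, M ≤ M' ∧ ∀ k ∈ p.coeff.support, |k| ≤ M' := by
    obtain ⟨B, hB⟩ := (p.coeff.support.image fun k => |k|).bddAbove
    refine ⟨max M B, le_max_left _ _, fun k hk => le_max_of_le_right (hB ?_)⟩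
    exact Finset.mem_coe.mpr (Finset.mem_image_of_mem _ hk)
  have hS' : ∀ z : ℍ, ∃ S : ℤ → ℂ,
      (∀ k, HasSum (fun p : ℤ × ℤ => a k p.1 p.2 * nome z ^ p.1 * conj (nome z) ^ p.2) (S k)) ∧
      F z = ∑ k ∈ Finset.Icc (-M') M', LL z ^ k * S k := by
    intro z
    obtain ⟨S, hs, hz⟩ := hS z
    refine ⟨S, hs, hz.trans (Finset.sum_subset ?_ fun k _ hk => ?_)⟩
    · exact Finset.Icc_subset_Icc (by omega) hM'.1
    · have h0 : ∀ i j, a k i j = 0 := by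
        intro i j
        by_contra hne
        exact hk (Finset.mem_Icc.mpr (abs_le.mp (hMN k i j hne).1))
      have : S k = 0 := by
        refine (hs k).unique ?_
        simp [h0]
      rw [this, mul_zero]
  -- The coefficients of p are subtracted from the diagonal coefficients at i = 0, so that the
  -- resulting series vanishes identically; M' was chosen large enough to include the support of p.
  have key := eq_zero_of_hasSum_zero (c := fun k i => a k i i - if i = 0 then p.coeff k else 0)
    (M := M') (N := max N 0) ?_ ?_ ?_ k₀ 0
  · exact (sub_eq_zero.mp (by simpa using key)).symm
  · intro k i hne
    by_cases hk : a k i i = 0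
    · rw [hk, zero_sub, neg_ne_zero, ite_ne_right_iff] at hne
      exact ⟨hM'.2 k (Finsupp.mem_support_iff.mpr hne.2), by omega⟩
    · have := hMN k i i hk
      omega
  · intro y hy k
    have h1 := (hasSum_zeroMode hS' hy).1 k
    have h2 : Summable fun i : ℤ =>
        (if i = 0 then p.coeff k else 0) * Complex.exp (-(4 * Real.pi * y)) ^ i :=
      summable_of_ne_finset_zero (s := {0}) fun i hi => by
        rw [if_neg (by simpa using hi), zero_mul]
    simpa only [sub_mul] using h1.sub h2
  · intro y hy
    have h1 := (hasSum_zeroMode hS' hy).2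
    have h2 : HasSum (fun i : ℤ => if i = 0 then zeroMode F y else 0) (zeroMode F y) :=
      hasSum_ite_eq 0 _
    have h3 := h1.sub h2
    rw [sub_self] at h3
    convert! h3 using 2 with i
    by_cases hi : i = 0
    · subst hi
      simp only [if_true, zpow_zero, mul_one, mul_sub, Finset.sum_sub_distrib]
      congr 1
      rw [hp y hy]
      symm
      simp only [mul_comm _ (p.coeff _)]
      refine Finset.sum_subset ?_ fun k _ hk => ?_
      · intro k hk
        exact Finset.mem_Icc.mpr (abs_le.mp (hM'.2 k hk))
      · rw [Finsupp.notMem_support_iff.mp hk, zero_mul]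
    · simp [hi]

/-! ### Wirtinger calculus -/

/-- The real-linear map `v ↦ A v + B v̄`. -/
def wirtinger (A B : ℂ) : ℂ →L[ℝ] ℂ :=
  A • (ContinuousLinearMap.id ℝ ℂ) + B • (Complex.conjCLE : ℂ →L[ℝ] ℂ)

theorem wirtinger_apply (A B v : ℂ) : wirtinger A B v = A * v + B * conj v := by
  simp [wirtinger]

/-- `F` is real differentiable at `z` with `∂F/∂z = A` and `∂F/∂z̄ = B`. -/
def HasWirtinger (F : ℍ → ℂ) (A B : ℂ) (z : ℍ) : Prop :=
  HasFDerivAt (F ∘ ofComplex) (wirtinger A B) (z : ℂ)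

namespace HasWirtinger

variable {F G : ℍ → ℂ} {A B A' B' : ℂ} {z : ℍ}

theorem dz_eq (h : HasWirtinger F A B z) : dz F z = A := by
  rw [dz, HasFDerivAt.fderiv h, wirtinger_apply, wirtinger_apply]
  simp only [map_one, Complex.conj_I]
  linear_combination (-A / 2 + B / 2) * Complex.I_mul_I

theorem dzbar_eq (h : HasWirtinger F A B z) : dzbar F z = B := by
  rw [dzbar, HasFDerivAt.fderiv h, wirtinger_apply, wirtinger_apply]
  simp only [map_one, Complex.conj_I]
  linear_combination (A / 2 - B / 2) * Complex.I_mul_I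

theorem differentiableAt (h : HasWirtinger F A B z) : DifferentiableAt ℝ (F ∘ ofComplex) (z : ℂ) :=
  HasFDerivAt.differentiableAt h

theorem congr_deriv (h : HasWirtinger F A B z) (hA : A = A') (hB : B = B') :
    HasWirtinger F A' B' z := hA ▸ hB ▸ h

theorem of_differentiableAt (h : DifferentiableAt ℝ (F ∘ ofComplex) (z : ℂ)) :
    HasWirtinger F (dz F z) (dzbar F z) z := by
  have h1 := h.hasFDerivAt
  refine h1.congr_fderiv ?_
  ext v
  have hv : v = v.re • (1 : ℂ) + v.im • Complex.I := by
    simp [Complex.re_add_im]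
  have hc : conj v = v.re - v.im * Complex.I := by
    rw [Complex.ext_iff]
    simp
  rw [wirtinger_apply, dz, dzbar, hc]
  conv_lhs => rw [hv, map_add, map_smul, map_smul, Complex.real_smul, Complex.real_smul]
  conv_rhs => rw [← Complex.re_add_im v]
  simp only [Complex.add_re, Complex.ofReal_re, Complex.mul_re, Complex.I_re, mul_zero,
    Complex.ofReal_im, Complex.I_im, mul_one, sub_self, add_zero, Complex.add_im, Complex.mul_im,
    zero_add]
  linear_combination (v.im * (fderiv ℝ (F ∘ ofComplex) (z : ℂ)) Complex.I) * Complex.I_mul_I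

theorem add (hF : HasWirtinger F A B z) (hG : HasWirtinger G A' B' z) :
    HasWirtinger (fun w => F w + G w) (A + A') (B + B') z := by
  refine (HasFDerivAt.add hF hG).congr_fderiv ?_
  ext v
  simp only [add_apply, wirtinger_apply]
  ring

theorem mul (hF : HasWirtinger F A B z) (hG : HasWirtinger G A' B' z) :
    HasWirtinger (fun w => F w * G w) (A * G z + F z * A') (B * G z + F z * B') z := by
  refine (HasFDerivAt.mul hF hG).congr_fderiv ?_
  ext v
  simp only [add_apply, smul_apply, wirtinger_apply,
    Function.comp_apply, ofComplex_apply, smul_eq_mul]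
  ring

theorem const (c : ℂ) : HasWirtinger (fun _ => c) 0 0 z := by
  refine (hasFDerivAt_const c (z : ℂ)).congr_fderiv ?_
  ext v
  simp [wirtinger_apply]

theorem const_mul (c : ℂ) (hF : HasWirtinger F A B z) :
    HasWirtinger (fun w => c * F w) (c * A) (c * B) z :=
  ((const c).mul hF).congr_deriv (by simp) (by simp)

theorem sub (hF : HasWirtinger F A B z) (hG : HasWirtinger G A' B' z) :
    HasWirtinger (fun w => F w - G w) (A - A') (B - B') z := by
  simpa [sub_eq_add_neg] using hF.add (hG.const_mul (-1))

theorem sum {ι : Type*} (s : Finset ι) {F : ι → ℍ → ℂ} {A B : ι → ℂ}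
    (h : ∀ i ∈ s, HasWirtinger (F i) (A i) (B i) z) :
    HasWirtinger (fun w => ∑ i ∈ s, F i w) (∑ i ∈ s, A i) (∑ i ∈ s, B i) z := by
  classical
  induction s using Finset.induction_on with
  | empty => simpa using const 0
  | insert i s hi ih =>
    simp only [Finset.sum_insert hi]
    exact (h i (Finset.mem_insert_self i s)).add
      (ih fun j hj => h j (Finset.mem_insert_of_mem hj))

theorem star (hF : HasWirtinger F A B z) :
    HasWirtinger (fun w => (starRingEnd ℂ) (F w)) ((starRingEnd ℂ) B) ((starRingEnd ℂ) A) z := by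
  refine ((Complex.conjCLE : ℂ →L[ℝ] ℂ).hasFDerivAt.comp (z : ℂ) hF).congr_fderiv ?_
  ext v
  simp only [ContinuousLinearMap.comp_apply, wirtinger_apply, ContinuousLinearEquiv.coe_coe,
    Complex.conjCLE_apply, map_add, map_mul, Complex.conj_conj]
  ring

/-- Composition with a holomorphic map. -/
theorem comp_holomorphic {w : ℍ} (hF : HasWirtinger F A B w) {φ : ℂ → ℂ} {c : ℂ}
    (hφ : HasDerivAt φ c z) (hw : φ z = w)
    (hG : G ∘ ofComplex =ᶠ[nhds (z : ℂ)] fun v => F (ofComplex (φ v))) :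
    HasWirtinger G (A * c) (B * (starRingEnd ℂ) c) z := by
  have h1 : HasFDerivAt φ ((ContinuousLinearMap.toSpanSingleton ℂ c).restrictScalars ℝ) (z : ℂ) :=
    hφ.hasFDerivAt.restrictScalars ℝ
  have h2 : HasFDerivAt (F ∘ ofComplex) (wirtinger A B) (φ z) := by
    rw [hw]
    exact hF
  refine ((h2.comp (z : ℂ) h1).congr_of_eventuallyEq hG).congr_fderiv ?_
  ext v
  simp only [ContinuousLinearMap.comp_apply, wirtinger_apply,
    ContinuousLinearMap.coe_restrictScalars', ContinuousLinearMap.toSpanSingleton_apply,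
    smul_eq_mul, map_mul]
  ring

theorem of_hasDerivAt {c : ℂ} (h : HasDerivAt (F ∘ ofComplex) c (z : ℂ)) :
    HasWirtinger F c 0 z := by
  refine (h.hasFDerivAt.restrictScalars ℝ).congr_fderiv ?_
  ext v
  simp [wirtinger_apply, mul_comm]

theorem del_eq (h : HasWirtinger F A B z) (r : ℤ) :
    del r F z = ((z : ℂ) - (starRingEnd ℂ) (z : ℂ)) * A + r * F z := by
  rw [del, h.dz_eq]

theorem delbar_eq (h : HasWirtinger F A B z) (s : ℤ) :
    delbar s F z = ((starRingEnd ℂ) (z : ℂ) - (z : ℂ)) * B + s * F z := by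
  rw [delbar, h.dzbar_eq]

end HasWirtinger

theorem coe_comp_ofComplex_eventuallyEq (z : ℍ) :
    (fun w => ((ofComplex w : ℍ) : ℂ)) =ᶠ[nhds (z : ℂ)] fun w => w :=
  eventuallyEq_coe_comp_ofComplex z.im_pos

theorem hasWirtinger_LL (z : ℍ) :
    HasWirtinger LL (Real.pi * Complex.I) (-(Real.pi * Complex.I)) z := by
  have h1 : HasWirtinger (fun w : ℍ => (w : ℂ)) 1 0 z :=
    HasWirtinger.of_hasDerivAt ((hasDerivAt_id (z : ℂ)).congr_of_eventuallyEq
      (coe_comp_ofComplex_eventuallyEq z))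
  have h2 := (h1.sub h1.star).const_mul (Real.pi * Complex.I)
  have h3 : (fun w : ℍ => Real.pi * Complex.I * ((w : ℂ) - conj (w : ℂ))) = LL :=
    funext fun w => (LL_eq w).symm
  rw [h3] at h2
  exact h2.congr_deriv (by simp) (by simp)

theorem hasWirtinger_LL_zpow (k : ℤ) (z : ℍ) :
    HasWirtinger (fun w => LL w ^ k) (k * LL z ^ (k - 1) * (Real.pi * Complex.I))
      (-(k * LL z ^ (k - 1) * (Real.pi * Complex.I))) z := by
  have h1 : HasDerivAt (fun v : ℂ => v ^ k) (k * LL z ^ (k - 1)) ((LL ∘ ofComplex) (z : ℂ)) := by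
    rw [Function.comp_apply, ofComplex_apply]
    exact hasDerivAt_zpow k (LL z) (Or.inl (LL_ne_zero z))
  have h2 := (h1.hasFDerivAt.restrictScalars ℝ).comp (z : ℂ) (hasWirtinger_LL z)
  refine HasFDerivAt.congr_fderiv h2 ?_
  ext v
  simp only [ContinuousLinearMap.comp_apply, wirtinger_apply,
    ContinuousLinearMap.coe_restrictScalars', ContinuousLinearMap.toSpanSingleton_apply,
    smul_eq_mul]
  ring

theorem hasWirtinger_of_mdifferentiable {f : ℍ → ℂ} (hf : MDifferentiable 𝓘(ℂ) 𝓘(ℂ) f) (z : ℍ) :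
    HasWirtinger f (2 * Real.pi * Complex.I * Derivative.normalizedDerivOfComplex f z) 0 z := by
  have h := (mdifferentiableAt_iff.mp (hf z)).hasDerivAt
  refine (HasWirtinger.of_hasDerivAt h).congr_deriv ?_ rfl
  rw [Derivative.normalizedDerivOfComplex, mul_inv_cancel_left₀]
  simp [Real.pi_ne_zero]

/-- Cauchy–Riemann: `∂F/∂z̄ = 0` implies that `F` is holomorphic. -/
theorem mdifferentiable_of_hasWirtinger {f : ℍ → ℂ} (h : ∀ z, ∃ A, HasWirtinger f A 0 z) :
    MDifferentiable 𝓘(ℂ) 𝓘(ℂ) f := by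
  intro z
  obtain ⟨A, hA⟩ := h z
  rw [mdifferentiableAt_iff, differentiableAt_complex_iff_differentiableAt_real]
  refine ⟨hA.differentiableAt, ?_⟩
  rw [HasFDerivAt.fderiv hA]
  simp [wirtinger_apply, mul_comm]

theorem continuous_of_hasWirtinger {F : ℍ → ℂ} (h : ∀ z, ∃ A B, HasWirtinger F A B z) :
    Continuous F := by
  rw [continuous_iff_continuousAt]
  intro z
  obtain ⟨A, B, hAB⟩ := h z
  have h1 : ContinuousAt (F ∘ ofComplex) (z : ℂ) := hAB.differentiableAt.continuousAt
  have h2 := h1.comp (x := z) (f := fun w : ℍ => (w : ℂ)) continuous_coe.continuousAt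
  simpa [Function.comp_def] using h2

theorem conj_dz (F : ℍ → ℂ) (z : ℍ) : conj (dz F z) = dzbar (fun w => conj (F w)) z := by
  have h : fderiv ℝ ((fun w => conj (F w)) ∘ ofComplex) (z : ℂ) =
      (Complex.conjCLE : ℂ →L[ℝ] ℂ).comp (fderiv ℝ (F ∘ ofComplex) (z : ℂ)) :=
    Complex.conjCLE.comp_fderiv
  rw [dz, dzbar, h]
  simp [map_ofNat]

theorem conj_del (r : ℤ) (F : ℍ → ℂ) (z : ℍ) :
    conj (del r F z) = delbar r (fun w => conj (F w)) z := by
  rw [del, delbar, map_add, map_mul, map_mul, map_sub, Complex.conj_conj, conj_dz]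
  simp

theorem conj_delPow (r : ℤ) (k : ℕ) (F : ℍ → ℂ) (z : ℍ) :
    conj (delPow r k F z) = delbarPow r k (fun w => conj (F w)) z := by
  induction k generalizing z with
  | zero => rfl
  | succ k ih =>
    rw [delPow, delbarPow, conj_del]
    congr 1
    exact funext ih

/-- `∂` and multiplication by powers of `𝕃`. -/
theorem del_LL_zpow_mul (r k : ℤ) {F : ℍ → ℂ} {A B : ℂ} {z : ℍ} (h : HasWirtinger F A B z) :
    del r (fun w => LL w ^ k * F w) z = LL z ^ k * del (r + k) F z := by
  rw [((hasWirtinger_LL_zpow k z).mul h).del_eq, h.del_eq]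
  have : LL z ^ k = LL z ^ (k - 1) * (Real.pi * Complex.I * ((z : ℂ) - conj (z : ℂ))) := by
    rw [← LL_eq, ← zpow_add_one₀ (LL_ne_zero z), sub_add_cancel]
  rw [this]
  push_cast
  ring

theorem delbar_LL_zpow_mul (s k : ℤ) {F : ℍ → ℂ} {A B : ℂ} {z : ℍ} (h : HasWirtinger F A B z) :
    delbar s (fun w => LL w ^ k * F w) z = LL z ^ k * delbar (s + k) F z := by
  rw [((hasWirtinger_LL_zpow k z).mul h).delbar_eq, h.delbar_eq]
  have : LL z ^ k = LL z ^ (k - 1) * (Real.pi * Complex.I * ((z : ℂ) - conj (z : ℂ))) := by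
    rw [← LL_eq, ← zpow_add_one₀ (LL_ne_zero z), sub_add_cancel]
  rw [this]
  push_cast
  ring

/-! ### Iterated raising operators on holomorphic functions -/

theorem mdifferentiable_iterate {f : ℍ → ℂ} (hf : MDifferentiable 𝓘(ℂ) 𝓘(ℂ) f) (k : ℕ) :
    MDifferentiable 𝓘(ℂ) 𝓘(ℂ) (𝒟^[k] f) := by
  induction k with
  | zero => exact hf
  | succ k ih =>
    rw [Function.iterate_succ_apply']
    exact Derivative.normalizedDerivOfComplex_mdifferentiable ih

/-- The coefficient of `𝕃^i D^i f` in `∂^k f`, for `f` of first weight `r`. -/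
def delPowCoeff (r : ℤ) (k i : ℕ) : ℂ :=
  (k.choose i : ℂ) * 2 ^ i * ∏ t ∈ Finset.Ico i k, ((r : ℂ) + t)

theorem hasWirtinger_LL_mul_iterate {f : ℍ → ℂ} (hf : MDifferentiable 𝓘(ℂ) 𝓘(ℂ) f) (i : ℕ)
    (z : ℍ) : ∃ A B, HasWirtinger (fun w => LL w ^ (i : ℤ) * 𝒟^[i] f w) A B z :=
  ⟨_, _, (hasWirtinger_LL_zpow i z).mul
    (hasWirtinger_of_mdifferentiable (mdifferentiable_iterate hf i) z)⟩

/-- For holomorphic f, 𝕃 = πi(z - z̄) and ∂f/∂z = 2πi Df combine to (z - z̄) ∂f/∂z = 2𝕃 Df. The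
factor 2 accounts for the powers of 2 in `delPowCoeff`. -/
theorem del_LL_mul_iterate {f : ℍ → ℂ} (hf : MDifferentiable 𝓘(ℂ) 𝓘(ℂ) f) (r : ℤ) (i : ℕ)
    (z : ℍ) : del r (fun w => LL w ^ (i : ℤ) * 𝒟^[i] f w) z =
      2 * (LL z ^ ((i + 1 : ℕ) : ℤ) * 𝒟^[i + 1] f z) +
        (r + i) * (LL z ^ (i : ℤ) * 𝒟^[i] f z) := by
  have h := hasWirtinger_of_mdifferentiable (mdifferentiable_iterate hf i) z
  rw [del_LL_zpow_mul r i h, h.del_eq, Function.iterate_succ_apply', Nat.cast_add, Nat.cast_one,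
    zpow_add_one₀ (LL_ne_zero z), LL_eq]
  push_cast
  ring

theorem delbar_LL_mul_iterate {f : ℍ → ℂ} (hf : MDifferentiable 𝓘(ℂ) 𝓘(ℂ) f) (s : ℤ) (i : ℕ)
    (z : ℍ) : delbar s (fun w => LL w ^ (i : ℤ) * 𝒟^[i] f w) z =
      (s + i) * (LL z ^ (i : ℤ) * 𝒟^[i] f z) := by
  have h := hasWirtinger_of_mdifferentiable (mdifferentiable_iterate hf i) z
  rw [delbar_LL_zpow_mul s i h, h.delbar_eq]
  push_cast
  ring

theorem HasWirtinger.del_sum {ι : Type*} {s : Finset ι} {F : ι → ℍ → ℂ} {z : ℍ}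
    (h : ∀ i ∈ s, ∃ A B, HasWirtinger (F i) A B z) (c : ι → ℂ) (r : ℤ) :
    del r (fun w => ∑ i ∈ s, c i * F i w) z = ∑ i ∈ s, c i * del r (F i) z := by
  choose! A B hAB using h
  rw [(HasWirtinger.sum s fun i hi => (hAB i hi).const_mul (c i)).del_eq, Finset.mul_sum,
    Finset.mul_sum, ← Finset.sum_add_distrib]
  refine Finset.sum_congr rfl fun i hi => ?_
  rw [(hAB i hi).del_eq]
  ring

theorem HasWirtinger.delbar_sum {ι : Type*} {s : Finset ι} {F : ι → ℍ → ℂ} {z : ℍ}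
    (h : ∀ i ∈ s, ∃ A B, HasWirtinger (F i) A B z) (c : ι → ℂ) (r : ℤ) :
    delbar r (fun w => ∑ i ∈ s, c i * F i w) z = ∑ i ∈ s, c i * delbar r (F i) z := by
  choose! A B hAB using h
  rw [(HasWirtinger.sum s fun i hi => (hAB i hi).const_mul (c i)).delbar_eq, Finset.mul_sum,
    Finset.mul_sum, ← Finset.sum_add_distrib]
  refine Finset.sum_congr rfl fun i hi => ?_
  rw [(hAB i hi).delbar_eq]
  ring

theorem delPowCoeff_succ_zero (r : ℤ) (k : ℕ) :
    delPowCoeff r (k + 1) 0 = (r + k) * delPowCoeff r k 0 := by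
  simp only [delPowCoeff, Nat.choose_zero_right, ← Finset.range_eq_Ico, Finset.prod_range_succ]
  ring

/-- Once the common product over `Finset.Ico (i + 1) k` is taken out, only (i + 1) C(k, i + 1) = (k
- i) C(k, i) is left. -/
theorem delPowCoeff_succ_succ (r : ℤ) {k i : ℕ} (hi : i + 1 ≤ k) :
    delPowCoeff r (k + 1) (i + 1) =
      2 * delPowCoeff r k i + ((r + k : ℤ) + (i + 1 : ℕ)) * delPowCoeff r k (i + 1) := by
  have h1 : (k.choose (i + 1) : ℂ) * (i + 1) = k.choose i * (k - i) := by
    have := Nat.choose_succ_right_eq k i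
    have h2 : ((k - i : ℕ) : ℂ) = k - i := Nat.cast_sub (by omega)
    rw [← h2]
    exact_mod_cast this
  simp only [delPowCoeff, Finset.prod_Ico_succ_top hi, Nat.choose_succ_succ,
    Finset.prod_eq_prod_Ico_succ_bot (show i < k by omega)]
  push_cast
  linear_combination (-(2 : ℂ) ^ (i + 1) * ∏ t ∈ Finset.Ico (i + 1) k, ((r : ℂ) + t)) * h1

theorem delPowCoeff_self (r : ℤ) (k : ℕ) : delPowCoeff r k k = 2 ^ k := by
  simp [delPowCoeff]

theorem delPow_eq_sum {f : ℍ → ℂ} (hf : MDifferentiable 𝓘(ℂ) 𝓘(ℂ) f) (r : ℤ) (k : ℕ) :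
    delPow r k f = fun z => ∑ i ∈ Finset.range (k + 1),
      delPowCoeff r k i * (LL z ^ (i : ℤ) * 𝒟^[i] f z) := by
  induction k with
  | zero =>
    funext z
    simp [delPow, delPowCoeff]
  | succ k ih =>
    funext z
    rw [delPow, ih, HasWirtinger.del_sum fun i _ => hasWirtinger_LL_mul_iterate hf i z]
    simp only [del_LL_mul_iterate hf, mul_add, Finset.sum_add_distrib]
    set E : ℕ → ℂ := fun i => LL z ^ (i : ℤ) * 𝒟^[i] f z with hE
    have hE' : ∀ i : ℕ, LL z ^ ((i : ℕ) : ℤ) * 𝒟^[i] f z = E i := fun i => rfl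
    simp only [hE']
    rw [Finset.sum_range_succ (fun i => delPowCoeff r k i * (2 * E (i + 1))),
      Finset.sum_range_succ' (fun i => delPowCoeff r k i * ((((r + k : ℤ) : ℂ) + i) * E i)),
      Finset.sum_range_succ' _ (k + 1), Finset.sum_range_succ, delPowCoeff_self, delPowCoeff_self,
      delPowCoeff_succ_zero]
    have : ∑ i ∈ Finset.range k, delPowCoeff r (k + 1) (i + 1) * E (i + 1) =
        ∑ i ∈ Finset.range k, delPowCoeff r k i * (2 * E (i + 1)) +
          ∑ i ∈ Finset.range k, delPowCoeff r k (i + 1) *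
            ((((r + k : ℤ) : ℂ) + (i + 1 : ℕ)) * E (i + 1)) := by
      rw [← Finset.sum_add_distrib]
      refine Finset.sum_congr rfl fun i hi => ?_
      rw [delPowCoeff_succ_succ r (by have := Finset.mem_range.mp hi; omega)]
      ring
    rw [this]
    push_cast
    ring

theorem exists_hasWirtinger_delPow {f : ℍ → ℂ} (hf : MDifferentiable 𝓘(ℂ) 𝓘(ℂ) f) (r : ℤ) (k : ℕ)
    (z : ℍ) : ∃ A B, HasWirtinger (delPow r k f) A B z := by
  rw [delPow_eq_sum hf]
  choose A B hAB using fun i => hasWirtinger_LL_mul_iterate hf i z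
  exact ⟨_, _, HasWirtinger.sum _ fun i _ => (hAB i).const_mul _⟩

/-- Bol's identity. -/
theorem delPow_bol {f : ℍ → ℂ} (hf : MDifferentiable 𝓘(ℂ) 𝓘(ℂ) f) (n : ℕ) (z : ℍ) :
    delPow (-n) (n + 1) f z = 2 ^ (n + 1) * LL z ^ ((n : ℤ) + 1) * 𝒟^[n + 1] f z := by
  simp only [delPow_eq_sum hf]
  rw [Finset.sum_range_succ, Finset.sum_eq_zero, delPowCoeff_self]
  · push_cast
    ring
  · intro i hi
    have hi' := Finset.mem_range.mp hi
    -- At first weight -n the factor t = n vanishes, which removes every term except the top one.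
    have : ∏ t ∈ Finset.Ico i (n + 1), (((-n : ℤ) : ℂ) + t) = 0 :=
      Finset.prod_eq_zero (i := n) (Finset.mem_Ico.mpr ⟨by omega, by omega⟩) (by simp)
    rw [delPowCoeff, this]
    simp

/-- The lowering operator on `∂^(k+1) f` for holomorphic `f` of weights `(r, 0)`. -/
theorem delbar_delPow {f : ℍ → ℂ} (hf : MDifferentiable 𝓘(ℂ) 𝓘(ℂ) f) (r : ℤ) (k : ℕ) (z : ℍ) :
    delbar (-(k + 1 : ℕ)) (delPow r (k + 1) f) z =
      -(k + 1) * (r + k) * delPow r k f z := by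
  rw [delPow_eq_sum hf, delPow_eq_sum hf,
    HasWirtinger.delbar_sum fun i _ => hasWirtinger_LL_mul_iterate hf i z, Finset.sum_range_succ]
  simp only [delbar_LL_mul_iterate hf]
  rw [Finset.mul_sum]
  -- ∂̄_s multiplies 𝕃^i D^i f by s + i, so s = -(k + 1) is the weight that removes the top term i =
  -- k + 1.
  have h0 : (((-(k + 1 : ℕ) : ℤ) : ℂ) + (k + 1 : ℕ)) = 0 := by push_cast; ring
  rw [h0]
  simp only [zero_mul, mul_zero, add_zero]
  refine Finset.sum_congr rfl fun i hi => ?_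
  have hi' := Finset.mem_range.mp hi
  have h1 : ((k + 1).choose i : ℂ) * (k + 1 - i) = (k + 1) * k.choose i := by
    have h2 : ((k + 1 - i : ℕ) : ℂ) = k + 1 - i := by
      rw [Nat.cast_sub (by omega)]
      push_cast
      ring
    rw [← h2]
    have := Nat.choose_mul_succ_eq k i
    rw [mul_comm ((k : ℂ) + 1)]
    exact_mod_cast this.symm
  simp only [delPowCoeff, Finset.prod_Ico_succ_top (show i ≤ k by omega)]
  push_cast
  linear_combination (-(2 : ℂ) ^ i * (∏ t ∈ Finset.Ico i k, ((r : ℂ) + t)) * (r + k) *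
    (LL z ^ (i : ℤ) * 𝒟^[i] f z)) * h1

/-! ### The raising and lowering operators on zeroth Fourier modes -/

section ZeroModeDeriv

variable {F : ℍ → ℂ}

theorem continuousOn_fderiv_apply (hF : AnalyticOnNhd ℝ (F ∘ ofComplex) upperHalfPlaneSet) (v : ℂ) :
    ContinuousOn (fun w => fderiv ℝ (F ∘ ofComplex) w v) upperHalfPlaneSet :=
  (hF.fderiv.continuousOn).clm_apply continuousOn_const

theorem differentiableAt_of_analyticOnNhd
    (hF : AnalyticOnNhd ℝ (F ∘ ofComplex) upperHalfPlaneSet) {w : ℂ} (hw : 0 < w.im) :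
    DifferentiableAt ℝ (F ∘ ofComplex) w := (hF w hw).differentiableAt

theorem hasWirtinger_of_analyticOnNhd
    (hF : AnalyticOnNhd ℝ (F ∘ ofComplex) upperHalfPlaneSet) (z : ℍ) :
    HasWirtinger F (dz F z) (dzbar F z) z :=
  HasWirtinger.of_differentiableAt (differentiableAt_of_analyticOnNhd hF z.im_pos)

theorem continuous_of_analyticOnNhd
    (hF : AnalyticOnNhd ℝ (F ∘ ofComplex) upperHalfPlaneSet) : Continuous F :=
  continuous_of_hasWirtinger fun z => ⟨_, _, hasWirtinger_of_analyticOnNhd hF z⟩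

theorem continuous_fderiv_line (hF : AnalyticOnNhd ℝ (F ∘ ofComplex) upperHalfPlaneSet) (v : ℂ)
    {y : ℝ} (hy : 0 < y) :
    Continuous fun x : ℝ => fderiv ℝ (F ∘ ofComplex) ((x : ℂ) + y * Complex.I) v := by
  refine (continuousOn_fderiv_apply hF v).comp_continuous (by fun_prop) fun x => ?_
  change 0 < ((x : ℂ) + y * Complex.I).im
  rwa [im_line]

theorem hasDerivAt_zeroMode (hF : AnalyticOnNhd ℝ (F ∘ ofComplex) upperHalfPlaneSet) {y : ℝ}
    (hy : 0 < y) : HasDerivAt (zeroMode F)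
      (∫ x in (0 : ℝ)..1, fderiv ℝ (F ∘ ofComplex) ((x : ℂ) + y * Complex.I) Complex.I) y := by
  let K : Set ℂ := (fun p : ℝ × ℝ => (p.1 : ℂ) + p.2 * Complex.I) ''
    (Set.Icc 0 1 ×ˢ Set.Icc (y / 2) (2 * y))
  have hK : IsCompact K := (isCompact_Icc.prod isCompact_Icc).image (by fun_prop)
  have hKsub : K ⊆ upperHalfPlaneSet := by
    rintro _ ⟨p, ⟨-, hp⟩, rfl⟩
    change 0 < ((p.1 : ℂ) + p.2 * Complex.I).im
    rw [im_line]
    exact lt_of_lt_of_le (by positivity) hp.1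
  obtain ⟨C, hC⟩ := hK.exists_bound_of_continuousOn
    ((continuousOn_fderiv_apply hF Complex.I).mono hKsub)
  have hs : Set.Ioo (y / 2) (2 * y) ∈ nhds y := Ioo_mem_nhds (by linarith) (by linarith)
  refine (intervalIntegral.hasDerivAt_integral_of_dominated_loc_of_deriv_le
    (F := fun (t : ℝ) (x : ℝ) => F (ofComplex ((x : ℂ) + t * Complex.I)))
    (F' := fun (t : ℝ) (x : ℝ) => fderiv ℝ (F ∘ ofComplex) ((x : ℂ) + t * Complex.I) Complex.I)
    (bound := fun _ => C) hs ?_ ?_ ?_ ?_ ?_ ?_).2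
  · filter_upwards [eventually_gt_nhds hy] with t ht
    exact ((continuous_of_analyticOnNhd hF).comp (continuous_line ht)).aestronglyMeasurable
  · exact intervalIntegrable_line (continuous_of_analyticOnNhd hF) hy 0 1
  · exact (continuous_fderiv_line hF Complex.I hy).aestronglyMeasurable
  · refine Eventually.of_forall fun x hx t ht => hC _ ⟨(x, t), ⟨?_, ?_⟩, rfl⟩
    · rw [Set.uIoc_of_le zero_le_one] at hx
      exact ⟨hx.1.le, hx.2⟩
    · exact ⟨ht.1.le, ht.2.le⟩
  · exact intervalIntegrable_const
  · refine Eventually.of_forall fun x hx t ht => ?_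
    have ht0 : 0 < t := lt_trans (by positivity) ht.1
    have h1 := (differentiableAt_of_analyticOnNhd hF (w := (x : ℂ) + t * Complex.I)
      (by rwa [im_line])).hasFDerivAt
    have h2 : HasDerivAt (fun t : ℝ => (x : ℂ) + t * Complex.I) Complex.I t := by
      simpa using ((Complex.ofRealCLM.hasDerivAt (x := t)).mul_const Complex.I).const_add (x : ℂ)
    exact h1.comp_hasDerivAt t h2

/-- By periodicity the x-derivative drops out of zeroth modes. It is the only term in which ∂ and ∂̄
of equal weight differ. -/
theorem integral_fderiv_one (hF : AnalyticOnNhd ℝ (F ∘ ofComplex) upperHalfPlaneSet)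
    (hper : Function.Periodic (F ∘ ofComplex) 1) {y : ℝ} (hy : 0 < y) :
    ∫ x in (0 : ℝ)..1, fderiv ℝ (F ∘ ofComplex) ((x : ℂ) + y * Complex.I) 1 = 0 := by
  have := intervalIntegral.integral_eq_sub_of_hasDerivAt (a := (0 : ℝ)) (b := 1)
    (f := fun x : ℝ => (F ∘ ofComplex) ((x : ℂ) + y * Complex.I))
    (f' := fun x : ℝ => fderiv ℝ (F ∘ ofComplex) ((x : ℂ) + y * Complex.I) 1) (fun x _ => by
      have h1 := (differentiableAt_of_analyticOnNhd hF (w := (x : ℂ) + y * Complex.I)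
        (by rwa [im_line])).hasFDerivAt
      have h2 : HasDerivAt (fun x : ℝ => (x : ℂ) + y * Complex.I) 1 x := by
        simpa using (Complex.ofRealCLM.hasDerivAt (x := x)).add_const ((y : ℂ) * Complex.I)
      exact h1.comp_hasDerivAt x h2) ((continuous_fderiv_line hF 1 hy).intervalIntegrable _ _)
  rw [this, sub_eq_zero]
  have h3 := hper (y * Complex.I)
  simp only [Complex.ofReal_one, Complex.ofReal_zero, zero_add]
  rw [← h3, add_comm]

theorem sub_conj_line (x : ℝ) {y : ℝ} (hy : 0 < y) :
    ((ofComplex ((x : ℂ) + y * Complex.I) : ℍ) : ℂ) -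
      conj ((ofComplex ((x : ℂ) + y * Complex.I) : ℍ) : ℂ) = 2 * y * Complex.I := by
  rw [Complex.sub_conj, coe_line x hy, im_line]
  push_cast
  ring

/-- On zeroth Fourier modes, `∂_r` and `∂̄_r` both act as `y d/dy + r`. -/
theorem zeroMode_del_delbar (hF : AnalyticOnNhd ℝ (F ∘ ofComplex) upperHalfPlaneSet)
    (hper : Function.Periodic (F ∘ ofComplex) 1) {y : ℝ} (hy : 0 < y) :
    ∃ d, HasDerivAt (zeroMode F) d y ∧
      (∀ r : ℤ, zeroMode (del r F) y = y * d + r * zeroMode F y) ∧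
      ∀ s : ℤ, zeroMode (delbar s F) y = y * d + s * zeroMode F y := by
  refine ⟨_, hasDerivAt_zeroMode hF hy, ?_, ?_⟩
  · intro r
    have h : ∀ x : ℝ, del r F (ofComplex ((x : ℂ) + y * Complex.I)) =
        y * Complex.I * fderiv ℝ (F ∘ ofComplex) ((x : ℂ) + y * Complex.I) 1 +
        y * fderiv ℝ (F ∘ ofComplex) ((x : ℂ) + y * Complex.I) Complex.I +
        r * F (ofComplex ((x : ℂ) + y * Complex.I)) := by
      intro x
      rw [del, dz, sub_conj_line x hy, coe_line x hy]
      linear_combination (-(y : ℂ) * fderiv ℝ (F ∘ ofComplex) ((x : ℂ) + y * Complex.I) Complex.I) *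
        Complex.I_mul_I
    simp only [zeroMode, h]
    rw [intervalIntegral.integral_add, intervalIntegral.integral_add,
      intervalIntegral.integral_const_mul, intervalIntegral.integral_const_mul,
      intervalIntegral.integral_const_mul, integral_fderiv_one hF hper hy, mul_zero, zero_add]
    · exact ((continuous_fderiv_line hF 1 hy).const_mul _).intervalIntegrable _ _
    · exact ((continuous_fderiv_line hF Complex.I hy).const_mul _).intervalIntegrable _ _
    · exact (((continuous_fderiv_line hF 1 hy).const_mul _).add
        ((continuous_fderiv_line hF Complex.I hy).const_mul _)).intervalIntegrable _ _
    · exact (intervalIntegrable_line (continuous_of_analyticOnNhd hF) hy 0 1).const_mul _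
  · intro s
    have h : ∀ x : ℝ, delbar s F (ofComplex ((x : ℂ) + y * Complex.I)) =
        -(y * Complex.I) * fderiv ℝ (F ∘ ofComplex) ((x : ℂ) + y * Complex.I) 1 +
        y * fderiv ℝ (F ∘ ofComplex) ((x : ℂ) + y * Complex.I) Complex.I +
        s * F (ofComplex ((x : ℂ) + y * Complex.I)) := by
      intro x
      rw [delbar, dzbar, ← neg_sub, sub_conj_line x hy, coe_line x hy]
      linear_combination (-(y : ℂ) * fderiv ℝ (F ∘ ofComplex) ((x : ℂ) + y * Complex.I) Complex.I) *
        Complex.I_mul_I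
    simp only [zeroMode, h]
    rw [intervalIntegral.integral_add, intervalIntegral.integral_add,
      intervalIntegral.integral_const_mul, intervalIntegral.integral_const_mul,
      intervalIntegral.integral_const_mul, integral_fderiv_one hF hper hy, mul_zero, zero_add]
    · exact ((continuous_fderiv_line hF 1 hy).const_mul _).intervalIntegrable _ _
    · exact ((continuous_fderiv_line hF Complex.I hy).const_mul _).intervalIntegrable _ _
    · exact (((continuous_fderiv_line hF 1 hy).const_mul _).add
        ((continuous_fderiv_line hF Complex.I hy).const_mul _)).intervalIntegrable _ _
    · exact (intervalIntegrable_line (continuous_of_analyticOnNhd hF) hy 0 1).const_mul _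

end ZeroModeDeriv

theorem IsModular.vadd_one {r s : ℤ} {F : ℍ → ℂ} (hF : IsModular r s F) (z : ℍ) :
    F ((1 : ℝ) +ᵥ z) = F z := by
  have h := hF ModularGroup.T z
  rw [UpperHalfPlane.modular_T_smul] at h
  rw [h]
  simp [ModularGroup.T]

theorem IsModular.periodic {r s : ℤ} {F : ℍ → ℂ} (hF : IsModular r s F) :
    Function.Periodic (F ∘ ofComplex) 1 := by
  intro w
  simp only [Function.comp_apply]
  by_cases hw : 0 < w.im
  · have hw' : 0 < (w + 1).im := by simpa using hw
    rw [← hF.vadd_one (ofComplex w)]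
    congr 1
    apply UpperHalfPlane.ext
    rw [coe_ofComplex hw', UpperHalfPlane.coe_vadd, coe_ofComplex hw]
    simp [add_comm]
  · rw [ofComplex_apply_eq_of_im_nonpos (w := w + 1) (w' := w) (by simpa using hw)
      (by simpa using hw)]

/-! ### Zeroth Fourier modes of a primitive system -/

theorem zeroMode_LL_mul {F : ℍ → ℂ} {y : ℝ} (hy : 0 < y) :
    zeroMode (fun z => LL z * F z) y = ((-2 * Real.pi * y : ℝ) : ℂ) * zeroMode F y := by
  simpa using zeroMode_LL_zpow_mul F 1 hy

theorem IsWeaklyHolomorphic.hasQExpansion {k : ℤ} {f : ℍ → ℂ} (hf : IsWeaklyHolomorphic k f) :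
    HasQExpansion f (qCoeff f) := by
  obtain ⟨a, ha⟩ := hf.expansion
  have : qCoeff f = a := funext ha.qCoeff_eq
  rwa [this]

/-- The zeroth mode u of X_{n,0} satisfies y u' + n u = 𝕃 a₀(f), whose solutions are a₀(f)/(n + 1) 𝕃
+ const · 𝕃^{-n}. The other components follow by ∂̄, so a single constant α serves all of them. -/
theorem IsPrimitiveSystem.exists_zeroMode {n : ℕ} {f g : ℍ → ℂ} {X : ℕ → ℕ → ℍ → ℂ}
    (hX : IsPrimitiveSystem n f g X) :
    ∃ α : ℂ, ∀ r s : ℕ, r + s = n → ∀ y : ℝ, 0 < y → zeroMode (X r s) y =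
      qCoeff f 0 / (n + 1) * ((-2 * Real.pi * y : ℝ) : ℂ) +
        α * (-1) ^ r * (n.choose r : ℂ) * ((-2 * Real.pi * y : ℝ) : ℂ) ^ (-(n : ℤ)) := by
  have hpi : (Real.pi : ℂ) ≠ 0 := by exact_mod_cast Real.pi_ne_zero
  have hn1 : (n : ℂ) + 1 ≠ 0 := by exact_mod_cast n.succ_ne_zero
  -- the top component
  obtain ⟨c, hc⟩ : ∃ c : ℂ, ∀ y : ℝ, 0 < y → zeroMode (X n 0) y =
      qCoeff f 0 / (n + 1) * ((-2 * Real.pi * y : ℝ) : ℂ) + c * (y : ℂ) ^ (-(n : ℤ)) := by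
    have hm := hX.mem n 0 (by simp)
    -- This is the integrating factor: y u' + n u = -2π a₀(f) y says exactly that H is constant.
    let H : ℝ → ℂ := fun y => (y : ℂ) ^ n * zeroMode (X n 0) y +
      2 * Real.pi * qCoeff f 0 / (n + 1) * (y : ℂ) ^ (n + 1)
    have hH : ∀ y ∈ Set.Ioi (0 : ℝ), HasDerivAt H 0 y := by
      intro y hy
      have hy0 : (y : ℂ) ≠ 0 := by exact_mod_cast (ne_of_gt hy : y ≠ 0)
      obtain ⟨d, hd, hdel, -⟩ := zeroMode_del_delbar hm.analytic hm.modular.periodic hy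
      have h1 : del n (X n 0) = fun z => LL z * f z := funext hX.del_top
      have h2 := hdel n
      rw [h1, zeroMode_LL_mul hy, hX.hol_f.hasQExpansion.zeroMode_eq hy] at h2
      have hid : HasDerivAt (fun y : ℝ => (y : ℂ)) 1 y := Complex.ofRealCLM.hasDerivAt
      have h3 := ((hid.pow n).mul hd).add
        ((hid.pow (n + 1)).const_mul (2 * Real.pi * qCoeff f 0 / (n + 1)))
      refine h3.congr_deriv ?_
      apply mul_left_cancel₀ hy0
      simp only [Pi.pow_apply, Nat.add_sub_cancel, mul_one]
      have h4 : (y : ℂ) * (n * (y : ℂ) ^ (n - 1)) = n * (y : ℂ) ^ n := by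
        rcases n with _ | n
        · simp
        · simp only [Nat.add_sub_cancel]
          ring
      have h5 : 2 * Real.pi * qCoeff f 0 / (n + 1) * ((n : ℂ) + 1) = 2 * Real.pi * qCoeff f 0 :=
        div_mul_cancel₀ _ hn1
      push_cast at h2 ⊢
      linear_combination (zeroMode (X n 0) y) * h4 - (y : ℂ) ^ n * h2 +
        (y : ℂ) * (y : ℂ) ^ n * h5
    obtain ⟨c, hc⟩ := isOpen_Ioi.exists_is_const_of_deriv_eq_zero (isPreconnected_Ioi (a := (0 : ℝ)))
      (fun y hy => (hH y hy).differentiableAt.differentiableWithinAt)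
      (fun y hy => (hH y hy).deriv)
    refine ⟨c, fun y hy => ?_⟩
    have hy0 : (y : ℂ) ≠ 0 := by exact_mod_cast hy.ne'
    rw [← hc y hy, zpow_neg, zpow_natCast]
    simp only [H]
    push_cast
    field_simp
    ring
  -- This rewrites c y^{-n} as α (-1)^n 𝕃^{-n}, where 𝕃 = -2πy.
  refine ⟨(-1) ^ n * c * (-2 * Real.pi) ^ n, ?_⟩
  have hL : ∀ y : ℝ, 0 < y → ((-2 * Real.pi * y : ℝ) : ℂ) ≠ 0 := by
    intro y hy
    have : 2 * Real.pi * y ≠ 0 := by positivity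
    rw [Complex.ofReal_ne_zero]
    intro h
    apply this
    linarith
  suffices h : ∀ s r : ℕ, r + s = n → ∀ y : ℝ, 0 < y → zeroMode (X r s) y =
      qCoeff f 0 / (n + 1) * ((-2 * Real.pi * y : ℝ) : ℂ) +
        (-1) ^ n * c * (-2 * Real.pi) ^ n * (-1) ^ r * (n.choose r : ℂ) *
          ((-2 * Real.pi * y : ℝ) : ℂ) ^ (-(n : ℤ)) from fun r s => h s r
  intro s
  -- ∂̄_s multiplies 𝕃 by s + 1 and 𝕃^{-n} by s - n = -(r + 1). Division by s + 1 leaves the 𝕃-term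
  -- alone and changes (-1)^{r+1} C(n, r + 1) into (-1)^r C(n, r).
  induction s with
  | zero =>
    intro r hr y hy
    obtain rfl : r = n := by omega
    have hy0 : (y : ℂ) ≠ 0 := by exact_mod_cast hy.ne'
    rw [hc y hy, Nat.choose_self, zpow_neg, zpow_natCast, zpow_neg, zpow_natCast]
    have h1 : ((-1 : ℂ) ^ r) * (-1) ^ r = 1 := by rw [← mul_pow]; simp
    push_cast
    rw [mul_pow (-2 * (Real.pi : ℂ)) y]
    have h2 : (-2 * (Real.pi : ℂ)) ^ r ≠ 0 := pow_ne_zero _ (by simp [hpi])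
    field_simp
    linear_combination (-c * ((r : ℂ) + 1)) * h1
  | succ s ih =>
    intro r hr y hy
    have hr' : (r + 1) + s = n := by omega
    have hm := hX.mem (r + 1) s hr'
    obtain ⟨d, hd, -, hdelbar⟩ := zeroMode_del_delbar hm.analytic hm.modular.periodic hy
    have h1 : delbar s (X (r + 1) s) = fun z => (s + 1) * X r (s + 1) z :=
      funext (hX.delbar_eq r s hr')
    have h2 := hdelbar s
    rw [h1, zeroMode_const_mul, ih (r + 1) hr' y hy] at h2
    have hd' : HasDerivAt (zeroMode (X (r + 1) s)) (qCoeff f 0 / (n + 1) * (-2 * Real.pi) +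
        (-1) ^ n * c * (-2 * Real.pi) ^ n * (-1) ^ (r + 1) * (n.choose (r + 1) : ℂ) *
          (((-(n : ℤ) : ℤ) : ℂ) * ((-2 * Real.pi * y : ℝ) : ℂ) ^ (-(n : ℤ) - 1) *
            (-2 * Real.pi))) y := by
      have hl : HasDerivAt (fun y : ℝ => ((-2 * Real.pi * y : ℝ) : ℂ)) (-2 * Real.pi) y := by
        have := ((hasDerivAt_id y).const_mul (-2 * Real.pi)).ofReal_comp
        simpa using this
      have h5 := (hl.const_mul (qCoeff f 0 / (n + 1))).add
        (((hasDerivAt_zpow (-(n : ℤ)) _ (Or.inl (hL y hy))).comp y hl).const_mul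
          ((-1) ^ n * c * (-2 * Real.pi) ^ n * (-1) ^ (r + 1) * (n.choose (r + 1) : ℂ)))
      refine h5.congr_of_eventuallyEq ?_
      filter_upwards [eventually_gt_nhds hy] with t ht
      exact ih (r + 1) hr' t ht
    rw [hd.unique hd'] at h2
    have hs1 : (s : ℂ) + 1 ≠ 0 := by exact_mod_cast s.succ_ne_zero
    apply mul_left_cancel₀ hs1
    rw [h2]
    have hch : (n.choose (r + 1) : ℂ) * (r + 1) = n.choose r * (s + 1) := by
      have := Nat.choose_succ_right_eq n r
      rw [show n - r = s + 1 by omega] at this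
      exact_mod_cast this
    have hn : (n : ℂ) = r + 1 + s := by
      rw [← hr']
      push_cast
      ring
    have hz : ((-2 * Real.pi * y : ℝ) : ℂ) ^ (-(n : ℤ)) =
        ((-2 * Real.pi * y : ℝ) : ℂ) ^ (-(n : ℤ) - 1) * (-2 * Real.pi * y) := by
      rw [← sub_add_cancel (-(n : ℤ)) 1, zpow_add_one₀ (hL y hy), sub_add_cancel]
      push_cast
      ring
    rw [hz]
    push_cast
    generalize ((-2 * (Real.pi : ℂ) * y) ^ (-(n : ℤ) - 1)) = Z
    rw [pow_succ]
    generalize (-1 : ℂ) ^ n * c * (-2 * Real.pi) ^ n = W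
    linear_combination (W * (-1) ^ r * (n.choose (r + 1) : ℂ) * (-2 * Real.pi * y) * Z) * hn +
      (W * (-1) ^ r * (-2 * Real.pi * y) * Z) * hch

theorem isConstantPart_of_zeroMode_eq {F : ℍ → ℂ} (hF : ∃ a, HasLExpansion F a) (a b : ℂ) (k l : ℤ)
    (h : ∀ y : ℝ, 0 < y → zeroMode F y = a * ((-2 * Real.pi * y : ℝ) : ℂ) ^ k +
      b * ((-2 * Real.pi * y : ℝ) : ℂ) ^ l) :
    IsConstantPart F (LaurentPolynomial.C a * LaurentPolynomial.T k +
      LaurentPolynomial.C b * LaurentPolynomial.T l) := by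
  refine isConstantPart_of_zeroMode hF _ fun y hy => ?_
  rw [h y hy]
  have e : (LaurentPolynomial.C a * LaurentPolynomial.T k +
      LaurentPolynomial.C b * LaurentPolynomial.T l).coeff =
      Finsupp.single k a + Finsupp.single l b := by
    rw [← LaurentPolynomial.single_eq_C_mul_T, ← LaurentPolynomial.single_eq_C_mul_T]
    rfl
  rw [e]
  change _ = (Finsupp.single k a + Finsupp.single l b).sum
    fun k c => c * ((-2 * Real.pi * y : ℝ) : ℂ) ^ k
  rw [Finsupp.sum_add_index' (by simp) (by intros; ring), Finsupp.sum_single_index (by simp),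
    Finsupp.sum_single_index (by simp)]

/-! ### Hecke operators and differentiation -/

theorem im_affine (a b d : ℕ) (z : ℂ) : (((a : ℂ) * z + b) / d).im = a * z.im / d := by
  have : ((a : ℂ) * z + b) / d = ((a / d : ℝ) : ℂ) * z + ((b / d : ℝ) : ℂ) := by
    push_cast
    ring
  rw [this, Complex.add_im, Complex.im_ofReal_mul, Complex.ofReal_im]
  ring

theorem pos_of_mem_divisorsAntidiagonal {m : ℕ} {p : ℕ × ℕ} (hp : p ∈ m.divisorsAntidiagonal) :
    0 < p.1 ∧ 0 < p.2 := by
  obtain ⟨h1, h2⟩ := Nat.mem_divisorsAntidiagonal.mp hp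
  constructor <;> refine Nat.pos_of_ne_zero fun h => h2 ?_ <;> rw [← h1, h] <;> simp

theorem im_affine_pos {a b d : ℕ} (ha : 0 < a) (hd : 0 < d) {z : ℂ} (hz : 0 < z.im) :
    0 < (((a : ℂ) * z + b) / d).im := by
  rw [im_affine]
  positivity

theorem im_ofComplex_affine {a b d : ℕ} (ha : 0 < a) (hd : 0 < d) (z : ℍ) :
    (ofComplex (((a : ℂ) * z + b) / d) : ℍ).im = a * z.im / d := by
  rw [← UpperHalfPlane.coe_im, coe_ofComplex (im_affine_pos ha hd z.im_pos), im_affine,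
    UpperHalfPlane.coe_im]

theorem LL_affine {a b d : ℕ} (ha : 0 < a) (hd : 0 < d) (z : ℍ) :
    LL (ofComplex (((a : ℂ) * z + b) / d)) = a / d * LL z := by
  rw [LL, LL, im_ofComplex_affine ha hd]
  push_cast
  ring

theorem sub_conj_affine {a b d : ℕ} (ha : 0 < a) (hd : 0 < d) (z : ℍ) :
    ((ofComplex (((a : ℂ) * z + b) / d) : ℍ) : ℂ) -
      conj ((ofComplex (((a : ℂ) * z + b) / d) : ℍ) : ℂ) = a / d * ((z : ℂ) - conj (z : ℂ)) := by
  rw [coe_ofComplex (im_affine_pos ha hd z.im_pos)]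
  simp only [map_div₀, map_add, map_mul, Complex.conj_natCast]
  ring

theorem HasWirtinger.affine {F : ℍ → ℂ} {A B : ℂ} {a b d : ℕ} (ha : 0 < a) (hd : 0 < d) {z : ℍ}
    (hF : HasWirtinger F A B (ofComplex (((a : ℂ) * z + b) / d))) :
    HasWirtinger (fun w => F (ofComplex (((a : ℂ) * w + b) / d))) (A * (a / d)) (B * (a / d)) z := by
  have hφ : HasDerivAt (fun v : ℂ => ((a : ℂ) * v + b) / d) (a / d) (z : ℂ) := by
    simpa using (((hasDerivAt_id (z : ℂ)).const_mul (a : ℂ)).add_const (b : ℂ)).div_const (d : ℂ)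
  have := hF.comp_holomorphic (G := fun w => F (ofComplex (((a : ℂ) * w + b) / d))) hφ
    (coe_ofComplex (im_affine_pos ha hd z.im_pos)).symm (by
      filter_upwards [coe_comp_ofComplex_eventuallyEq z] with v hv
      simp only [Function.comp_apply, hv])
  refine this.congr_deriv rfl ?_
  simp

theorem hasWirtinger_hecke {F A B : ℍ → ℂ} (hF : ∀ z, HasWirtinger F (A z) (B z) z) (w : ℤ) (m : ℕ)
    (z : ℍ) : HasWirtinger (hecke w m F)
      ((m : ℂ) ^ (w - 1) * ∑ p ∈ m.divisorsAntidiagonal, (p.2 : ℂ) ^ (-w) *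
        ∑ b ∈ Finset.range p.2, A (ofComplex (((p.1 : ℂ) * z + b) / p.2)) * (p.1 / p.2))
      ((m : ℂ) ^ (w - 1) * ∑ p ∈ m.divisorsAntidiagonal, (p.2 : ℂ) ^ (-w) *
        ∑ b ∈ Finset.range p.2, B (ofComplex (((p.1 : ℂ) * z + b) / p.2)) * (p.1 / p.2)) z := by
  refine HasWirtinger.const_mul _ (HasWirtinger.sum _ fun p hp => HasWirtinger.const_mul _
    (HasWirtinger.sum _ fun b _ => ?_))
  obtain ⟨ha, hd⟩ := pos_of_mem_divisorsAntidiagonal hp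
  exact HasWirtinger.affine ha hd (hF _)

theorem hecke_const_mul (w : ℤ) (m : ℕ) (c : ℂ) (F : ℍ → ℂ) (z : ℍ) :
    hecke w m (fun v => c * F v) z = c * hecke w m F z := by
  simp only [hecke, Finset.mul_sum]
  refine Finset.sum_congr rfl fun p _ => Finset.sum_congr rfl fun b _ => ?_
  ring

theorem del_hecke {F : ℍ → ℂ} (hF : ∀ z, ∃ A B, HasWirtinger F A B z) (w r : ℤ) (m : ℕ) (z : ℍ) :
    del r (hecke w m F) z = hecke w m (del r F) z := by
  choose A B hAB using hF
  rw [(hasWirtinger_hecke hAB w m z).del_eq]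
  simp only [hecke, Finset.mul_sum]
  rw [← Finset.sum_add_distrib]
  refine Finset.sum_congr rfl fun p hp => ?_
  obtain ⟨ha, hd⟩ := pos_of_mem_divisorsAntidiagonal hp
  rw [← Finset.sum_add_distrib]
  refine Finset.sum_congr rfl fun b _ => ?_
  rw [(hAB _).del_eq, sub_conj_affine ha hd]
  ring

theorem delbar_hecke {F : ℍ → ℂ} (hF : ∀ z, ∃ A B, HasWirtinger F A B z) (w r : ℤ) (m : ℕ) (z : ℍ) :
    delbar r (hecke w m F) z = hecke w m (delbar r F) z := by
  choose A B hAB using hF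
  rw [(hasWirtinger_hecke hAB w m z).delbar_eq]
  simp only [hecke, Finset.mul_sum]
  rw [← Finset.sum_add_distrib]
  refine Finset.sum_congr rfl fun p hp => ?_
  obtain ⟨ha, hd⟩ := pos_of_mem_divisorsAntidiagonal hp
  rw [← Finset.sum_add_distrib]
  refine Finset.sum_congr rfl fun b _ => ?_
  have h := sub_conj_affine (b := b) ha hd z
  rw [(hAB _).delbar_eq]
  linear_combination ((m : ℂ) ^ (w - 1) * ((p.2 : ℂ) ^ (-w) *
    B (ofComplex (((p.1 : ℂ) * z + b) / p.2)))) * h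

/-- At (az + b)/d the value of 𝕃 is (a/d) 𝕃(z), and a/d = m/d². The factor d^{-2} shifts the weight
by 2 and the powers of m leave 1/m. This is why λ_m for f becomes λ_m/m for the components X_{r,s}.
-/
theorem hecke_LL_mul (w : ℤ) {m : ℕ} (hm : 1 ≤ m) (F : ℍ → ℂ) (z : ℍ) :
    hecke w m (fun v => LL v * F v) z = 1 / (m : ℂ) * (LL z * hecke (w + 2) m F z) := by
  have hm0 : (m : ℂ) ≠ 0 := by exact_mod_cast (by omega : m ≠ 0)
  simp only [hecke, Finset.mul_sum]
  refine Finset.sum_congr rfl fun p hp => Finset.sum_congr rfl fun b _ => ?_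
  obtain ⟨ha, hd⟩ := pos_of_mem_divisorsAntidiagonal hp
  have hd0 : (p.2 : ℂ) ≠ 0 := by exact_mod_cast hd.ne'
  have hpm : (p.1 : ℂ) * p.2 = m := by
    exact_mod_cast (Nat.mem_divisorsAntidiagonal.mp hp).1
  rw [LL_affine ha hd, show w + 2 - 1 = (w - 1) + 2 by ring, zpow_add₀ hm0,
    show -(w + 2) = -w + (-2) by ring, zpow_add₀ hd0, ← hpm]
  have ha0 : (p.1 : ℂ) ≠ 0 := by exact_mod_cast ha.ne'
  rw [zpow_neg (p.2 : ℂ) 2]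
  generalize ((p.1 : ℂ) * p.2) ^ (w - 1) = Z
  generalize ((p.2 : ℂ)) ^ (-w) = Z'
  simp only [zpow_ofNat]
  field_simp

theorem conj_hecke (w : ℤ) (m : ℕ) (F : ℍ → ℂ) (z : ℍ) :
    conj (hecke w m F z) = hecke w m (fun v => conj (F v)) z := by
  simp only [hecke, map_mul, map_sum, map_zpow₀, Complex.conj_natCast]

/-! ### Hecke operators preserve modularity -/

section HeckeModular

open FixedDetMatrices ModularGroup

local notation "SL2Z" => Matrix.SpecialLinearGroup (Fin 2) ℤ

variable {m : ℤ}

/-- Each reduction step is a left multiplication by a word in S and T, so the reduction stays in the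
left orbit; S * S = -1 adjusts the sign in the base case. -/
theorem exists_reduce_eq_smul (A : FixedDetMatrix (Fin 2) ℤ m) : ∃ γ : SL2Z, reduce A = γ • A := by
  induction A using reduce_rec with
  | base A h =>
    by_cases h1 : 0 < A.1 0 0
    · exact ⟨_, reduce_of_pos h h1⟩
    · refine ⟨T ^ (-(-A.1 0 1 / -A.1 1 1)) * (S * S), ?_⟩
      rw [reduce_of_not_pos h h1, mul_smul, mul_smul]
  | step A h ih =>
    obtain ⟨γ, hγ⟩ := ih
    rw [reduce_reduceStep h] at hγ
    refine ⟨γ * (S * T ^ (-(A.1 0 0 / A.1 1 0))), ?_⟩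
    rw [hγ, reduceStep, mul_smul, mul_smul]

/-- Both matrices are upper triangular with positive diagonal, which forces γ to be upper unipotent.
It then translates the entry b by a multiple of d, and 0 ≤ b < d for both forces that multiple to be
zero. -/
theorem reps_eq_of_smul {A B : FixedDetMatrix (Fin 2) ℤ m} (hA : A ∈ reps m) (hB : B ∈ reps m)
    (hm : 0 < m) {γ : SL2Z}
    (h : γ • A = B) : A = B := by
  obtain ⟨A10, A00, A01, A11⟩ := hA
  obtain ⟨B10, B00, B01, B11⟩ := hB
  have hAdet := A.2
  have hBdet := B.2
  have hγ := γ.2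
  have h' : ∀ i j, B.1 i j = γ.1 i 0 * A.1 0 j + γ.1 i 1 * A.1 1 j := by
    intro i j
    rw [← h, smul_coe, Matrix.mul_apply, Fin.sum_univ_two]
  have e00 := h' 0 0
  have e01 := h' 0 1
  have e10 := h' 1 0
  have e11 := h' 1 1
  rw [Matrix.det_fin_two] at hAdet hBdet hγ
  rw [A10] at e00 e10 hAdet
  rw [B10] at e10 hBdet
  simp only [mul_zero, add_zero] at e00 e10
  have g10 : γ.1 1 0 = 0 := by
    rcases mul_eq_zero.mp e10.symm with h | h
    · exact h
    · omega
  rw [g10] at hγ e11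
  have g00 : γ.1 0 0 = 1 := by
    have hp : 0 < γ.1 0 0 := by
      rw [e00] at B00
      by_contra hle
      nlinarith
    have hu : IsUnit (γ.1 0 0) := IsUnit.of_mul_eq_one (γ.1 1 1) (by linarith)
    rcases Int.isUnit_iff.mp hu with h | h <;> omega
  rw [g00] at hγ e00 e01
  have g11 : γ.1 1 1 = 1 := by linarith
  rw [g11] at e11
  have hA11 : 0 < A.1 1 1 := by
    by_contra hle
    nlinarith
  have hd : B.1 1 1 = A.1 1 1 := by linarith
  rw [hd, abs_of_pos hA11] at B11
  rw [abs_of_pos hA11] at A11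
  rw [abs_of_nonneg A01] at A11
  rw [abs_of_nonneg B01] at B11
  have g01 : γ.1 0 1 = 0 := by
    have e : B.1 0 1 = A.1 0 1 + γ.1 0 1 * A.1 1 1 := by linarith
    by_contra hne
    rcases lt_or_gt_of_ne hne with hlt | hgt
    · have : γ.1 0 1 ≤ -1 := by omega
      nlinarith
    · have : 1 ≤ γ.1 0 1 := by omega
      nlinarith
  rw [g01] at e01
  ext i j
  fin_cases i <;> fin_cases j <;> simp <;> linarith

/-- Right multiplication of an integral matrix by a unimodular one. -/
def mulRight (A : FixedDetMatrix (Fin 2) ℤ m) (γ : SL2Z) : FixedDetMatrix (Fin 2) ℤ m :=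
  ⟨A.1 * γ.1, by rw [Matrix.det_mul, A.2, γ.2, mul_one]⟩

theorem smul_mulRight (δ : SL2Z) (A : FixedDetMatrix (Fin 2) ℤ m) (γ : SL2Z) :
    mulRight (δ • A) γ = δ • mulRight A γ := by
  apply FixedDetMatrices.ext'
  rw [smul_coe]
  exact Matrix.mul_assoc _ _ _

theorem mulRight_mulRight_inv (A : FixedDetMatrix (Fin 2) ℤ m) (γ : SL2Z) :
    mulRight (mulRight A γ) γ⁻¹ = A := by
  apply FixedDetMatrices.ext'
  change A.1 * γ.1 * (γ⁻¹).1 = A.1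
  have : γ.1 * (γ⁻¹).1 = 1 := by
    rw [← Matrix.SpecialLinearGroup.coe_mul, mul_inv_cancel, Matrix.SpecialLinearGroup.coe_one]
  rw [Matrix.mul_assoc, this, Matrix.mul_one]

/-- The permutation of the representatives induced by right multiplication. -/
theorem reduce_mulRight_bijective (hm : 0 < m) (γ : SL2Z) :
    Function.Bijective fun A : reps m =>
      (⟨reduce (mulRight A.1 γ), reduce_mem_reps hm.ne' _⟩ : reps m) := by
  refine Function.Injective.bijective_of_finite fun A B hAB => Subtype.ext ?_
  have h : reduce (mulRight A.1 γ) = reduce (mulRight B.1 γ) := congrArg Subtype.val hAB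
  obtain ⟨δ, hδ⟩ := exists_reduce_eq_smul (mulRight A.1 γ)
  obtain ⟨δ', hδ'⟩ := exists_reduce_eq_smul (mulRight B.1 γ)
  rw [hδ, hδ', ← smul_mulRight, ← smul_mulRight] at h
  have h2 := congrArg (fun M => mulRight M γ⁻¹) h
  simp only [mulRight_mulRight_inv] at h2
  refine reps_eq_of_smul A.2 B.2 hm (γ := δ'⁻¹ * δ) ?_
  rw [mul_smul, h2, inv_smul_smul]

/-- The denominator `cz + d`. -/
def cocycle (A : Matrix (Fin 2) (Fin 2) ℤ) (z : ℂ) : ℂ := A 1 0 * z + A 1 1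

/-- The numerator `az + b`. -/
def numer (A : Matrix (Fin 2) (Fin 2) ℤ) (z : ℂ) : ℂ := A 0 0 * z + A 0 1

theorem cocycle_ne_zero {A : Matrix (Fin 2) (Fin 2) ℤ} (hA : A.det ≠ 0) (z : ℍ) :
    cocycle A z ≠ 0 := by
  intro h
  have him := congrArg Complex.im h
  have hre := congrArg Complex.re h
  simp only [cocycle, Complex.add_im, Complex.mul_im, Complex.intCast_re, Complex.intCast_im,
    zero_mul, add_zero, Complex.zero_im, UpperHalfPlane.coe_im, mul_eq_zero, Int.cast_eq_zero,
    z.im_pos.ne', or_false] at him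
  simp only [cocycle, him, Int.cast_zero, zero_mul, zero_add, Complex.intCast_re, Complex.zero_re,
    Int.cast_eq_zero] at hre
  exact hA (by rw [Matrix.det_fin_two, him, hre]; simp)

theorem im_numer_div_cocycle_pos {A : Matrix (Fin 2) (Fin 2) ℤ} (hA : 0 < A.det) (z : ℍ) :
    0 < (numer A z / cocycle A z).im := by
  have h0 : 0 < Complex.normSq (cocycle A z) :=
    Complex.normSq_pos.mpr (cocycle_ne_zero hA.ne' z)
  have h1 : (numer A z / cocycle A z).im = A.det * z.im / Complex.normSq (cocycle A z) := by
    rw [Complex.div_im, ← sub_div]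
    congr 1
    rw [Matrix.det_fin_two]
    simp only [numer, cocycle, Complex.add_im, Complex.add_re, Complex.mul_im, Complex.mul_re,
      Complex.intCast_re, Complex.intCast_im, UpperHalfPlane.coe_im]
    push_cast
    ring
  rw [h1]
  have : (0 : ℝ) < A.det := by exact_mod_cast hA
  have := z.im_pos
  positivity

theorem coe_smul_eq (γ : SL2Z) (z : ℍ) : ((γ • z : ℍ) : ℂ) = numer γ.1 z / cocycle γ.1 z := by
  rw [UpperHalfPlane.coe_specialLinearGroup_apply]
  simp [numer, cocycle]

theorem cocycle_mul {A B : Matrix (Fin 2) (Fin 2) ℤ} {z : ℂ} (hB : cocycle B z ≠ 0) :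
    cocycle (A * B) z = cocycle A (numer B z / cocycle B z) * cocycle B z := by
  have h : cocycle A (numer B z / cocycle B z) * cocycle B z =
      A 1 0 * numer B z + A 1 1 * cocycle B z := by
    rw [cocycle, add_mul, mul_assoc, div_mul_cancel₀ _ hB]
  rw [h]
  simp only [cocycle, numer, Matrix.mul_apply, Fin.sum_univ_two]
  push_cast
  ring

theorem numer_mul {A B : Matrix (Fin 2) (Fin 2) ℤ} {z : ℂ} (hB : cocycle B z ≠ 0) :
    numer (A * B) z = numer A (numer B z / cocycle B z) * cocycle B z := by
  have h : numer A (numer B z / cocycle B z) * cocycle B z =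
      A 0 0 * numer B z + A 0 1 * cocycle B z := by
    rw [numer, add_mul, mul_assoc, div_mul_cancel₀ _ hB]
  rw [h]
  simp only [cocycle, numer, Matrix.mul_apply, Fin.sum_univ_two]
  push_cast
  ring

/-- The weight `(r, s)` action of an integral matrix on functions. -/
def slashMat (F : ℍ → ℂ) (r s : ℤ) (A : Matrix (Fin 2) (Fin 2) ℤ) (z : ℍ) : ℂ :=
  cocycle A z ^ (-r) * conj (cocycle A z) ^ (-s) * F (ofComplex (numer A z / cocycle A z))

theorem isModular_iff {r s : ℤ} {F : ℍ → ℂ} : IsModular r s F ↔ ∀ (γ : SL2Z) (z : ℍ),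
    F (γ • z) = cocycle γ.1 z ^ r * conj (cocycle γ.1 z) ^ s * F z := by
  simp [IsModular, cocycle]

theorem slashMat_mul_left {r s : ℤ} {F : ℍ → ℂ} (hF : IsModular r s F) (γ : SL2Z)
    {A : Matrix (Fin 2) (Fin 2) ℤ} (hA : 0 < A.det) (z : ℍ) :
    slashMat F r s (γ.1 * A) z = slashMat F r s A z := by
  have hj := cocycle_ne_zero hA.ne' z
  set w : ℍ := ofComplex (numer A z / cocycle A z) with hw
  have hwc : (w : ℂ) = numer A z / cocycle A z := coe_ofComplex (im_numer_div_cocycle_pos hA z)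
  have hjw : cocycle γ.1 w ≠ 0 := cocycle_ne_zero (by rw [γ.2]; exact one_ne_zero) w
  have h1 : ofComplex (numer (γ.1 * A) z / cocycle (γ.1 * A) z) = γ • w := by
    rw [cocycle_mul hj, numer_mul hj, mul_div_mul_right _ _ hj, ← hwc, ← coe_smul_eq,
      ofComplex_apply]
  rw [slashMat, slashMat, h1, isModular_iff.mp hF, cocycle_mul hj, ← hwc, map_mul, mul_zpow,
    mul_zpow, ofComplex_apply, zpow_neg (cocycle γ.1 w), zpow_neg (conj (cocycle γ.1 w))]
  have h2 : cocycle γ.1 w ^ r ≠ 0 := zpow_ne_zero _ hjw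
  have h3 : conj (cocycle γ.1 w) ^ s ≠ 0 :=
    zpow_ne_zero _ ((map_ne_zero _).mpr hjw)
  field_simp

theorem slashMat_smul {r s : ℤ} {F : ℍ → ℂ} (γ : SL2Z) {A : Matrix (Fin 2) (Fin 2) ℤ} (z : ℍ) :
    slashMat F r s A (γ • z) =
      cocycle γ.1 z ^ r * conj (cocycle γ.1 z) ^ s * slashMat F r s (A * γ.1) z := by
  have hj : cocycle γ.1 z ≠ 0 := cocycle_ne_zero (by rw [γ.2]; exact one_ne_zero) z
  rw [slashMat, slashMat, coe_smul_eq, cocycle_mul hj, numer_mul hj, mul_div_mul_right _ _ hj,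
    map_mul, mul_zpow, mul_zpow, zpow_neg (cocycle γ.1 z), zpow_neg (conj (cocycle γ.1 z))]
  have h2 : cocycle γ.1 z ^ r ≠ 0 := zpow_ne_zero _ hj
  have h3 : conj (cocycle γ.1 z) ^ s ≠ 0 := zpow_ne_zero _ ((map_ne_zero _).mpr hj)
  field_simp

/-- The matrices with rows (a, b) and (0, d), 0 ≤ b < d, are exactly the representatives, and their
denominator is the real constant d. `slashMat` carries no determinant factor, since all determinants
equal m; the power of m stands in front. -/
theorem hecke_eq_sum_reps (F : ℍ → ℂ) (r s : ℤ) {m : ℕ} (hm : 1 ≤ m) (z : ℍ) :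
    hecke (r + s) m F z =
      (m : ℂ) ^ (r + s - 1) * ∑ A : reps (m : ℤ), slashMat F r s A.1.1 z := by
  rw [hecke]
  congr 1
  simp only [Finset.mul_sum]
  rw [Finset.sum_sigma']
  refine Finset.sum_bij (fun x hx => ⟨⟨!![(x.1.1 : ℤ), (x.2 : ℤ); 0, (x.1.2 : ℤ)], ?_⟩, ?_⟩)
    ?_ ?_ ?_ ?_
  · have := (Nat.mem_divisorsAntidiagonal.mp (Finset.mem_sigma.mp hx).1).1
    rw [Matrix.det_fin_two_of]
    simp only [mul_zero, sub_zero]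
    exact_mod_cast this
  · obtain ⟨hp, hb⟩ := Finset.mem_sigma.mp hx
    obtain ⟨ha, hd⟩ := pos_of_mem_divisorsAntidiagonal hp
    have hb' := Finset.mem_range.mp hb
    refine ⟨rfl, ?_, ?_, ?_⟩
    · simpa using ha
    · simp
    · simpa using hb'
  · intro x hx
    exact Finset.mem_univ _
  · intro x hx y hy hxy
    have h := congrArg (fun A : reps (m : ℤ) => A.1.1) hxy
    simp only at h
    have h00 := congrFun (congrFun h 0) 0
    have h01 := congrFun (congrFun h 0) 1
    have h11 := congrFun (congrFun h 1) 1
    simp at h00 h01 h11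
    obtain ⟨⟨a, d⟩, b⟩ := x
    obtain ⟨⟨a', d'⟩, b'⟩ := y
    simp_all
  · intro A _
    obtain ⟨h10, h00, h01, h11⟩ := A.2
    have hdet := A.1.2
    rw [Matrix.det_fin_two, h10, mul_zero, sub_zero] at hdet
    have hd : 0 < A.1.1 1 1 := by
      by_contra hle
      have : (0 : ℤ) < m := by exact_mod_cast hm
      nlinarith
    rw [abs_of_nonneg h01, abs_of_pos hd] at h11
    obtain ⟨a, ha⟩ := Int.eq_ofNat_of_zero_le h00.le
    obtain ⟨b, hb⟩ := Int.eq_ofNat_of_zero_le h01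
    obtain ⟨d, hd'⟩ := Int.eq_ofNat_of_zero_le hd.le
    rw [ha, hd'] at hdet
    refine ⟨⟨(a, d), b⟩, ?_, ?_⟩
    · rw [Finset.mem_sigma, Nat.mem_divisorsAntidiagonal, Finset.mem_range]
      refine ⟨⟨by exact_mod_cast hdet, by omega⟩, ?_⟩
      rw [hb, hd'] at h11
      exact_mod_cast h11
    · apply Subtype.ext
      ext i j
      fin_cases i <;> fin_cases j <;> simp [ha, hb, hd', h10]
  · intro x hx
    have hd : (x.1.2 : ℂ) ≠ 0 := by
      exact_mod_cast (pos_of_mem_divisorsAntidiagonal (Finset.mem_sigma.mp hx).1).2.ne'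
    rw [neg_add, zpow_add₀ hd]
    simp [slashMat, cocycle, numer]

/-- The sum runs over the left orbits of integral matrices of determinant m, and `slashMat` depends
only on the orbit. Right multiplication by γ permutes the orbits and produces the automorphy factor.
-/
theorem IsModular.hecke {r s : ℤ} {F : ℍ → ℂ} (hF : IsModular r s F) {m : ℕ} (hm : 1 ≤ m) :
    IsModular r s (hecke (r + s) m F) := by
  have hm' : (0 : ℤ) < m := by exact_mod_cast hm
  rw [isModular_iff]
  intro γ z
  rw [hecke_eq_sum_reps F r s hm, hecke_eq_sum_reps F r s hm, mul_left_comm]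
  congr 1
  rw [← (Equiv.ofBijective _ (reduce_mulRight_bijective hm' γ)).sum_comp
    (fun A : reps (m : ℤ) => slashMat F r s A.1.1 z), Finset.mul_sum]
  refine Finset.sum_congr rfl fun A _ => ?_
  rw [slashMat_smul]
  congr 1
  obtain ⟨δ, hδ⟩ := exists_reduce_eq_smul (mulRight A.1 γ)
  simp only [Equiv.ofBijective_apply]
  rw [hδ, smul_coe, slashMat_mul_left hF δ]
  · rfl
  · rw [(mulRight A.1 γ).2]
    exact hm'

end HeckeModular

/-! ### Operations on modular functions -/

theorem cocycle_coe_ne_zero (γ : Matrix.SpecialLinearGroup (Fin 2) ℤ) (z : ℍ) :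
    cocycle γ.1 z ≠ 0 := cocycle_ne_zero (by rw [γ.2]; exact one_ne_zero) z

theorem IsModular.mul {r s r' s' : ℤ} {F G : ℍ → ℂ} (hF : IsModular r s F)
    (hG : IsModular r' s' G) : IsModular (r + r') (s + s') (fun z => F z * G z) := by
  rw [isModular_iff] at *
  intro γ z
  have hj := cocycle_coe_ne_zero γ z
  rw [hF, hG, zpow_add₀ hj, zpow_add₀ ((map_ne_zero _).mpr hj)]
  ring

theorem IsModular.const_mul {r s : ℤ} {F : ℍ → ℂ} (hF : IsModular r s F) (c : ℂ) :
    IsModular r s (fun z => c * F z) := by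
  intro γ z
  beta_reduce
  rw [hF]
  ring

theorem IsModular.sub {r s : ℤ} {F G : ℍ → ℂ} (hF : IsModular r s F) (hG : IsModular r s G) :
    IsModular r s (fun z => F z - G z) := by
  intro γ z
  beta_reduce
  rw [hF, hG]
  ring

theorem IsModular.star {r s : ℤ} {F : ℍ → ℂ} (hF : IsModular r s F) :
    IsModular s r (fun z => conj (F z)) := by
  rw [isModular_iff] at *
  intro γ z
  rw [hF, map_mul, map_mul, map_zpow₀, map_zpow₀, Complex.conj_conj]
  ring

theorem det_eq_one_complex (γ : Matrix.SpecialLinearGroup (Fin 2) ℤ) :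
    (γ.1 0 0 : ℂ) * γ.1 1 1 - γ.1 0 1 * γ.1 1 0 = 1 := by
  have := γ.2
  rw [Matrix.det_fin_two] at this
  exact_mod_cast this

theorem sub_conj_smul (γ : Matrix.SpecialLinearGroup (Fin 2) ℤ) (z : ℍ) :
    ((γ • z : ℍ) : ℂ) - conj ((γ • z : ℍ) : ℂ) =
      ((z : ℂ) - conj (z : ℂ)) / (cocycle γ.1 z * conj (cocycle γ.1 z)) := by
  have hj := cocycle_coe_ne_zero γ z
  have hj' : conj (cocycle γ.1 z) ≠ 0 := (map_ne_zero _).mpr hj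
  rw [coe_smul_eq, map_div₀]
  have e1 : conj (numer γ.1 z) = γ.1 0 0 * conj (z : ℂ) + γ.1 0 1 := by simp [numer]
  have e2 : conj (cocycle γ.1 z) = γ.1 1 0 * conj (z : ℂ) + γ.1 1 1 := by simp [cocycle]
  rw [div_sub_div _ _ hj hj']
  congr 1
  rw [e1, e2, numer, cocycle]
  linear_combination ((z : ℂ) - conj (z : ℂ)) * det_eq_one_complex γ

theorem isModular_LL : IsModular (-1) (-1) LL := by
  rw [isModular_iff]
  intro γ z
  rw [LL_eq, LL_eq, sub_conj_smul, zpow_neg_one, zpow_neg_one]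
  rw [div_eq_mul_inv, mul_inv]
  ring

theorem isModular_LL_zpow (n : ℤ) : IsModular (-n) (-n) (fun z => LL z ^ n) := by
  have h := isModular_LL
  rw [isModular_iff] at *
  intro γ z
  rw [h, mul_zpow, mul_zpow, ← zpow_mul, ← zpow_mul, neg_one_mul]

theorem hasDerivAt_cocycle (A : Matrix (Fin 2) (Fin 2) ℤ) (z : ℂ) :
    HasDerivAt (cocycle A) (A 1 0) z := by
  have h := ((hasDerivAt_id z).const_mul (A 1 0 : ℂ)).add_const (A 1 1 : ℂ)
  rw [mul_one] at h
  exact h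

theorem hasDerivAt_numer (A : Matrix (Fin 2) (Fin 2) ℤ) (z : ℂ) :
    HasDerivAt (numer A) (A 0 0) z := by
  have h := ((hasDerivAt_id z).const_mul (A 0 0 : ℂ)).add_const (A 0 1 : ℂ)
  rw [mul_one] at h
  exact h

theorem HasWirtinger.comp_smul {F : ℍ → ℂ} {A B : ℂ} {z : ℍ}
    {γ : Matrix.SpecialLinearGroup (Fin 2) ℤ} (h : HasWirtinger F A B (γ • z)) :
    HasWirtinger (fun w => F (γ • w)) (A / cocycle γ.1 z ^ 2) (B / conj (cocycle γ.1 z) ^ 2) z := by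
  have hj := cocycle_coe_ne_zero γ z
  have e : (γ.1 0 0 * cocycle γ.1 z - numer γ.1 z * γ.1 1 0) / cocycle γ.1 z ^ 2 =
      1 / cocycle γ.1 z ^ 2 := by
    congr 1
    rw [numer, cocycle]
    linear_combination det_eq_one_complex γ
  refine (h.comp_holomorphic (G := fun w => F (γ • w))
    ((hasDerivAt_numer γ.1 z).div (hasDerivAt_cocycle γ.1 z) hj)
    (coe_smul_eq γ z).symm ?_).congr_deriv ?_ ?_
  · filter_upwards [isOpen_upperHalfPlaneSet.mem_nhds z.im_pos] with v hv
    simp only [Function.comp_apply, Pi.div_apply]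
    congr 1
    rw [← ofComplex_apply (γ • ofComplex v), coe_smul_eq, coe_ofComplex hv]
  · rw [e]
    ring
  · rw [e, map_div₀, map_one, map_pow]
    ring

/-- With j = cz + d, differentiating F(γz) = j^r j̄^s F(z) in z gives an extra term r c j^{r-1} j̄^s
F. Since c(z - z̄) = j - j̄, the weight term of ∂_r is exactly what absorbs it. -/
theorem IsModular.del {r s : ℤ} {F : ℍ → ℂ} (hF : IsModular r s F)
    (hd : ∀ z, ∃ A B, HasWirtinger F A B z) : IsModular (r + 1) (s - 1) (del r F) := by
  rw [isModular_iff]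
  intro γ z
  have hj := cocycle_coe_ne_zero γ z
  have hj' : conj (cocycle γ.1 z) ≠ 0 := (map_ne_zero _).mpr hj
  obtain ⟨A, B, hAB⟩ := hd z
  obtain ⟨A', B', hAB'⟩ := hd (γ • z)
  have h1 := hAB'.comp_smul
  have hz : ∀ k : ℤ, HasWirtinger (fun w : ℍ => cocycle γ.1 w ^ k)
      (k * cocycle γ.1 z ^ (k - 1) * γ.1 1 0) 0 z := by
    intro k
    have h3 := (hasDerivAt_zpow k (cocycle γ.1 z) (Or.inl hj)).comp (z : ℂ)
      (hasDerivAt_cocycle γ.1 z)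
    refine HasWirtinger.of_hasDerivAt (h3.congr_of_eventuallyEq ?_)
    filter_upwards [isOpen_upperHalfPlaneSet.mem_nhds z.im_pos] with v hv
    simp only [Function.comp_apply]
    rw [coe_ofComplex hv]
  have h2 := ((hz r).mul (hz s).star).mul hAB
  have e : (fun w : ℍ => F (γ • w)) =
      fun w : ℍ => cocycle γ.1 w ^ r * conj (cocycle γ.1 w ^ s) * F w := by
    funext w
    rw [isModular_iff.mp hF, map_zpow₀]
  rw [e] at h1
  have h4 := h1.dz_eq.symm.trans h2.dz_eq
  rw [hAB'.del_eq, hAB.del_eq, sub_conj_smul, isModular_iff.mp hF, zpow_add_one₀ hj,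
    zpow_sub_one₀ hj']
  have h6 : (γ.1 1 0 : ℂ) * ((z : ℂ) - conj (z : ℂ)) =
      cocycle γ.1 z - conj (cocycle γ.1 z) := by
    simp only [cocycle, map_add, map_mul, map_intCast]
    ring
  rw [zpow_sub_one₀ hj, map_zero, mul_zero, add_zero, map_zpow₀] at h4
  have h7 : A' = cocycle γ.1 z ^ 2 * (r * (cocycle γ.1 z ^ r * (cocycle γ.1 z)⁻¹) * γ.1 1 0 *
      conj (cocycle γ.1 z) ^ s * F z + cocycle γ.1 z ^ r * conj (cocycle γ.1 z) ^ s * A) := by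
    rw [← h4]
    field_simp
  rw [h7]
  generalize cocycle γ.1 z ^ r = P
  generalize conj (cocycle γ.1 z) ^ s = Q
  field_simp
  linear_combination (P * Q * r * F z) * h6

theorem isModular_delPow {f : ℍ → ℂ} {r s : ℤ} (hf : MDifferentiable 𝓘(ℂ) 𝓘(ℂ) f)
    (hm : IsModular r s f) (k : ℕ) : IsModular (r + k) (s - k) (delPow r k f) := by
  induction k with
  | zero => simpa [delPow] using hm
  | succ k ih =>
    have := ih.del (exists_hasWirtinger_delPow hf r k)
    rw [delPow]
    convert! this using 1
    · push_cast
      ring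
    · push_cast
      ring

theorem IsWeaklyHolomorphic.const_mul {k : ℤ} {f : ℍ → ℂ} (hf : IsWeaklyHolomorphic k f) (c : ℂ) :
    IsWeaklyHolomorphic k (fun z => c * f z) := by
  obtain ⟨a, ha⟩ := hf.expansion
  exact ⟨(ha.const_mul c).normalizedDeriv.1, hf.modular.const_mul c, _, ha.const_mul c⟩

theorem IsWeaklyHolomorphic.sub {k : ℤ} {f g : ℍ → ℂ} (hf : IsWeaklyHolomorphic k f)
    (hg : IsWeaklyHolomorphic k g) : IsWeaklyHolomorphic k (fun z => f z - g z) := by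
  obtain ⟨a, ha⟩ := hf.expansion
  obtain ⟨b, hb⟩ := hg.expansion
  exact ⟨(ha.sub hb).normalizedDeriv.1, hf.modular.sub hg.modular, _, ha.sub hb⟩

theorem iterate_normalizedDeriv_const_mul {f : ℍ → ℂ} (hf : MDifferentiable 𝓘(ℂ) 𝓘(ℂ) f) (c : ℂ)
    (k : ℕ) : 𝒟^[k] (fun z => c * f z) = fun z => c * 𝒟^[k] f z := by
  induction k with
  | zero => rfl
  | succ k ih =>
    rw [Function.iterate_succ_apply', Function.iterate_succ_apply', ih]
    exact Derivative.normalizedDerivOfComplex_smul c _ (mdifferentiable_iterate hf k)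

theorem iterate_normalizedDeriv_sub {f g : ℍ → ℂ} (hf : MDifferentiable 𝓘(ℂ) 𝓘(ℂ) f)
    (hg : MDifferentiable 𝓘(ℂ) 𝓘(ℂ) g) (k : ℕ) :
    𝒟^[k] (fun z => f z - g z) = fun z => 𝒟^[k] f z - 𝒟^[k] g z := by
  induction k with
  | zero => rfl
  | succ k ih =>
    rw [Function.iterate_succ_apply', Function.iterate_succ_apply', Function.iterate_succ_apply',
      ih]
    exact Derivative.normalizedDerivOfComplex_sub _ _ (mdifferentiable_iterate hf k)
      (mdifferentiable_iterate hg k)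

theorem ExpGrowth.affine {F : ℍ → ℂ} (hF : ExpGrowth F) {a b d : ℕ} (ha : 0 < a) (hd : 0 < d) :
    ExpGrowth fun z => F (ofComplex (((a : ℂ) * z + b) / d)) := by
  obtain ⟨K, hK⟩ := hF
  refine ⟨K * (a / d), ?_⟩
  have ht : Tendsto (fun z : ℍ => (ofComplex (((a : ℂ) * z + b) / d) : ℍ)) atImInfty atImInfty := by
    rw [atImInfty, tendsto_comap_iff]
    have : (UpperHalfPlane.im ∘ fun z : ℍ => (ofComplex (((a : ℂ) * z + b) / d) : ℍ)) =
        fun z : ℍ => (a / d : ℝ) * z.im := by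
      funext z
      rw [Function.comp_apply, im_ofComplex_affine ha hd]
      ring
    rw [this]
    exact Tendsto.const_mul_atTop (by positivity) tendsto_comap
  refine (hK.comp_tendsto ht).congr (fun z => rfl) fun z => ?_
  rw [Function.comp_apply, im_ofComplex_affine ha hd]
  congr 1
  ring

theorem ExpGrowth.hecke {F : ℍ → ℂ} (hF : ExpGrowth F) (w : ℤ) (m : ℕ) :
    ExpGrowth (hecke w m F) :=
  ExpGrowth.const_mul (ExpGrowth.sum _ fun _ hp => ExpGrowth.const_mul (ExpGrowth.sum _ fun _ _ =>
    hF.affine (pos_of_mem_divisorsAntidiagonal hp).1 (pos_of_mem_divisorsAntidiagonal hp).2) _) _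

theorem HasQExpansion.expGrowth_delPow {f : ℍ → ℂ} {a : ℤ → ℂ} (hf : HasQExpansion f a) (r : ℤ)
    (k : ℕ) : ExpGrowth (delPow r k f) := by
  rw [delPow_eq_sum hf.normalizedDeriv.1]
  exact ExpGrowth.sum _ fun i _ => ((expGrowth_LL_zpow i).mul
    (hf.iterate_normalizedDeriv i).expGrowth).const_mul _

/-! ### The defect forms -/

theorem HasWirtinger.delbar_add {F G : ℍ → ℂ} {A B A' B' : ℂ} {z : ℍ} (hF : HasWirtinger F A B z)
    (hG : HasWirtinger G A' B' z) (s : ℤ) :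
    delbar s (fun w => F w + G w) z = delbar s F z + delbar s G z := by
  rw [(hF.add hG).delbar_eq, hF.delbar_eq, hG.delbar_eq]
  ring

theorem HasWirtinger.delbar_const_mul {F : ℍ → ℂ} {A B : ℂ} {z : ℍ} (hF : HasWirtinger F A B z)
    (c : ℂ) (s : ℤ) : delbar s (fun w => c * F w) z = c * delbar s F z := by
  rw [(hF.const_mul c).delbar_eq, hF.delbar_eq]
  ring

theorem HasWirtinger.del_const_mul {F : ℍ → ℂ} {A B : ℂ} {z : ℍ} (hF : HasWirtinger F A B z)
    (c : ℂ) (s : ℤ) : del s (fun w => c * F w) z = c * del s F z := by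
  rw [(hF.const_mul c).del_eq, hF.del_eq]
  ring

theorem HasWirtinger.del_sub {F G : ℍ → ℂ} {A B A' B' : ℂ} {z : ℍ} (hF : HasWirtinger F A B z)
    (hG : HasWirtinger G A' B' z) (s : ℤ) :
    del s (fun w => F w - G w) z = del s F z - del s G z := by
  rw [(hF.sub hG).del_eq, hF.del_eq, hG.del_eq]
  ring

theorem HasWirtinger.delbar_sub {F G : ℍ → ℂ} {A B A' B' : ℂ} {z : ℍ} (hF : HasWirtinger F A B z)
    (hG : HasWirtinger G A' B' z) (s : ℤ) :
    delbar s (fun w => F w - G w) z = delbar s F z - delbar s G z := by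
  rw [(hF.sub hG).delbar_eq, hF.delbar_eq, hG.delbar_eq]
  ring

theorem exists_hasWirtinger_delbarPow {f : ℍ → ℂ} (hf : MDifferentiable 𝓘(ℂ) 𝓘(ℂ) f) (r : ℤ)
    (k : ℕ) (z : ℍ) : ∃ A B, HasWirtinger (delbarPow r k fun w => conj (f w)) A B z := by
  obtain ⟨A, B, h⟩ := exists_hasWirtinger_delPow hf r k z
  have e : delbarPow r k (fun w => conj (f w)) = fun w => conj (delPow r k f w) :=
    funext fun w => (conj_delPow r k f w).symm
  rw [e]
  exact ⟨_, _, h.star⟩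

/-- The operator `T_m - λ_m / m` on the component `X r s`. -/
def heckeDefect (n m : ℕ) (c : ℂ) (F : ℍ → ℂ) (z : ℍ) : ℂ := hecke n m F z - c / m * F z

theorem exists_hasWirtinger_heckeDefect {F : ℍ → ℂ} (hF : ∀ z, ∃ A B, HasWirtinger F A B z)
    (n m : ℕ) (c : ℂ) (z : ℍ) : ∃ A B, HasWirtinger (heckeDefect n m c F) A B z := by
  choose A B hAB using hF
  exact ⟨_, _, (hasWirtinger_hecke hAB n m z).sub ((hAB z).const_mul _)⟩

theorem del_heckeDefect {F : ℍ → ℂ} (hF : ∀ z, ∃ A B, HasWirtinger F A B z) (n m : ℕ) (c : ℂ)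
    (r : ℤ) (z : ℍ) : del r (heckeDefect n m c F) z = heckeDefect n m c (del r F) z := by
  choose A B hAB using hF
  have h := (hasWirtinger_hecke hAB n m z).del_sub ((hAB z).const_mul (c / m)) r
  rw [del_hecke fun z => ⟨A z, B z, hAB z⟩, (hAB z).del_const_mul] at h
  exact h

theorem delbar_heckeDefect {F : ℍ → ℂ} (hF : ∀ z, ∃ A B, HasWirtinger F A B z) (n m : ℕ) (c : ℂ)
    (r : ℤ) (z : ℍ) : delbar r (heckeDefect n m c F) z = heckeDefect n m c (delbar r F) z := by
  choose A B hAB using hF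
  have h := (hasWirtinger_hecke hAB n m z).delbar_sub ((hAB z).const_mul (c / m)) r
  rw [delbar_hecke fun z => ⟨A z, B z, hAB z⟩, (hAB z).delbar_const_mul] at h
  exact h

theorem heckeDefect_const_mul (n m : ℕ) (c d : ℂ) (F : ℍ → ℂ) (z : ℍ) :
    heckeDefect n m c (fun w => d * F w) z = d * heckeDefect n m c F z := by
  rw [heckeDefect, heckeDefect, hecke_const_mul]
  ring

theorem heckeDefect_LL_mul (n : ℕ) {m : ℕ} (hm : 1 ≤ m) (c : ℂ) (F : ℍ → ℂ) (z : ℍ) :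
    heckeDefect n m c (fun w => LL w * F w) z =
      1 / (m : ℂ) * (LL z * (hecke (n + 2) m F z - c * F z)) := by
  rw [heckeDefect, hecke_LL_mul _ hm]
  ring

/-- Bol's identity produces ψ from the hypothesis on f. The identity for X_{n,0} is then solved for
the conjugate of φ; what has to be shown is that this φ is weakly holomorphic. Applying ∂̄
repeatedly gives all other identities. -/
theorem IsPrimitiveSystem.exists_defect {n : ℕ} {f g : ℍ → ℂ} {X : ℕ → ℕ → ℍ → ℂ}
    (hX : IsPrimitiveSystem n f g X) {lam : ℕ → ℂ} {m : ℕ} (hm : 1 ≤ m)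
    (hlam : IsBolImage n (fun z => hecke (n + 2) m f z - lam m * f z)) :
    ∃ ψ φ : ℍ → ℂ, IsHeckeDefect n f g X lam m ψ φ := by
  obtain ⟨p, hp, hpe⟩ := hlam
  have hm0 : (m : ℂ) ≠ 0 := by exact_mod_cast (by omega : m ≠ 0)
  have hn0 : (n.factorial : ℂ) ≠ 0 := by exact_mod_cast n.factorial_ne_zero
  have hXw : ∀ r s, r + s = n → ∀ z, ∃ A B, HasWirtinger (X r s) A B z := fun r s h z =>
    ⟨_, _, hasWirtinger_of_analyticOnNhd (hX.mem r s h).analytic z⟩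
  -- The constant cancels the factor 1/n! of the statement against the 2^{n+1} in Bol's identity.
  set ψ : ℍ → ℂ := fun z => (n.factorial : ℂ) / 2 ^ (n + 1) * p z with hψdef
  have hψ : IsWeaklyHolomorphic (-n) ψ := hp.const_mul _
  have on_f : ∀ z, hecke (n + 2) m f z - lam m * f z =
      1 / (n.factorial : ℂ) * LL z ^ (-(n : ℤ) - 1) * delPow (-n) (n + 1) ψ z := by
    intro z
    rw [delPow_bol hψ.holo, hψdef, iterate_normalizedDeriv_const_mul hp.holo, ← hpe]
    have h1 : LL z ^ (-(n : ℤ) - 1) * LL z ^ ((n : ℤ) + 1) = 1 := by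
      rw [← zpow_add₀ (LL_ne_zero z)]
      simp
    field_simp
    linear_combination (-(hecke (n + 2) m f z - lam m * f z)) * h1
  -- the function whose conjugate is the second defect form
  set Y : ℍ → ℂ := heckeDefect n m (lam m) (X n 0) with hY
  have hYw := exists_hasWirtinger_heckeDefect (hXw n 0 rfl) n m (lam m)
  set R : ℍ → ℂ := fun z => m * (LL z ^ (n : ℤ) * Y z) -
    1 / (n.factorial : ℂ) * delPow (-n) n ψ z with hR
  -- ∂_0 has no weight term, so ∂_0 R = 0 together with z ≠ z̄ gives ∂R/∂z = 0. Here ∂_0(𝕃^n Y) =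
  -- 𝕃^n ∂_n Y reduces to the identity `on_f`.
  have hRw : ∀ z, ∃ B, HasWirtinger R 0 B z := by
    intro z
    obtain ⟨A, B, hAB⟩ := hYw z
    obtain ⟨A', B', hAB'⟩ := exists_hasWirtinger_delPow hψ.holo (-n) n z
    have h1 := ((hasWirtinger_LL_zpow n z).mul hAB).const_mul (m : ℂ)
    have h2 := hAB'.const_mul (1 / (n.factorial : ℂ))
    have h3 : del 0 R z = 0 := by
      rw [h1.del_sub h2, ((hasWirtinger_LL_zpow n z).mul hAB).del_const_mul,
        hAB'.del_const_mul, del_LL_zpow_mul _ _ hAB, zero_add, del_heckeDefect (hXw n 0 rfl)]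
      have e1 : del n (X n 0) = fun z => LL z * f z := funext hX.del_top
      have e2 : del 0 (delPow (-n) n ψ) z = delPow (-n) (n + 1) ψ z := by
        rw [delPow, neg_add_cancel]
      rw [e1, e2, heckeDefect_LL_mul n hm, on_f]
      have h1 : LL z ^ (n : ℤ) * (LL z * LL z ^ (-(n : ℤ) - 1)) = 1 := by
        rw [← zpow_one_add₀ (LL_ne_zero z), ← zpow_add₀ (LL_ne_zero z)]
        simp
      field_simp
      linear_combination (delPow (-n) (n + 1) ψ z) * h1
    have h4 := h1.sub h2
    have h5 := h4.del_eq 0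
    rw [h3, Int.cast_zero, zero_mul, add_zero] at h5
    have h6 : (z : ℂ) - conj (z : ℂ) ≠ 0 := by
      intro h
      have := LL_ne_zero z
      rw [LL_eq, h, mul_zero] at this
      exact this rfl
    have h7 := (mul_eq_zero.mp h5.symm).resolve_left h6
    exact ⟨_, h4.congr_deriv h7 rfl⟩
  set φ : ℍ → ℂ := fun z => conj (R z) with hφdef
  have hφR : ∀ z, conj (φ z) = R z := fun z => Complex.conj_conj _
  have hφholo : MDifferentiable 𝓘(ℂ) 𝓘(ℂ) φ := by
    refine mdifferentiable_of_hasWirtinger fun z => ?_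
    obtain ⟨B, hB⟩ := hRw z
    exact ⟨_, hB.star.congr_deriv rfl (map_zero _)⟩
  -- Both terms of R have weights (0, -n): 𝕃^n of weights (-n, -n) times Y of weights (n, 0), and
  -- ∂^n applied to weights (-n, 0). Conjugation exchanges the two weights.
  have hφmod : IsModular (-n) 0 φ := by
    have hXm := (hX.mem n 0 rfl).modular
    have h1 : IsModular (n : ℤ) 0 Y := by
      have h := hXm.hecke hm
      simp only [Nat.cast_zero, add_zero] at h hXm
      exact h.sub (hXm.const_mul _)
    have h2 := ((isModular_LL_zpow n).mul h1).const_mul (m : ℂ)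
    have h3 := (isModular_delPow hψ.holo hψ.modular n).const_mul (1 / (n.factorial : ℂ))
    rw [neg_add_cancel, add_zero] at h2
    rw [neg_add_cancel, zero_sub] at h3
    exact (h2.sub h3).star
  have hφgrowth : ExpGrowth φ := by
    obtain ⟨a, ha⟩ := (hX.mem n 0 rfl).expansion
    obtain ⟨b, hb⟩ := hψ.expansion
    have h1 : ExpGrowth Y := (ha.expGrowth.hecke n m).sub (ha.expGrowth.const_mul _)
    have h2 := ((expGrowth_LL_zpow n).mul h1).const_mul (m : ℂ)
    exact (h2.sub ((hb.expGrowth_delPow (-n) n).const_mul (1 / (n.factorial : ℂ)))).conj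
  have hφ : IsWeaklyHolomorphic (-n) φ :=
    ⟨hφholo, hφmod, hasQExpansion_of_expGrowth hφholo hφmod.periodic hφgrowth⟩
  -- the identities for the components
  have on_X : ∀ s r, r + s = n → ∀ z, heckeDefect n m (lam m) (X r s) z =
      1 / (m : ℂ) * (LL z ^ (-(n : ℤ)) * (1 / (r.factorial : ℂ) * delPow (-n) r ψ z +
        1 / (s.factorial : ℂ) * delbarPow (-n) s (fun w => conj (φ w)) z)) := by
    intro s
    induction s with
    | zero =>
      intro r hr z
      obtain rfl : r = n := by omega
      simp only [delbarPow, hφR, hR, Nat.factorial_zero, Nat.cast_one, div_one, one_mul]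
      have h1 : LL z ^ (-(r : ℤ)) * LL z ^ (r : ℤ) = 1 := by
        rw [← zpow_add₀ (LL_ne_zero z)]
        simp
      rw [← hY]
      field_simp
      linear_combination (-Y z * m * (r.factorial : ℂ)) * h1
    | succ s ih =>
      intro r hr z
      have hr' : (r + 1) + s = n := by omega
      have h1 := congrArg (fun G => delbar s G z) (funext (ih (r + 1) hr'))
      obtain ⟨A, B, hAB⟩ := exists_hasWirtinger_delPow hψ.holo (-n) (r + 1) z
      obtain ⟨A', B', hAB'⟩ := exists_hasWirtinger_delbarPow hφholo (-n) s z
      have hS := (hAB.const_mul (1 / ((r + 1).factorial : ℂ))).add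
        (hAB'.const_mul (1 / (s.factorial : ℂ)))
      rw [((hasWirtinger_LL_zpow (-(n : ℤ)) z).mul hS).delbar_const_mul, delbar_LL_zpow_mul _ _ hS,
        (hAB.const_mul _).delbar_add (hAB'.const_mul _), hAB.delbar_const_mul,
        hAB'.delbar_const_mul, delbar_heckeDefect (hXw (r + 1) s hr'),
        funext (hX.delbar_eq r s hr'), heckeDefect_const_mul] at h1
      -- Moving ∂̄_s past 𝕃^{-n} shifts its weight to s - n = -(r + 1), the one required by
      -- `delbar_delPow`. The resulting factor (r + 1)(s + 1) turns 1/(r + 1)! into (s + 1)/r!.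
      have e1 : (s : ℤ) + -(n : ℤ) = -(r + 1 : ℕ) := by omega
      have e2 : delbar ((s : ℤ) + -(n : ℤ)) (delbarPow (-n) s fun w => conj (φ w)) z =
          delbarPow (-n) (s + 1) (fun w => conj (φ w)) z := by
        rw [delbarPow, add_comm]
      rw [e2, e1, delbar_delPow hψ.holo] at h1
      have hs1 : (s : ℂ) + 1 ≠ 0 := by exact_mod_cast s.succ_ne_zero
      apply mul_left_cancel₀ hs1
      rw [h1]
      have hsf : (s.factorial : ℂ) ≠ 0 := by exact_mod_cast s.factorial_ne_zero
      have hrf : (r.factorial : ℂ) ≠ 0 := by exact_mod_cast r.factorial_ne_zero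
      have hr1 : (r : ℂ) + 1 ≠ 0 := by exact_mod_cast r.succ_ne_zero
      have hn : (n : ℂ) = r + 1 + s := by
        rw [← hr']
        push_cast
        ring
      rw [Nat.factorial_succ, Nat.factorial_succ]
      push_cast
      rw [hn]
      field_simp
      ring
  -- ∂̄_n is applied to the identity for X_{0,n}: the ψ-term drops out because ψ is holomorphic, and
  -- conjugation turns λ_m into its conjugate.
  have on_g : ∀ z, hecke (n + 2) m g z - conj (lam m) * g z =
      1 / (n.factorial : ℂ) * LL z ^ (-(n : ℤ) - 1) * delPow (-n) (n + 1) φ z := by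
    intro z
    have h1 := congrArg (fun G => delbar n G z) (funext (on_X n 0 (zero_add n)))
    obtain ⟨A, B, hAB⟩ := exists_hasWirtinger_delPow hψ.holo (-n) 0 z
    obtain ⟨A', B', hAB'⟩ := exists_hasWirtinger_delbarPow hφholo (-n) n z
    have hS := (hAB.const_mul (1 / (Nat.factorial 0 : ℂ))).add
      (hAB'.const_mul (1 / (n.factorial : ℂ)))
    rw [((hasWirtinger_LL_zpow (-(n : ℤ)) z).mul hS).delbar_const_mul, delbar_LL_zpow_mul _ _ hS,
      (hAB.const_mul _).delbar_add (hAB'.const_mul _), hAB.delbar_const_mul,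
      hAB'.delbar_const_mul, delbar_heckeDefect (hXw 0 n (zero_add n)), funext hX.delbar_bot,
      heckeDefect_LL_mul n hm, add_neg_cancel] at h1
    have e1 : delbar 0 (delPow (-n) 0 ψ) z = 0 := by
      rw [delPow, (hasWirtinger_of_mdifferentiable hψ.holo z).delbar_eq]
      simp
    have e2 : delbar 0 (delbarPow (-n) n fun w => conj (φ w)) z =
        conj (delPow (-n) (n + 1) φ z) := by
      rw [conj_delPow, delbarPow, neg_add_cancel]
    rw [e1, e2] at h1
    have h2 : hecke (n + 2) m (fun w => conj (g w)) z - lam m * conj (g z) =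
        1 / (n.factorial : ℂ) * LL z ^ (-(n : ℤ) - 1) * conj (delPow (-n) (n + 1) φ z) := by
      have hL := LL_ne_zero z
      apply mul_left_cancel₀ hL
      apply mul_left_cancel₀ (one_div_ne_zero hm0)
      rw [h1, zpow_sub_one₀ hL]
      field_simp
      ring
    have h3 := congrArg conj h2
    simp only [map_sub, map_mul, map_div₀, map_one, map_natCast, map_zpow₀, conj_LL,
      Complex.conj_conj] at h3
    rw [conj_hecke] at h3
    simpa only [Complex.conj_conj] using h3
  refine ⟨ψ, φ, hψ, hφ, on_f, on_g, fun r s hrs z => ?_⟩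
  have := on_X s r hrs z
  rw [heckeDefect] at this
  rw [this]
  ring

/-! ### Zeroth modes under Hecke operators and the relation for `α` -/

/-- As x runs over [0, ad], the real part (ax + b)/d runs over a² full periods, and the substitution
contributes d/a. The shift b plays no role. -/
theorem integral_affine_line {F : ℍ → ℂ} (hF : Continuous F)
    (hper : Function.Periodic (F ∘ ofComplex) 1) {a d : ℕ} (ha : 0 < a) (hd : 0 < d) (b : ℕ) {y : ℝ}
    (hy : 0 < y) :
    ∫ x in (0 : ℝ)..(a * d : ℕ),
      F (ofComplex (((a : ℂ) * (ofComplex ((x : ℂ) + y * Complex.I) : ℍ) + b) / d)) =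
      (a * d : ℕ) * zeroMode F (a * y / d) := by
  have hy' : 0 < a * y / d := by positivity
  have hd0 : (d : ℝ) ≠ 0 := by positivity
  have ha0 : (a : ℝ) ≠ 0 := by positivity
  have e : ∀ x : ℝ, F (ofComplex (((a : ℂ) * (ofComplex ((x : ℂ) + y * Complex.I) : ℍ) + b) / d)) =
      F (ofComplex (((a / d * x + b / d : ℝ) : ℂ) + (a * y / d : ℝ) * Complex.I)) := by
    intro x
    rw [coe_line x hy]
    congr 2
    push_cast
    ring
  simp only [e]
  rw [intervalIntegral.integral_comp_mul_add
    (fun t : ℝ => F (ofComplex ((t : ℂ) + (a * y / d : ℝ) * Complex.I))) (div_ne_zero ha0 hd0)]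
  have hp : Function.Periodic
      (fun t : ℝ => F (ofComplex ((t : ℂ) + (a * y / d : ℝ) * Complex.I))) 1 := by
    intro t
    have := hper ((t : ℂ) + (a * y / d : ℝ) * Complex.I)
    simp only [Function.comp_apply] at this
    beta_reduce
    rw [← this]
    congr 2
    push_cast
    ring
  have h1 := hp.intervalIntegral_add_zsmul_eq ((a : ℤ) * a) (b / d)
    (intervalIntegrable_line hF hy')
  rw [hp.intervalIntegral_add_eq _ 0, zero_add] at h1
  have e1 : (a / d : ℝ) * 0 + b / d = b / d := by ring
  have e2 : (a / d : ℝ) * ((a * d : ℕ) : ℝ) + b / d = b / d + ((a : ℤ) * a) • (1 : ℝ) := by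
    rw [zsmul_eq_mul]
    push_cast
    field_simp
    ring
  rw [e1, e2, h1, zeroMode, zsmul_eq_mul, Complex.real_smul]
  push_cast
  have : (d : ℂ) ≠ 0 := by exact_mod_cast hd.ne'
  have : (a : ℂ) ≠ 0 := by exact_mod_cast ha.ne'
  field_simp

theorem continuous_affine {F : ℍ → ℂ} (hF : Continuous F) {a d : ℕ} (ha : 0 < a) (hd : 0 < d)
    (b : ℕ) : Continuous fun z : ℍ => F (ofComplex (((a : ℂ) * z + b) / d)) := by
  refine hF.comp ?_
  rw [UpperHalfPlane.isOpenEmbedding_coe.isEmbedding.continuous_iff]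
  have e : ((↑) ∘ fun z : ℍ => (ofComplex (((a : ℂ) * z + b) / d) : ℍ)) =
      fun z : ℍ => ((a : ℂ) * z + b) / d := by
    funext z
    rw [Function.comp_apply, coe_ofComplex (im_affine_pos ha hd z.im_pos)]
  rw [e]
  have := UpperHalfPlane.continuous_coe
  fun_prop

theorem continuous_hecke {F : ℍ → ℂ} (hF : Continuous F) (w : ℤ) (m : ℕ) :
    Continuous (hecke w m F) :=
  continuous_const.mul (continuous_finsetSum _ fun _ hp => continuous_const.mul
    (continuous_finsetSum _ fun b _ => continuous_affine hF
      (pos_of_mem_divisorsAntidiagonal hp).1 (pos_of_mem_divisorsAntidiagonal hp).2 b))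

/-- A single summand of T_m F need not have period 1 in x. Integrating the whole sum over m periods
lets every summand complete an integral number of its own periods. -/
theorem zeroMode_hecke {F : ℍ → ℂ} (hF : Continuous F) {r s : ℤ} (hmod : IsModular r s F) {m : ℕ}
    (hm : 1 ≤ m) {y : ℝ} (hy : 0 < y) :
    zeroMode (hecke (r + s) m F) y = (m : ℂ) ^ (r + s - 1) * ∑ p ∈ m.divisorsAntidiagonal,
      (p.2 : ℂ) ^ (-(r + s)) * (p.2 * zeroMode F (p.1 * y / p.2)) := by
  have hm0 : (m : ℂ) ≠ 0 := by exact_mod_cast (by omega : m ≠ 0)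
  have hp : Function.Periodic
      (fun t : ℝ => hecke (r + s) m F (ofComplex ((t : ℂ) + y * Complex.I))) 1 := by
    intro t
    have := (hmod.hecke hm).periodic ((t : ℂ) + y * Complex.I)
    simp only [Function.comp_apply] at this
    beta_reduce
    rw [← this]
    congr 2
    push_cast
    ring
  have h1 := hp.intervalIntegral_add_zsmul_eq (m : ℤ) 0
    (intervalIntegrable_line (continuous_hecke hF (r + s) m) hy)
  rw [zero_add, zero_add, zsmul_eq_mul, zsmul_eq_mul, mul_one] at h1
  apply mul_left_cancel₀ hm0
  rw [zeroMode]
  simp only [Int.cast_natCast] at h1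
  rw [← h1]
  have hc : ∀ p ∈ m.divisorsAntidiagonal, ∀ b : ℕ, Continuous fun x : ℝ =>
      F (ofComplex (((p.1 : ℂ) * (ofComplex ((x : ℂ) + y * Complex.I) : ℍ) + b) / p.2)) := by
    intro p hp b
    obtain ⟨h1, h2⟩ := pos_of_mem_divisorsAntidiagonal hp
    exact (continuous_affine hF h1 h2 b).comp (continuous_line hy)
  simp only [hecke]
  rw [intervalIntegral.integral_const_mul, intervalIntegral.integral_finsetSum, mul_left_comm]
  · congr 1
    rw [Finset.mul_sum]
    refine Finset.sum_congr rfl fun p hp => ?_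
    obtain ⟨h1, h2⟩ := pos_of_mem_divisorsAntidiagonal hp
    have hpm : p.1 * p.2 = m := (Nat.mem_divisorsAntidiagonal.mp hp).1
    rw [intervalIntegral.integral_const_mul, intervalIntegral.integral_finsetSum]
    · rw [← hpm]
      simp only [integral_affine_line hF hmod.periodic h1 h2 _ hy, Finset.sum_const,
        Finset.card_range, nsmul_eq_mul]
      ring
    · exact fun b _ => (hc p hp b).intervalIntegrable _ _
  · exact fun p hp => (continuous_const.mul (continuous_finsetSum _ fun b _ =>
      hc p hp b)).intervalIntegrable _ _

theorem delPowCoeff_neg_zero (n : ℕ) :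
    delPowCoeff (-n) n 0 = (-1) ^ n * (n.factorial : ℂ) := by
  rw [delPowCoeff, Nat.choose_zero_right, Nat.cast_one, pow_zero, one_mul, one_mul]
  rw [Nat.Ico_zero_eq_range, ← Finset.prod_range_add_one_eq_factorial]
  push_cast
  have h : (-1 : ℂ) ^ n = ∏ _i ∈ Finset.range n, (-1 : ℂ) := by simp
  rw [h, ← Finset.prod_mul_distrib, ← Finset.prod_range_reflect]
  refine Finset.prod_congr rfl fun i hi => ?_
  have := Finset.mem_range.mp hi
  rw [Nat.cast_sub (by omega), Nat.cast_sub (by omega)]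
  push_cast
  ring

theorem zeroMode_delPow {f : ℍ → ℂ} {a : ℤ → ℂ} (hf : HasQExpansion f a) (n : ℕ) {y : ℝ}
    (hy : 0 < y) : zeroMode (delPow (-n) n f) y = (-1) ^ n * (n.factorial : ℂ) * a 0 := by
  rw [delPow_eq_sum hf.normalizedDeriv.1, zeroMode_sum _ _ hy]
  · rw [Finset.sum_eq_single 0]
    · rw [zeroMode_const_mul, zeroMode_LL_zpow_mul _ _ hy,
        (hf.iterate_normalizedDeriv 0).zeroMode_eq hy,        delPowCoeff_neg_zero]
      simp
    · intro i _ hi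
      rw [zeroMode_const_mul, zeroMode_LL_zpow_mul _ _ hy,
        (hf.iterate_normalizedDeriv i).zeroMode_eq hy]
      simp [hi]
    · simp
  · intro i _
    exact continuous_const.mul (continuous_of_hasWirtinger
      (hasWirtinger_LL_mul_iterate hf.normalizedDeriv.1 i))

/-- The matrix -1 acts trivially on ℍ but multiplies the form by (-1)^k. -/
theorem IsModular.eq_zero_of_odd {k : ℤ} (hk : Odd k) {f : ℍ → ℂ} (hf : IsModular k 0 f) :
    f = fun _ => 0 := by
  funext z
  have h := hf (-1) z
  have h1 : (-1 : Matrix.SpecialLinearGroup (Fin 2) ℤ) • z = z := by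
    rw [ModularGroup.SL_neg_smul, one_smul]
  rw [h1] at h
  simp [hk.neg_one_zpow] at h
  exact self_eq_neg.mp h

/-- The two values 𝕃 = -1 and 𝕃 = -2 suffice: eliminating P leaves Q(2^{n+1} - 1) = 0, which also
covers n = 0. -/
theorem eq_zero_of_linear_combination_LL {n : ℕ} {P Q : ℂ}
    (h : ∀ y : ℝ, 0 < y → P * ((-2 * Real.pi * y : ℝ) : ℂ) +
      Q * ((-2 * Real.pi * y : ℝ) : ℂ) ^ (-(n : ℤ)) = 0) : Q = 0 := by
  have hpi := Real.pi_pos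
  have h1 := h (1 / (2 * Real.pi)) (by positivity)
  have h2 := h (2 / (2 * Real.pi)) (by positivity)
  have e1 : -2 * Real.pi * (1 / (2 * Real.pi)) = -1 := by field_simp
  have e2 : -2 * Real.pi * (2 / (2 * Real.pi)) = -2 := by field_simp
  rw [e1, zpow_neg, zpow_natCast] at h1
  rw [e2, zpow_neg, zpow_natCast] at h2
  push_cast at h1 h2
  have e3 : (-2 : ℂ) ^ n = 2 ^ n * (-1) ^ n := by rw [← mul_pow]; norm_num
  have h3 : ((-1 : ℂ) ^ n) * (-1) ^ n = 1 := by rw [← mul_pow]; simp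
  have h4 : (-1 : ℂ) ^ n ≠ 0 := pow_ne_zero _ (by norm_num)
  have h5 : (2 : ℂ) ^ n ≠ 0 := pow_ne_zero _ (by norm_num)
  rw [e3] at h2
  field_simp at h1 h2
  have h6 : Q * (2 ^ (n + 1) - 1) = 0 := by
    rw [pow_succ]
    linear_combination 2 ^ n * 2 * h1 - h2
  refine (mul_eq_zero.mp h6).resolve_right ?_
  have : (1 : ℝ) < 2 ^ (n + 1) := one_lt_pow₀ (by norm_num) (by omega)
  refine sub_ne_zero.mpr ?_
  exact_mod_cast this.ne'

/-- This is the multiplier of 𝕃^{-n} under T_m. With ad = m each summand is m^{n-1} d a^{-n} =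
d^{n+1}/m. -/
theorem sum_hecke_eq_sigma (n : ℕ) {m : ℕ} (hm : 1 ≤ m) :
    (m : ℂ) ^ ((n : ℤ) - 1) * ∑ p ∈ m.divisorsAntidiagonal,
      (p.2 : ℂ) ^ (-(n : ℤ)) * (p.2 * ((p.1 : ℂ) / p.2) ^ (-(n : ℤ))) =
      1 / (m : ℂ) * (ArithmeticFunction.sigma (n + 1) m : ℂ) := by
  have hm0 : (m : ℂ) ≠ 0 := by exact_mod_cast (by omega : m ≠ 0)
  rw [ArithmeticFunction.sigma_apply,
    ← Nat.sum_divisorsAntidiagonal' (f := fun _ d => d ^ (n + 1)), zpow_sub_one₀ hm0]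
  push_cast
  rw [Finset.mul_sum, Finset.mul_sum]
  refine Finset.sum_congr rfl fun p hp => ?_
  obtain ⟨h1, h2⟩ := pos_of_mem_divisorsAntidiagonal hp
  have h1' : (p.1 : ℂ) ≠ 0 := by exact_mod_cast h1.ne'
  have h2' : (p.2 : ℂ) ≠ 0 := by exact_mod_cast h2.ne'
  have hpm : (m : ℂ) = p.1 * p.2 := by
    exact_mod_cast (Nat.mem_divisorsAntidiagonal.mp hp).1.symm
  rw [hpm]
  simp only [zpow_neg, zpow_natCast, mul_pow, div_pow, pow_succ]
  field_simp

/-- The zeroth modes of both sides of the identity for X_{n,0} are compared at 𝕃^{-n}. In ∂^n ψ only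
the undifferentiated term has a constant coefficient, so it contributes (-1)^n n! a₀(ψ). -/
theorem IsHeckeDefect.relation {n : ℕ} {f g : ℍ → ℂ} {X : ℕ → ℕ → ℍ → ℂ} {lam : ℕ → ℂ} {m : ℕ}
    {ψ φ : ℍ → ℂ} {A α : ℂ} (hX : IsPrimitiveSystem n f g X) (hm : 1 ≤ m)
    (hα : ∀ y : ℝ, 0 < y → zeroMode (X n 0) y = A * ((-2 * Real.pi * y : ℝ) : ℂ) +
      α * (-1) ^ n * ((-2 * Real.pi * y : ℝ) : ℂ) ^ (-(n : ℤ)))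
    (h : IsHeckeDefect n f g X lam m ψ φ) :
    ((ArithmeticFunction.sigma (n + 1) m : ℂ) - lam m) * α = qCoeff ψ 0 + conj (qCoeff φ 0) := by
  have hm0 : (m : ℂ) ≠ 0 := by exact_mod_cast (by omega : m ≠ 0)
  have hn0 : (n.factorial : ℂ) ≠ 0 := by exact_mod_cast n.factorial_ne_zero
  have hXm := (hX.mem n 0 rfl).modular
  have hXc := continuous_of_analyticOnNhd (hX.mem n 0 rfl).analytic
  have hψc : Continuous (delPow (-n) n ψ) :=
    continuous_of_hasWirtinger (exists_hasWirtinger_delPow h.hol_psi.holo (-n) n)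
  have hψc' : Continuous fun z => 1 / (n.factorial : ℂ) * delPow (-n) n ψ z :=
    continuous_const.mul hψc
  have hφc : Continuous fun z => conj (φ z) :=
    Complex.continuous_conj.comp h.hol_phi.holo.continuous
  have key : ∀ y : ℝ, 0 < y → zeroMode (hecke n m (X n 0)) y - lam m / m * zeroMode (X n 0) y =
      1 / (m : ℂ) * (((-2 * Real.pi * y : ℝ) : ℂ) ^ (-(n : ℤ)) *
        ((-1) ^ n * qCoeff ψ 0 + conj (qCoeff φ 0))) := by
    intro y hy
    have hXc' : Continuous fun z => lam m / m * X n 0 z := continuous_const.mul hXc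
    rw [← zeroMode_const_mul, ← zeroMode_sub (continuous_hecke hXc n m) hXc' hy]
    have e : (fun z => hecke n m (X n 0) z - lam m / m * X n 0 z) = fun z =>
        1 / (m : ℂ) * (LL z ^ (-(n : ℤ)) * (1 / (n.factorial : ℂ) * delPow (-n) n ψ z +
          conj (φ z))) := by
      funext z
      rw [h.on_X n 0 rfl z]
      simp only [delbarPow, Nat.factorial_zero, Nat.cast_one, div_one]
      ring
    rw [e, zeroMode_const_mul, zeroMode_LL_zpow_mul _ _ hy,
      zeroMode_add hψc' hφc hy, zeroMode_const_mul,
      zeroMode_delPow h.hol_psi.hasQExpansion n hy, zeroMode_conj,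
      h.hol_phi.hasQExpansion.zeroMode_eq hy]
    field_simp
  have hQ : α * (-1) ^ n * (1 / (m : ℂ) * (ArithmeticFunction.sigma (n + 1) m : ℂ)) -
      lam m / m * (α * (-1) ^ n) - 1 / (m : ℂ) *
        ((-1) ^ n * qCoeff ψ 0 + conj (qCoeff φ 0)) = 0 := by
    -- P collects what comes from the linear term A𝕃; its value does not matter, because 𝕃 and
    -- 𝕃^{-n} are independent.
    refine eq_zero_of_linear_combination_LL (n := n) (P := (m : ℂ) ^ ((n : ℤ) - 1) *
      (∑ p ∈ m.divisorsAntidiagonal, (p.2 : ℂ) ^ (-(n : ℤ)) * (p.2 * (A * (p.1 / p.2)))) -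
        lam m / m * A) fun y hy => ?_
    have h1 := key y hy
    have h2 := zeroMode_hecke hXc hXm hm hy
    simp only [Nat.cast_zero, add_zero] at h2
    have h3 : ∑ p ∈ m.divisorsAntidiagonal, (p.2 : ℂ) ^ (-(n : ℤ)) *
        (p.2 * zeroMode (X n 0) (p.1 * y / p.2)) =
        (∑ p ∈ m.divisorsAntidiagonal, (p.2 : ℂ) ^ (-(n : ℤ)) * (p.2 * (A * (p.1 / p.2)))) *
          ((-2 * Real.pi * y : ℝ) : ℂ) +
        (∑ p ∈ m.divisorsAntidiagonal,
          (p.2 : ℂ) ^ (-(n : ℤ)) * (p.2 * ((p.1 : ℂ) / p.2) ^ (-(n : ℤ)))) *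
          (α * (-1) ^ n * ((-2 * Real.pi * y : ℝ) : ℂ) ^ (-(n : ℤ))) := by
      rw [Finset.sum_mul, Finset.sum_mul, ← Finset.sum_add_distrib]
      refine Finset.sum_congr rfl fun p hp => ?_
      obtain ⟨h1, h2⟩ := pos_of_mem_divisorsAntidiagonal hp
      have e : ((-2 * Real.pi * (p.1 * y / p.2) : ℝ) : ℂ) =
          (p.1 : ℂ) / p.2 * ((-2 * Real.pi * y : ℝ) : ℂ) := by
        push_cast
        ring
      rw [hα _ (by positivity), e, mul_zpow]
      ring
    have h4 := sum_hecke_eq_sigma n hm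
    rw [h3] at h2
    rw [h2, hα y hy] at h1
    linear_combination h1 -
      (α * (-1) ^ n * ((-2 * Real.pi * y : ℝ) : ℂ) ^ (-(n : ℤ))) * h4
  have h3 : ((-1 : ℂ) ^ n) * (-1) ^ n = 1 := by rw [← mul_pow]; simp
  -- The sign (-1)^n on the ψ-side is missing on the φ-side; this is harmless, since for odd n the
  -- weight is odd and φ vanishes.
  have h4 : (-1 : ℂ) ^ n * conj (qCoeff φ 0) = conj (qCoeff φ 0) := by
    rcases Nat.even_or_odd n with he | ho
    · rw [he.neg_one_pow, one_mul]
    · have hk : Odd (-(n : ℤ)) := by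
        rw [odd_neg]
        exact_mod_cast ho
      rw [h.hol_phi.modular.eq_zero_of_odd hk, hasQExpansion_zero.qCoeff_eq]
      simp
  field_simp at hQ
  linear_combination (-1 : ℂ) ^ n * hQ + h4 +
    (qCoeff ψ 0 - α * ((ArithmeticFunction.sigma (n + 1) m : ℂ) - lam m)) * h3

/-! ### Weakly holomorphic forms of weight two -/

/-- Dividing by m does not spoil convergence. At m = 0 the quotient is 0 by the convention for
division by zero, so the constant term of f is lost and appears as a correction. -/
theorem HasQExpansion.exists_primitive {f : ℍ → ℂ} {a : ℤ → ℂ} (hf : HasQExpansion f a) :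
    ∃ G : ℍ → ℂ, HasQExpansion G (fun m => a m / m) ∧ ∀ z, 𝒟 G z = f z - a 0 := by
  have hG : HasQExpansion (fun z => ∑' m : ℤ, a m / m * nome z ^ m) (fun m => a m / m) := by
    obtain ⟨N, hN⟩ := hf.1
    refine ⟨⟨N, fun m hm => by simp [hN m hm]⟩, fun z => Summable.hasSum ?_⟩
    refine Summable.of_norm_bounded (hf.summable_norm z) fun m => ?_
    rw [norm_mul, norm_mul, norm_div]
    gcongr
    rcases eq_or_ne m 0 with rfl | hm
    · simp
    · refine div_le_self (norm_nonneg _) ?_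
      rw [Complex.norm_intCast]
      exact_mod_cast Int.one_le_abs hm
  refine ⟨_, hG, fun z => ?_⟩
  have h1 := (hG.normalizedDeriv.2.2 z).add (hasSum_ite_eq (0 : ℤ) (a 0))
  rw [eq_sub_iff_add_eq]
  refine h1.unique ?_
  convert! hf.2 z using 2 with m
  rcases eq_or_ne m 0 with rfl | hm
  · simp
  · have : (m : ℂ) ≠ 0 := by exact_mod_cast hm
    simp only [hm, if_false, add_zero]
    rw [mul_div_cancel₀ _ this]

theorem exists_const_of_hasWirtinger_zero {F : ℍ → ℂ} (hF : ∀ z, HasWirtinger F 0 0 z) :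
    ∃ c, ∀ z, F z = c := by
  refine ⟨F UpperHalfPlane.I, fun z => ?_⟩
  have hd : ∀ w ∈ upperHalfPlaneSet, HasFDerivAt (F ∘ ofComplex) (0 : ℂ →L[ℝ] ℂ) w := by
    intro w hw
    have := hF ⟨w, hw⟩
    rw [HasWirtinger] at this
    refine this.congr_fderiv ?_
    ext v
    simp [wirtinger_apply]
  have := isOpen_upperHalfPlaneSet.is_const_of_fderiv_eq_zero (𝕜 := ℝ)
    (convex_halfSpace_im_gt 0).isPreconnected
    (fun w hw => (hd w hw).differentiableAt.differentiableWithinAt)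
    (fun w hw => (hd w hw).fderiv) z.im_pos UpperHalfPlane.I.im_pos
  rwa [Function.comp_apply, Function.comp_apply, ofComplex_apply, ofComplex_apply] at this

theorem hasWirtinger_coe (z : ℍ) : HasWirtinger (fun w : ℍ => (w : ℂ)) 1 0 z :=
  HasWirtinger.of_hasDerivAt ((hasDerivAt_id (z : ℂ)).congr_of_eventuallyEq
    (coe_comp_ofComplex_eventuallyEq z))

theorem smul_of_generators {G : ℍ → ℂ} (hS : ∀ z : ℍ, G (ModularGroup.S • z) = G z)
    (hT : ∀ z : ℍ, G (ModularGroup.T • z) = G z) (γ : Matrix.SpecialLinearGroup (Fin 2) ℤ) (z : ℍ) :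
    G (γ • z) = G z := by
  have hγ : γ ∈ Subgroup.closure {ModularGroup.S, ModularGroup.T} := by
    rw [SpecialLinearGroup.SL2Z_generators]
    trivial
  induction hγ using Subgroup.closure_induction generalizing z with
  | mem x hx =>
    rcases hx with rfl | rfl
    · exact hS z
    · exact hT z
  | one => rw [one_smul]
  | mul x y _ _ hx hy => rw [mul_smul, hx, hy]
  | inv x _ hx => rw [← hx, smul_inv_smul]

/-- A weakly holomorphic form of weight two is the derivative of a modular function; in particular
its constant term vanishes. -/
theorem IsWeaklyHolomorphic.exists_primitive {f : ℍ → ℂ} (hf : IsWeaklyHolomorphic 2 f) :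
    qCoeff f 0 = 0 ∧ ∃ G, IsWeaklyHolomorphic 0 G ∧ f = 𝒟 G := by
  obtain ⟨G₁, hG₁, hder⟩ := hf.hasQExpansion.exists_primitive
  -- The linear term restores the constant coefficient lost in G₁, so that G is a true
  -- antiderivative of 2πi f.
  set κ : ℂ := 2 * Real.pi * Complex.I * qCoeff f 0 with hκ
  set G : ℍ → ℂ := fun z => G₁ z + κ * z with hG
  have hGw : ∀ z, HasWirtinger G (2 * Real.pi * Complex.I * f z) 0 z := by
    intro z
    refine ((hasWirtinger_of_mdifferentiable hG₁.normalizedDeriv.1 z).add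
      ((hasWirtinger_coe z).const_mul κ)).congr_deriv ?_ (by simp)
    rw [hder, hκ]
    ring
  -- Weight 2 makes f dz invariant, so G changes under γ by a constant. S and ST act on ℍ with
  -- orders 2 and 3, so twice, respectively three times, the constant is zero; hence T also fixes G.
  have hconst : ∀ γ : Matrix.SpecialLinearGroup (Fin 2) ℤ, ∃ c, ∀ z : ℍ, G (γ • z) = G z + c := by
    intro γ
    have h1 : ∀ z, HasWirtinger (fun w => G (γ • w) - G w) 0 0 z := by
      intro z
      refine ((hGw (γ • z)).comp_smul.sub (hGw z)).congr_deriv ?_ (by simp)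
      have hj := cocycle_coe_ne_zero γ z
      rw [isModular_iff.mp hf.modular, zpow_zero, mul_one, sub_eq_zero]
      rw [show (2 : ℤ) = ((2 : ℕ) : ℤ) from rfl, zpow_natCast]
      field_simp
    obtain ⟨c, hc⟩ := exists_const_of_hasWirtinger_zero h1
    exact ⟨c, fun z => by rw [← hc z]; ring⟩
  have hneg : ∀ z : ℍ, (-1 : Matrix.SpecialLinearGroup (Fin 2) ℤ) • z = z := fun z => by
    rw [ModularGroup.SL_neg_smul, one_smul]
  have hSS : ModularGroup.S * ModularGroup.S = -1 := by decide
  have hU : ModularGroup.S * ModularGroup.T * (ModularGroup.S * ModularGroup.T) *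
      (ModularGroup.S * ModularGroup.T) = -1 := by decide
  have hS : ∀ z : ℍ, G (ModularGroup.S • z) = G z := by
    obtain ⟨c, hc⟩ := hconst ModularGroup.S
    have h1 := hc (ModularGroup.S • UpperHalfPlane.I)
    rw [smul_smul, hSS, hneg, hc] at h1
    have h2 : c = 0 := by linear_combination (-1 / 2 : ℂ) * h1
    intro z
    rw [hc, h2, add_zero]
  have hST : ∀ z : ℍ, G ((ModularGroup.S * ModularGroup.T) • z) = G z := by
    obtain ⟨c, hc⟩ := hconst (ModularGroup.S * ModularGroup.T)
    have h1 := hneg UpperHalfPlane.I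
    rw [← hU, mul_smul, mul_smul] at h1
    have h2 := congrArg G h1
    rw [hc, hc, hc] at h2
    have h3 : c = 0 := by linear_combination (1 / 3 : ℂ) * h2
    intro z
    rw [hc, h3, add_zero]
  have hT : ∀ z : ℍ, G (ModularGroup.T • z) = G z := fun z => by
    rw [← hS, smul_smul, hST]
  have hG₁T : G₁ (ModularGroup.T • UpperHalfPlane.I) = G₁ UpperHalfPlane.I := by
    rw [← (hG₁.2 (ModularGroup.T • UpperHalfPlane.I)).tsum_eq,
      ← (hG₁.2 UpperHalfPlane.I).tsum_eq]
    have : nome (ModularGroup.T • UpperHalfPlane.I) = nome UpperHalfPlane.I := by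
      rw [UpperHalfPlane.modular_T_smul, nome, nome, UpperHalfPlane.coe_vadd, mul_add,
        Complex.exp_add]
      simp
    rw [this]
  -- G₁ is a series in q and does not change under z ↦ z + 1, so κ is the period of G under T.
  have hκ0 : κ = 0 := by
    have h := hT UpperHalfPlane.I
    simp only [hG] at h
    rw [hG₁T, UpperHalfPlane.modular_T_smul, UpperHalfPlane.coe_vadd] at h
    push_cast at h
    linear_combination h
  have h0 : qCoeff f 0 = 0 := by
    rw [hκ] at hκ0
    simpa [Real.pi_ne_zero] using hκ0
  have hGG : G = G₁ := by
    funext z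
    rw [hG, hκ0]
    simp
  refine ⟨h0, G₁, ⟨hG₁.normalizedDeriv.1, ?_, _, hG₁⟩, ?_⟩
  · intro γ z
    rw [← hGG, smul_of_generators hS hT]
    simp
  · funext z
    rw [hder, h0, sub_zero]

/-! ### The image of Bol's operator -/

/-- Modularity is seen on the other side of Bol's identity: 𝕃^{-n-1} has weights (n + 1, n + 1) and
∂^{n+1} p has weights (1, -n - 1). -/
theorem IsWeaklyHolomorphic.bol {n : ℕ} {p : ℍ → ℂ} (hp : IsWeaklyHolomorphic (-n) p) :
    IsWeaklyHolomorphic (n + 2) (𝒟^[n + 1] p) := by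
  refine ⟨mdifferentiable_iterate hp.holo _, ?_, _, hp.hasQExpansion.iterate_normalizedDeriv _⟩
  have h1 := ((isModular_LL_zpow (-(n + 1))).mul
    (isModular_delPow hp.holo hp.modular (n + 1))).const_mul (1 / 2 ^ (n + 1))
  convert! h1 using 1
  · push_cast
    ring
  · push_cast
    ring
  · funext z
    rw [delPow_bol hp.holo]
    have : LL z ^ (-((n : ℤ) + 1)) * LL z ^ ((n : ℤ) + 1) = 1 := by
      rw [← zpow_add₀ (LL_ne_zero z)]
      simp
    field_simp
    linear_combination (-𝒟^[n + 1] p z) * this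

theorem isWeaklyHolomorphic_zero (k : ℤ) : IsWeaklyHolomorphic k fun _ => 0 :=
  ⟨mdifferentiable_const, fun _ _ => by simp, _, hasQExpansion_zero⟩

theorem IsBolImage.sub {n : ℕ} {f g : ℍ → ℂ} (hf : IsBolImage n f) (hg : IsBolImage n g) :
    IsBolImage n fun z => f z - g z := by
  obtain ⟨p, hp, rfl⟩ := hf
  obtain ⟨q, hq, rfl⟩ := hg
  exact ⟨_, hp.sub hq, (iterate_normalizedDeriv_sub hp.holo hq.holo _).symm⟩

theorem IsBolImage.const_mul {n : ℕ} {f : ℍ → ℂ} (hf : IsBolImage n f) (c : ℂ) :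
    IsBolImage n fun z => c * f z := by
  obtain ⟨p, hp, rfl⟩ := hf
  exact ⟨_, hp.const_mul c, (iterate_normalizedDeriv_const_mul hp.holo c _).symm⟩

theorem isBolImage_zero (n : ℕ) : IsBolImage n fun _ => 0 := by
  refine ⟨fun _ => 0, isWeaklyHolomorphic_zero _, ?_⟩
  funext z
  refine ((hasQExpansion_zero.iterate_normalizedDeriv (n + 1)).2 z).unique ?_ |>.symm
  simp

/-! ### Weakly holomorphic forms with prescribed leading term -/

theorem hasQExpansion_one : HasQExpansion (fun _ => 1) (fun m => if m = 0 then 1 else 0) := by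
  refine ⟨⟨0, fun m hm => if_neg (by omega)⟩, fun z => ?_⟩
  convert! hasSum_ite_eq (0 : ℤ) (1 : ℂ) using 2 with m
  split_ifs with h
  · simp [h]
  · simp [h]

theorem HasQExpansion.tendsto {f : ℍ → ℂ} {a : ℤ → ℂ} (hf : HasQExpansion f a)
    (ha : ∀ m < 0, a m = 0) : Tendsto f atImInfty (nhds (a 0)) := by
  have h1 := hf.sub (hasQExpansion_one.const_mul (a 0))
  obtain ⟨C, hC⟩ := h1.exists_bound (N := -1) fun m hm => by
    rcases eq_or_ne m 0 with rfl | h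
    · simp
    · simp [h, ha m (by omega)]
  rw [tendsto_iff_norm_sub_tendsto_zero]
  have h2 := (tendsto_nome.norm).const_mul C
  rw [norm_zero, mul_zero] at h2
  refine squeeze_zero' (Eventually.of_forall fun z => norm_nonneg _) ?_ h2
  filter_upwards [eventually_atImInfty_le_im 1] with z hz
  simpa using hC z hz

theorem isModular_of_slashInvariant {k : ℤ} {F : Type*} [FunLike F ℍ ℂ]
    [SlashInvariantFormClass F (Matrix.SpecialLinearGroup.mapGL (R := ℤ) (n := Fin 2) ℝ).range k]
    (f : F) :
    IsModular k 0 f := by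
  intro γ z
  have hγ : Matrix.SpecialLinearGroup.mapGL ℝ γ ∈
    (Matrix.SpecialLinearGroup.mapGL (R := ℤ) (n := Fin 2) ℝ).range := ⟨γ, rfl⟩
  exact (SlashInvariantForm.slash_action_eqn' f hγ z).trans (by simp)

theorem exists_hasQExpansion_E {k : ℕ} (hk : 3 ≤ k) (hk2 : Even k) :
    ∃ a, HasQExpansion (ModularForm.E hk) a ∧ (∀ m < 0, a m = 0) ∧ a 0 = 1 := by
  refine ⟨fun m => if 0 ≤ m then (qExpansion 1 (ModularForm.E hk)).coeff m.toNat else 0,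
    ⟨⟨0, fun m hm => if_neg (by omega)⟩, fun z => ?_⟩, fun m hm => if_neg (by omega), ?_⟩
  · have hs := ModularForm.hasSum_qExpansion one_pos
      one_mem_strictPeriods_SL (f := ModularForm.E hk) z
    have hinj : Function.Injective fun j : ℕ => (j : ℤ) := Nat.cast_injective
    rw [← hinj.hasSum_iff]
    · convert! hs using 2 with j
      simp [nome, Function.Periodic.qParam]
    · intro m hm
      have h0 : ¬ 0 ≤ m := fun h0 => hm ⟨m.toNat, by simp [h0]⟩
      simp [h0]
  · simpa using EisensteinSeries.E_qExpansion_coeff_zero hk hk2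

theorem IsWeaklyHolomorphic.of_expGrowth {k : ℤ} {f : ℍ → ℂ} (h1 : MDifferentiable 𝓘(ℂ) 𝓘(ℂ) f)
    (h2 : IsModular k 0 f) (h3 : ExpGrowth f) : IsWeaklyHolomorphic k f :=
  ⟨h1, h2, hasQExpansion_of_expGrowth h1 h2.periodic h3⟩

theorem IsWeaklyHolomorphic.mul {k l : ℤ} {f g : ℍ → ℂ} (hf : IsWeaklyHolomorphic k f)
    (hg : IsWeaklyHolomorphic l g) : IsWeaklyHolomorphic (k + l) fun z => f z * g z := by
  have hm := hf.modular.mul hg.modular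
  rw [add_zero] at hm
  exact .of_expGrowth (hf.holo.mul hg.holo) hm
    (hf.hasQExpansion.expGrowth.mul hg.hasQExpansion.expGrowth)

theorem tendsto_discriminant_div_nome :
    Tendsto (fun z : ℍ => ModularForm.discriminant z * (nome z)⁻¹) atImInfty (nhds 1) := by
  refine ModularForm.tendsto_atImInfty_tprod_one_sub_eta_q_pow.congr fun z => ?_
  rw [ModularForm.discriminant_eq_q_prod]
  have : Function.Periodic.qParam 1 z = nome z := by simp [nome, Function.Periodic.qParam]
  rw [this]
  have := nome_ne_zero z
  field_simp

theorem ExpGrowth.of_tendsto {F : ℍ → ℂ} {c : ℂ} {j : ℤ}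
    (h : Tendsto (fun z => F z * nome z ^ (-j)) atImInfty (nhds c)) : ExpGrowth F := by
  have h1 : ExpGrowth fun z => F z * nome z ^ (-j) := by
    refine ⟨0, ?_⟩
    simpa using h.isBigO_one ℝ
  have h2 := h1.mul (expGrowth_nome_zpow j)
  have e : (fun z => F z * nome z ^ (-j) * nome z ^ j) = F := by
    funext z
    rw [mul_assoc, ← zpow_add₀ (nome_ne_zero z)]
    simp
  rwa [e] at h2

theorem tendsto_discriminant_zpow (j : ℤ) :
    Tendsto (fun z : ℍ => ModularForm.discriminant z ^ j * nome z ^ (-j)) atImInfty (nhds 1) := by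
  have h := tendsto_discriminant_div_nome.zpow₀ j (Or.inl one_ne_zero)
  rw [one_zpow] at h
  refine h.congr fun z => ?_
  rw [mul_zpow, inv_zpow, zpow_neg]

theorem isWeaklyHolomorphic_discriminant_zpow (j : ℤ) :
    IsWeaklyHolomorphic (12 * j) fun z => ModularForm.discriminant z ^ j := by
  refine .of_expGrowth ?_ ?_ (.of_tendsto (tendsto_discriminant_zpow j))
  · have h : MDifferentiable 𝓘(ℂ) 𝓘(ℂ) ModularForm.discriminant := CuspForm.discriminant.holo'
    rw [UpperHalfPlane.mdifferentiable_iff] at *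
    exact h.zpow (Or.inl fun z _ => ModularForm.discriminant_ne_zero _)
  · have h : IsModular 12 0 ModularForm.discriminant :=
      isModular_of_slashInvariant CuspForm.discriminant
    intro γ z
    beta_reduce
    rw [h, mul_zpow, mul_zpow, ← zpow_mul, zpow_zero, one_zpow]

/-- The forms `E_l Δ^j`. -/
theorem exists_leading_form {l : ℕ} (hl : l = 0 ∨ 3 ≤ l ∧ Even l) (j : ℤ) :
    ∃ F, IsWeaklyHolomorphic (l + 12 * j) F ∧ (∀ i < j, qCoeff F i = 0) ∧ qCoeff F j = 1 := by
  obtain ⟨e, he, hlim⟩ : ∃ e, IsWeaklyHolomorphic l e ∧ Tendsto e atImInfty (nhds 1) := by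
    rcases hl with rfl | ⟨hl, hl2⟩
    · exact ⟨fun _ => 1, ⟨mdifferentiable_const, fun γ z => by simp, _, hasQExpansion_one⟩,
        tendsto_const_nhds⟩
    · obtain ⟨a, ha, hneg, h0⟩ := exists_hasQExpansion_E hl hl2
      refine ⟨_, ⟨ha.normalizedDeriv.1, isModular_of_slashInvariant (ModularForm.E hl), a, ha⟩, ?_⟩
      rw [← h0]
      exact ha.tendsto hneg
  have hF := he.mul (isWeaklyHolomorphic_discriminant_zpow j)
  have hlead := hlim.mul (tendsto_discriminant_zpow j)
  rw [one_mul] at hlead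
  simp only [← mul_assoc] at hlead
  exact ⟨_, hF, fun i hi =>
    hF.hasQExpansion.coeff_eq_zero_of_tendsto hF.holo.continuous hi hlead,
    hF.hasQExpansion.coeff_eq_of_tendsto hF.holo.continuous hlead⟩

/-! ### Hecke operators on `q`-expansions -/

/-- The coefficients of `T_m f` in terms of those of `f`. -/
def heckeCoeff (w : ℤ) (m : ℕ) (a : ℤ → ℂ) (j : ℤ) : ℂ :=
  (m : ℂ) ^ (w - 1) * ∑ p ∈ m.divisorsAntidiagonal, (p.2 : ℂ) ^ (-w) *
    (p.2 * if (p.1 : ℤ) ∣ j then a (p.2 * (j / p.1)) else 0)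

/-- The sum over b is a geometric sum of the d-th root of unity e^{2πik/d}, equal to d if d divides
k and to 0 otherwise. -/
theorem sum_nome_affine_zpow {a d : ℕ} (ha : 0 < a) (hd : 0 < d) (z : ℍ) (k : ℤ) :
    ∑ b ∈ Finset.range d, nome (ofComplex (((a : ℂ) * z + b) / d)) ^ k =
      if (d : ℤ) ∣ k then d * nome z ^ (a * (k / d)) else 0 := by
  have hd0 : (d : ℂ) ≠ 0 := by exact_mod_cast hd.ne'
  set ω : ℂ := Complex.exp (2 * Real.pi * Complex.I * (k / d)) with hω
  have h1 : ∀ b : ℕ, nome (ofComplex (((a : ℂ) * z + b) / d)) ^ k =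
      Complex.exp (2 * Real.pi * Complex.I * (k * (a * z) / d)) * ω ^ b := by
    intro b
    rw [nome, coe_ofComplex (im_affine_pos ha hd z.im_pos), ← Complex.exp_int_mul, hω,
      ← Complex.exp_nat_mul, ← Complex.exp_add]
    congr 1
    ring
  simp only [h1, ← Finset.mul_sum]
  split_ifs with h
  · obtain ⟨l, rfl⟩ := h
    have hω1 : ω = 1 := by
      rw [hω, Complex.exp_eq_one_iff]
      refine ⟨l, ?_⟩
      push_cast
      field_simp
    have hd' : (d : ℤ) ≠ 0 := by exact_mod_cast hd.ne'
    rw [Int.mul_ediv_cancel_left _ hd', nome, ← Complex.exp_int_mul]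
    simp only [hω1, one_pow, Finset.sum_const, Finset.card_range, nsmul_eq_mul, mul_one]
    rw [mul_comm]
    congr 2
    push_cast
    field_simp
  · have hω1 : ω ≠ 1 := by
      rw [hω, Ne, Complex.exp_eq_one_iff]
      rintro ⟨l, hl⟩
      apply h
      have h2 : (2 * Real.pi * Complex.I : ℂ) ≠ 0 := by simp [Real.pi_ne_zero]
      have h3 : (k : ℂ) / d = l := mul_left_cancel₀ h2 (by rw [hl]; ring)
      rw [div_eq_iff hd0] at h3
      exact ⟨l, by rw [mul_comm]; exact_mod_cast h3⟩
    have hωd : ω ^ d = 1 := by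
      rw [hω, ← Complex.exp_nat_mul, Complex.exp_eq_one_iff]
      refine ⟨k, ?_⟩
      field_simp
    rw [geom_sum_eq hω1, hωd, sub_self, zero_div, mul_zero]

theorem heckeCoeff_eq_zero {a : ℤ → ℂ} {N : ℕ} (hN : ∀ m : ℤ, m < -N → a m = 0)
    (w : ℤ) (m : ℕ) {j : ℤ} (hj : j < -(m * N : ℕ)) : heckeCoeff w m a j = 0 := by
  rw [heckeCoeff, Finset.sum_eq_zero, mul_zero]
  intro p hp
  obtain ⟨h1, h2⟩ := pos_of_mem_divisorsAntidiagonal hp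
  have hpm : p.1 * p.2 = m := (Nat.mem_divisorsAntidiagonal.mp hp).1
  split_ifs with h
  · obtain ⟨l, rfl⟩ := h
    have h1' : (p.1 : ℤ) ≠ 0 := by exact_mod_cast h1.ne'
    rw [Int.mul_ediv_cancel_left _ h1', hN, mul_zero, mul_zero]
    have h3 : (p.1 : ℤ) * l < p.1 * (-(p.2 * N)) := by
      rw [← hpm] at hj
      push_cast at hj
      linarith
    have h4 : l < -(p.2 * N) := lt_of_mul_lt_mul_left h3 (by positivity)
    have h5 : (1 : ℤ) ≤ p.2 := by exact_mod_cast h2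
    have h6 : (N : ℤ) ≤ p.2 * N := le_mul_of_one_le_left (by positivity) h5
    have h7 : (p.2 : ℤ) * l ≤ 1 * l := mul_le_mul_of_nonpos_right h5 (by omega)
    omega
  · rw [mul_zero, mul_zero]

theorem HasQExpansion.hecke {f : ℍ → ℂ} {a : ℤ → ℂ} (hf : HasQExpansion f a) (w : ℤ) (m : ℕ) :
    HasQExpansion (hecke w m f) (heckeCoeff w m a) := by
  refine ⟨?_, fun z => ?_⟩
  · obtain ⟨N, hN⟩ := hf.1
    refine ⟨(m * N.toNat : ℕ), fun j hj => heckeCoeff_eq_zero (N := N.toNat) (fun i hi => hN i ?_)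
      w m hj⟩
    have := Int.self_le_toNat N
    omega
  · have key : ∀ p ∈ m.divisorsAntidiagonal, HasSum (fun j : ℤ =>
        ((p.2 : ℂ) * if (p.1 : ℤ) ∣ j then a (p.2 * (j / p.1)) else 0) * nome z ^ j)
        (∑ b ∈ Finset.range p.2, f (ofComplex (((p.1 : ℂ) * z + b) / p.2))) := by
      intro p hp
      obtain ⟨h1, h2⟩ := pos_of_mem_divisorsAntidiagonal hp
      have h1' : (p.1 : ℤ) ≠ 0 := by exact_mod_cast h1.ne'
      have h2' : (p.2 : ℤ) ≠ 0 := by exact_mod_cast h2.ne'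
      have hs := hasSum_sum (s := Finset.range p.2) fun b _ =>
        hf.2 (ofComplex (((p.1 : ℂ) * z + b) / p.2))
      simp only [← Finset.mul_sum, sum_nome_affine_zpow h1 h2] at hs
      have hi1 : Function.Injective fun l : ℤ => (p.1 : ℤ) * l := mul_right_injective₀ h1'
      have hi2 : Function.Injective fun l : ℤ => (p.2 : ℤ) * l := mul_right_injective₀ h2'
      rw [← hi2.hasSum_iff] at hs
      · rw [← hi1.hasSum_iff]
        · refine Eq.mpr (congrArg (fun u => HasSum u _) (funext fun l => ?_)) hs
          simp only [Function.comp_apply, dvd_mul_right, if_true]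
          rw [Int.mul_ediv_cancel_left _ h1', Int.mul_ediv_cancel_left _ h2']
          ring
        · intro j hj
          rw [if_neg fun hdvd => hj ⟨j / p.1, Int.mul_ediv_cancel' hdvd⟩]
          simp
      · intro j hj
        rw [if_neg fun hdvd => hj ⟨j / p.2, Int.mul_ediv_cancel' hdvd⟩]
        simp
    have := (hasSum_sum fun p hp => (key p hp).mul_left ((p.2 : ℂ) ^ (-w))).mul_left
      ((m : ℂ) ^ (w - 1))
    convert! this using 2 with j
    rw [heckeCoeff, mul_assoc, Finset.sum_mul]
    simp only [mul_assoc]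

theorem IsWeaklyHolomorphic.hecke {k : ℤ} {f : ℍ → ℂ} (hf : IsWeaklyHolomorphic k f) {m : ℕ}
    (hm : 1 ≤ m) : IsWeaklyHolomorphic k (hecke k m f) := by
  have h := hf.hasQExpansion.hecke k m
  have hmod := hf.modular.hecke hm
  rw [add_zero] at hmod
  exact ⟨h.normalizedDeriv.1, hmod, _, h⟩

theorem HasQExpansion.eq {f g : ℍ → ℂ} {a : ℤ → ℂ} (hf : HasQExpansion f a)
    (hg : HasQExpansion g a) : f = g :=
  funext fun z => (hf.2 z).unique (hg.2 z)

/-- Hecke operators preserve the image of Bol's operator. -/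
theorem IsBolImage.hecke {n : ℕ} {f : ℍ → ℂ} (hf : IsBolImage n f) {m : ℕ} (hm : 1 ≤ m) :
    IsBolImage n (hecke (n + 2) m f) := by
  obtain ⟨p, hp, rfl⟩ := hf
  have hm0 : (m : ℂ) ≠ 0 := by exact_mod_cast (by omega : m ≠ 0)
  -- On coefficients T_m D^{n+1} = m^{n+1} D^{n+1} T_m, with T_m in weight n + 2 on the left and in
  -- weight -n on the right.
  refine ⟨_, (hp.hecke hm).const_mul ((m : ℂ) ^ (n + 1)), ?_⟩
  have h1 := (hp.hasQExpansion.iterate_normalizedDeriv (n + 1)).hecke (n + 2) m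
  have h2 := ((hp.hasQExpansion.hecke (-n) m).const_mul ((m : ℂ) ^ (n + 1))).iterate_normalizedDeriv
    (n + 1)
  refine h1.eq ?_
  convert! h2 using 1
  funext j
  simp only [heckeCoeff]
  rw [Finset.mul_sum, Finset.mul_sum, Finset.mul_sum, Finset.mul_sum]
  refine Finset.sum_congr rfl fun p hp => ?_
  obtain ⟨h1, h2⟩ := pos_of_mem_divisorsAntidiagonal hp
  split_ifs with h
  · obtain ⟨l, rfl⟩ := h
    have h1' : (p.1 : ℤ) ≠ 0 := by exact_mod_cast h1.ne'
    have h1'' : (p.1 : ℂ) ≠ 0 := by exact_mod_cast h1.ne'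
    have h2'' : (p.2 : ℂ) ≠ 0 := by exact_mod_cast h2.ne'
    have hpm : (m : ℂ) = p.1 * p.2 := by
      exact_mod_cast (Nat.mem_divisorsAntidiagonal.mp hp).1.symm
    rw [Int.mul_ediv_cancel_left _ h1', hpm]
    have e1 : ((n : ℤ) + 2 - 1) = ((n + 1 : ℕ) : ℤ) := by push_cast; ring
    have e2 : (-(n : ℤ) - 1) = -((n + 1 : ℕ) : ℤ) := by push_cast; ring
    have e3 : (-((n : ℤ) + 2)) = -((n + 2 : ℕ) : ℤ) := by push_cast; ring
    rw [e1, e2, e3, neg_neg, zpow_neg, zpow_neg, zpow_natCast, zpow_natCast, zpow_natCast]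
    push_cast
    simp only [mul_pow]
    field_simp
    ring
  · simp

/-! ### Bounds for coefficients -/

/-- |f|² |𝕃|^k is continuous and invariant under SL₂(ℤ), so boundedness at the cusp gives
boundedness on all of ℍ. -/
theorem exists_norm_sq_le {k : ℤ} {f : ℍ → ℂ} (hf : Continuous f) (hmod : IsModular k 0 f)
    (hbd : ∃ C, ∀ᶠ z : ℍ in atImInfty, ‖f z‖ ^ 2 * ‖LL z‖ ^ k ≤ C) :
    ∃ C, ∀ z : ℍ, ‖f z‖ ^ 2 ≤ C * ‖LL z‖ ^ (-k) := by
  have hpos : ∀ z : ℍ, 0 < ‖LL z‖ := fun z => norm_pos_iff.mpr (LL_ne_zero z)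
  set F : ℍ → ℂ := fun z => f z * conj (f z) * LL z ^ k with hF
  have hnorm : ∀ z, ‖F z‖ = ‖f z‖ ^ 2 * ‖LL z‖ ^ k := by
    intro z
    rw [hF, norm_mul, norm_mul, RCLike.norm_conj, norm_zpow, sq]
  have hcont : Continuous F := (hf.mul (Complex.continuous_conj.comp hf)).mul
    (continuous_LL.zpow₀ _ fun z => Or.inl (LL_ne_zero z))
  have hinv := (hmod.mul hmod.star).mul (isModular_LL_zpow k)
  rw [add_zero, zero_add, add_neg_cancel] at hinv
  obtain ⟨C₀, hC₀⟩ := hbd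
  obtain ⟨C, hC⟩ := ModularGroup.exists_bound_of_invariant hcont
    (Asymptotics.IsBigO.of_bound C₀ (by
      filter_upwards [hC₀] with z hz
      rw [hnorm]
      simpa using hz))
    fun γ z => by simpa using hinv γ z
  refine ⟨C, fun z => ?_⟩
  have := hC z
  rw [hnorm] at this
  rw [zpow_neg, ← div_eq_mul_inv, le_div_iff₀ (zpow_pos (hpos z) k)]
  exact this

/-- The coefficient is the mean of f q^{-m} over the line im z = y/(2π), on which |𝕃| = y and
|q^{-m}|² = e^{2my}. -/
theorem norm_coeff_sq_le {k : ℤ} {f : ℍ → ℂ} {a : ℤ → ℂ} (hf : HasQExpansion f a) {C : ℝ}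
    (hC : ∀ z : ℍ, ‖f z‖ ^ 2 ≤ C * ‖LL z‖ ^ (-k)) (m : ℤ) {y : ℝ} (hy : 0 < y) :
    ‖a m‖ ^ 2 ≤ C * y ^ (-k) * Real.exp (2 * m * y) := by
  have hy' : 0 < y / (2 * Real.pi) := by positivity
  have h1 : ∀ z : ℍ, z.im = y / (2 * Real.pi) → ‖f z * nome z ^ (-m)‖ ≤
      Real.sqrt (C * y ^ (-k) * Real.exp (2 * m * y)) := by
    intro z hz
    apply Real.le_sqrt_of_sq_le
    have e1 : ‖LL z‖ = y := by
      rw [LL, Complex.norm_real, hz, Real.norm_eq_abs]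
      have : -2 * Real.pi * (y / (2 * Real.pi)) = -y := by field_simp
      rw [this, abs_neg, abs_of_pos hy]
    have e2 : ‖nome z ^ (-m)‖ ^ 2 = Real.exp (2 * m * y) := by
      rw [norm_zpow, norm_nome, real_exp_zpow, ← Real.exp_nat_mul, hz]
      congr 1
      push_cast
      field_simp
    rw [norm_mul, mul_pow, e2]
    have := hC z
    rw [e1] at this
    gcongr
  have h2 := norm_zeroMode_le hy' h1
  rw [hf.coeff_eq_zeroMode m hy'] at h2
  have h3 : 0 ≤ C * y ^ (-k) * Real.exp (2 * m * y) := by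
    obtain ⟨z, hz⟩ : ∃ z : ℍ, ‖LL z‖ = y := by
      refine ⟨ofComplex (((0 : ℝ) : ℂ) + (y / (2 * Real.pi) : ℝ) * Complex.I), ?_⟩
      rw [LL_line _ hy', Complex.norm_real, Real.norm_eq_abs]
      have : -2 * Real.pi * (y / (2 * Real.pi)) = -y := by field_simp
      rw [this, abs_neg, abs_of_pos hy]
    have := (sq_nonneg _).trans (hC z)
    rw [hz] at this
    positivity
  calc ‖a m‖ ^ 2 ≤ Real.sqrt (C * y ^ (-k) * Real.exp (2 * m * y)) ^ 2 := by gcongr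
    _ = _ := Real.sq_sqrt h3

theorem norm_LL (z : ℍ) : ‖LL z‖ = 2 * Real.pi * z.im := by
  rw [LL, Complex.norm_real, Real.norm_eq_abs, abs_of_neg]
  · ring
  · have := z.im_pos
    have := Real.pi_pos
    nlinarith [mul_pos this z.im_pos]

/-- The trivial bound for the coefficients of a cusp form. -/
theorem exists_coeff_bound_of_cuspidal {k : ℕ} {f : ℍ → ℂ} {a : ℤ → ℂ} (hf : HasQExpansion f a)
    (hmod : IsModular k 0 f) (ha : ∀ m ≤ 0, a m = 0) :
    ∃ C, 0 ≤ C ∧ ∀ m : ℕ, 1 ≤ m → ‖a m‖ ^ 2 ≤ C * (m : ℝ) ^ k := by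
  obtain ⟨C₀, hC₀⟩ := hf.exists_bound (N := -1) fun m hm => ha m (by omega)
  have hbd : ∃ C, ∀ᶠ z : ℍ in atImInfty, ‖f z‖ ^ 2 * ‖LL z‖ ^ (k : ℤ) ≤ C := by
    have h1 : Tendsto (fun z : ℍ => ‖LL z‖ ^ k * Real.exp (-‖LL z‖)) atImInfty (nhds 0) := by
      refine (Real.tendsto_pow_mul_exp_neg_atTop_nhds_zero k).comp ?_
      simp only [norm_LL]
      exact Tendsto.const_mul_atTop (by positivity) tendsto_comap
    refine ⟨C₀ ^ 2, ?_⟩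
    filter_upwards [h1.eventually (eventually_le_nhds one_pos), eventually_atImInfty_le_im 1] with
      z hz1 hz2
    have h2 := hC₀ z hz2
    rw [neg_neg, zpow_one, norm_nome, ← norm_LL] at h2
    have h3 : Real.exp (-‖LL z‖) ≤ 1 := Real.exp_le_one_iff.mpr (neg_nonpos.mpr (norm_nonneg _))
    have h4 := Real.exp_pos (-‖LL z‖)
    rw [zpow_natCast]
    calc ‖f z‖ ^ 2 * ‖LL z‖ ^ k ≤ (C₀ * Real.exp (-‖LL z‖)) ^ 2 * ‖LL z‖ ^ k := by gcongr
      _ = C₀ ^ 2 * (‖LL z‖ ^ k * Real.exp (-‖LL z‖)) * Real.exp (-‖LL z‖) := by ring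
      _ ≤ C₀ ^ 2 * 1 * 1 := by gcongr
      _ = C₀ ^ 2 := by ring
  obtain ⟨C, hC⟩ := exists_norm_sq_le hf.normalizedDeriv.1.continuous hmod hbd
  have hC' : 0 ≤ C := by
    have := (sq_nonneg _).trans (hC UpperHalfPlane.I)
    exact nonneg_of_mul_nonneg_left this
      (zpow_pos (norm_pos_iff.mpr (LL_ne_zero _)) _)
  refine ⟨C * Real.exp 2, by positivity, fun m hm => ?_⟩
  have hm0 : (0 : ℝ) < m := by exact_mod_cast hm
  -- Height y = 1/m keeps the exponential factor equal to e².
  have := norm_coeff_sq_le hf hC m (inv_pos.mpr hm0)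
  rw [inv_zpow, zpow_neg, inv_inv, zpow_natCast] at this
  refine this.trans_eq ?_
  have e : 2 * ((m : ℤ) : ℝ) * (m : ℝ)⁻¹ = 2 := by
    push_cast
    field_simp
  rw [e]
  ring

/-- A form of negative weight without pole at the cusp vanishes. -/
theorem eq_zero_of_neg_weight {n : ℕ} (hn : n ≠ 0) {f : ℍ → ℂ} {a : ℤ → ℂ} (hf : HasQExpansion f a)
    (hmod : IsModular (-n) 0 f) (ha : ∀ m < 0, a m = 0) : a = 0 := by
  obtain ⟨C₀, hC₀⟩ := hf.exists_bound (N := 0) fun m hm => ha m (by omega)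
  have hbd : ∃ C, ∀ᶠ z : ℍ in atImInfty, ‖f z‖ ^ 2 * ‖LL z‖ ^ (-(n : ℤ)) ≤ C := by
    refine ⟨C₀ ^ 2, ?_⟩
    filter_upwards [eventually_atImInfty_le_im 1] with z hz
    have h2 := hC₀ z hz
    rw [neg_zero, zpow_zero, mul_one] at h2
    have h3 : 1 ≤ ‖LL z‖ := by
      rw [norm_LL]
      nlinarith [Real.pi_gt_three]
    have h4 : ‖LL z‖ ^ (-(n : ℤ)) ≤ 1 := by
      rw [zpow_neg, zpow_natCast]
      exact inv_le_one_of_one_le₀ (one_le_pow₀ h3)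
    calc ‖f z‖ ^ 2 * ‖LL z‖ ^ (-(n : ℤ)) ≤ C₀ ^ 2 * 1 := by gcongr
      _ = C₀ ^ 2 := mul_one _
  obtain ⟨C, hC⟩ := exists_norm_sq_le hf.normalizedDeriv.1.continuous hmod hbd
  funext m
  -- In weight -n the bound is C y^n e^{2my}, which tends to 0 as y → 0 because n ≠ 0.
  have hlim : Tendsto (fun y : ℝ => C * y ^ n * Real.exp (2 * m * y)) (nhdsWithin 0 (Set.Ioi 0))
      (nhds 0) := by
    have : ContinuousAt (fun y : ℝ => C * y ^ n * Real.exp (2 * m * y)) 0 := by fun_prop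
    have h := this.tendsto
    simp only [zero_pow hn, mul_zero, zero_mul] at h
    exact h.mono_left nhdsWithin_le_nhds
  have hle : ‖a m‖ ^ 2 ≤ 0 := by
    refine ge_of_tendsto hlim ?_
    filter_upwards [self_mem_nhdsWithin] with y hy
    have := norm_coeff_sq_le hf hC m hy
    rwa [neg_neg, zpow_natCast] at this
  have := pow_eq_zero_iff (two_ne_zero) |>.mp (le_antisymm hle (sq_nonneg _))
  exact norm_eq_zero.mp this

theorem HasQExpansion.hasSum_mul {f g : ℍ → ℂ} {a b : ℤ → ℂ} (hf : HasQExpansion f a)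
    (hg : HasQExpansion g b) (w : ℍ) :
    HasSum (fun p : ℤ × ℤ => a p.1 * nome w ^ p.1 * (b p.2 * nome w ^ p.2)) (f w * g w) := by
  have h1 := summable_mul_of_summable_norm (hf.summable_norm w) (hg.summable_norm w)
  have h2 := HasSum.mul (hf.2 w) (hg.2 w)
  exact h2 h1

/-- The constant term of a product. -/
theorem hasSum_coeff_mul {f g : ℍ → ℂ} {a b : ℤ → ℂ} (hf : HasQExpansion f a)
    (hg : HasQExpansion g b) {y : ℝ} (hy : 0 < y) :
    HasSum (fun p : ℤ × ℤ => if p.1 + p.2 = 0 then a p.1 * b p.2 else 0)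
      (zeroMode (fun z => f z * g z) y) := by
  set e : ℂ := Complex.exp (-(2 * Real.pi * y)) with he
  have he0 : e ≠ 0 := Complex.exp_ne_zero _
  have key : ∀ (p : ℤ × ℤ) (x : ℝ), a p.1 * nome (ofComplex ((x : ℂ) + y * Complex.I)) ^ p.1 *
      (b p.2 * nome (ofComplex ((x : ℂ) + y * Complex.I)) ^ p.2) =
      a p.1 * b p.2 * e ^ (p.1 + p.2) *
        Complex.exp (2 * Real.pi * Complex.I * (p.1 + p.2 : ℤ) * x) := by
    intro p x
    have : Complex.exp (2 * Real.pi * Complex.I * (p.1 + p.2 : ℤ) * x) =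
        Complex.exp (2 * Real.pi * Complex.I * x) ^ (p.1 + p.2) := by
      rw [← Complex.exp_int_mul]
      ring_nf
    rw [this, nome_line x hy, mul_zpow, mul_zpow, zpow_add₀ he0, zpow_add₀ (Complex.exp_ne_zero _)]
    ring
  have hs := (hf.summable_norm (ofComplex (((0 : ℝ) : ℂ) + y * Complex.I))).mul_of_nonneg
    (hg.summable_norm (ofComplex (((0 : ℝ) : ℂ) + y * Complex.I))) (fun _ => norm_nonneg _)
    fun _ => norm_nonneg _
  simp only [← norm_mul, key] at hs
  simp only [Complex.ofReal_zero, mul_zero, Complex.exp_zero, mul_one] at hs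
  have hF : ∀ x : ℝ, HasSum (fun p : ℤ × ℤ => a p.1 * b p.2 * e ^ (p.1 + p.2) *
      Complex.exp (2 * Real.pi * Complex.I * (p.1 + p.2 : ℤ) * x))
      (f (ofComplex ((x : ℂ) + y * Complex.I)) * g (ofComplex ((x : ℂ) + y * Complex.I))) := by
    intro x
    have h1 := hf.hasSum_mul hg (ofComplex ((x : ℂ) + y * Complex.I))
    rwa [funext fun p => key p x] at h1
  have h := hasSum_integral_of_frequencies (e := fun p : ℤ × ℤ => p.1 + p.2) hs hF
  convert! h using 2 with p
  split_ifs with h0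
  · rw [h0, zpow_zero, mul_one]
  · rfl

/-! ### Growth of weak Hecke eigenvalues -/

/-- Bol images are orthogonal to cusp forms under the residue pairing. -/
theorem sum_qCoeff_mul_eq_zero {n : ℕ} {p h : ℍ → ℂ} (hp : IsWeaklyHolomorphic (-n) p)
    (hh : IsWeaklyHolomorphic (n + 2) h) (hcusp : ∀ j ≤ 0, qCoeff h j = 0) {N : ℕ}
    (hN : ∀ j : ℤ, j < -N → qCoeff p j = 0) :
    ∑ j ∈ Finset.Icc 1 N, qCoeff p (-(j : ℤ)) * qCoeff h j = 0 := by
  -- The product ph has weight 2, so its constant term is zero. That term is the finite sum in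
  -- question: h has only positive exponents and p has none below -N.
  have hmul := hp.mul hh
  rw [show -(n : ℤ) + (n + 2) = 2 by ring] at hmul
  have h1 := hasSum_coeff_mul hp.hasQExpansion hh.hasQExpansion one_pos
  rw [hmul.hasQExpansion.zeroMode_eq one_pos, hmul.exists_primitive.1] at h1
  have hinj : Function.Injective fun j : ℕ => (-(j : ℤ), (j : ℤ)) := fun i j hij => by
    simpa using hij
  have h2 := hasSum_sum_of_ne_finset_zero (L := SummationFilter.unconditional _)
    (f := fun p' : ℤ × ℤ => if p'.1 + p'.2 = 0 then qCoeff p p'.1 * qCoeff h p'.2 else 0)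
    (s := (Finset.Icc 1 N).image fun j : ℕ => (-(j : ℤ), (j : ℤ))) (by
      rintro ⟨i, j⟩ hij
      simp only
      split_ifs with h0
      · by_cases hj : j ≤ 0
        · rw [hcusp j hj, mul_zero]
        · rw [hN i, zero_mul]
          by_contra hlt
          refine hij (Finset.mem_image.mpr ⟨j.toNat, Finset.mem_Icc.mpr ⟨by omega, by omega⟩, ?_⟩)
          ext <;> simp <;> omega
      · rfl)
  rw [Finset.sum_image hinj.injOn] at h2
  simpa using h2.unique h1

/-- Only indices in t can contribute. Counting these instead of all divisors of m keeps later bounds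
at m^n, with no divisor function. -/
theorem norm_sum_le_card_mul {ι : Type*} [DecidableEq ι] {s t : Finset ι} {g : ι → ℂ} {B : ℝ}
    (hB : 0 ≤ B) (h0 : ∀ i ∈ s, i ∉ t → g i = 0) (h1 : ∀ i ∈ s, ‖g i‖ ≤ B) :
    ‖∑ i ∈ s, g i‖ ≤ t.card * B := by
  rw [← Finset.sum_subset (Finset.inter_subset_left (s₁ := s) (s₂ := t))
    fun i hi hi' => h0 i hi fun ht => hi' (Finset.mem_inter.mpr ⟨hi, ht⟩)]
  refine (norm_sum_le_of_le _ fun i hi => h1 i (Finset.mem_inter.mp hi).1).trans ?_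
  rw [Finset.sum_const, nsmul_eq_mul]
  gcongr
  exact Finset.inter_subset_right

theorem heckeCoeff_eq (n m : ℕ) (a : ℤ → ℂ) (j : ℤ) :
    heckeCoeff (n + 2) m a j = ∑ p ∈ m.divisorsAntidiagonal,
      (p.1 : ℂ) ^ (n + 1) * if (p.1 : ℤ) ∣ j then a (p.2 * (j / p.1)) else 0 := by
  rw [heckeCoeff, Finset.mul_sum]
  refine Finset.sum_congr rfl fun p hp => ?_
  obtain ⟨h1, h2⟩ := pos_of_mem_divisorsAntidiagonal hp
  have h2' : (p.2 : ℂ) ≠ 0 := by exact_mod_cast h2.ne'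
  have hpm : (m : ℂ) = p.1 * p.2 := by
    exact_mod_cast (Nat.mem_divisorsAntidiagonal.mp hp).1.symm
  have e1 : ((n : ℤ) + 2 - 1) = ((n + 1 : ℕ) : ℤ) := by push_cast; ring
  have e3 : (-((n : ℤ) + 2)) = -((n + 2 : ℕ) : ℤ) := by push_cast; ring
  rw [e1, e3, zpow_neg, zpow_natCast, zpow_natCast, hpm, mul_pow]
  field_simp
  ring

/-- Only factorizations ad = m with a dividing j contribute. There are at most j of them, each with
a ≤ j and with coefficient index dj/a ≤ mj. -/
theorem norm_heckeCoeff_le {n : ℕ} {a : ℤ → ℂ} {C : ℝ} (hC : 0 ≤ C)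
    (ha : ∀ m : ℕ, 1 ≤ m → ‖a m‖ ≤ C * (m : ℝ) ^ n) {j : ℕ} (hj : 1 ≤ j) {m : ℕ} (hm : 1 ≤ m) :
    ‖heckeCoeff (n + 2) m a j‖ ≤ j * ((j : ℝ) ^ (n + 1) * (C * (j : ℝ) ^ n)) * (m : ℝ) ^ n := by
  have hle : ∀ p ∈ m.divisorsAntidiagonal, ¬ (p.1 ∣ j) ∨ p.1 ≤ j := fun p _ =>
    or_iff_not_imp_left.mpr fun h => Nat.le_of_dvd hj (not_not.mp h)
  rw [heckeCoeff_eq]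
  have h := norm_sum_le_card_mul (s := m.divisorsAntidiagonal)
    (t := (Finset.Icc 1 j).image fun x => (x, m / x)) (B := (j : ℝ) ^ (n + 1) *
      (C * ((m : ℝ) * j) ^ n)) (g := fun p => (p.1 : ℂ) ^ (n + 1) *
        if (p.1 : ℤ) ∣ j then a (p.2 * ((j : ℤ) / p.1)) else 0) (by positivity) ?_ ?_
  · refine h.trans ?_
    have hcard : (((Finset.Icc 1 j).image fun x => (x, m / x)).card : ℝ) ≤ j := by
      have := Finset.card_image_le (s := Finset.Icc 1 j) (f := fun x => (x, m / x))
      rw [Nat.card_Icc, Nat.add_sub_cancel] at this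
      exact_mod_cast this
    refine (mul_le_mul_of_nonneg_right hcard (by positivity)).trans_eq ?_
    rw [mul_pow]
    ring
  · intro p hp hpt
    obtain ⟨h1, h2⟩ := pos_of_mem_divisorsAntidiagonal hp
    have hpm : p.1 * p.2 = m := (Nat.mem_divisorsAntidiagonal.mp hp).1
    rw [if_neg, mul_zero]
    intro hdvd
    have hdvd' : p.1 ∣ j := by exact_mod_cast hdvd
    refine hpt (Finset.mem_image.mpr ⟨p.1, Finset.mem_Icc.mpr ⟨h1, Nat.le_of_dvd hj hdvd'⟩, ?_⟩)
    rw [← hpm, Nat.mul_div_cancel_left _ h1]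
  · intro p hp
    obtain ⟨h1, h2⟩ := pos_of_mem_divisorsAntidiagonal hp
    have hpm : p.1 * p.2 = m := (Nat.mem_divisorsAntidiagonal.mp hp).1
    split_ifs with hdvd
    · have hdvd' : p.1 ∣ j := by exact_mod_cast hdvd
      have hxj := Nat.le_of_dvd hj hdvd'
      obtain ⟨l, rfl⟩ := hdvd'
      have hl : 1 ≤ l := Nat.pos_of_ne_zero fun h => by simp [h] at hj
      have h1' : (p.1 : ℤ) ≠ 0 := by exact_mod_cast h1.ne'
      have e : ((p.2 : ℤ) * (((p.1 * l : ℕ) : ℤ) / p.1)) = ((p.2 * l : ℕ) : ℤ) := by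
        push_cast
        rw [Int.mul_ediv_cancel_left _ h1']
      rw [e, norm_mul, norm_pow, Complex.norm_natCast]
      have h3 := ha (p.2 * l) (Nat.mul_pos h2 hl)
      have h4 : p.2 * l ≤ m * (p.1 * l) := by
        rw [← hpm]
        calc p.2 * l = 1 * p.2 * (1 * l) := by ring
          _ ≤ p.1 * p.2 * (p.1 * l) := by gcongr <;> omega
      have h4' : ((p.2 * l : ℕ) : ℝ) ≤ m * (p.1 * l : ℕ) := by exact_mod_cast h4
      have h5 : (p.1 : ℝ) ≤ (p.1 * l : ℕ) := by exact_mod_cast hxj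
      refine mul_le_mul (by gcongr) (h3.trans ?_) (norm_nonneg _) (by positivity)
      gcongr
    · rw [mul_zero, norm_zero]
      positivity

/-- The pairing of `T_m f` with a cusp form grows at most like the coefficients of the latter. -/
theorem exists_bound_pairing {n : ℕ} {a b : ℤ → ℂ} {C : ℝ} (hC : 0 ≤ C)
    (hb : ∀ m : ℕ, 1 ≤ m → ‖b m‖ ≤ C * (m : ℝ) ^ n) {N : ℕ} (hN : ∀ m : ℤ, m < -N → a m = 0) :
    ∃ C', ∀ m : ℕ, 1 ≤ m → ‖∑ j ∈ Finset.Icc 1 (m * N),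
      heckeCoeff (n + 2) m a (-(j : ℤ)) * b j / (j : ℂ) ^ (n + 1)‖ ≤ C' * (m : ℝ) ^ n := by
  set A : ℝ := ∑ i ∈ Finset.Icc 1 N, ‖a (-(i : ℤ))‖ with hA
  have hA0 : 0 ≤ A := Finset.sum_nonneg fun _ _ => norm_nonneg _
  have haA : ∀ i : ℕ, 1 ≤ i → ‖a (-(i : ℤ))‖ ≤ A := by
    intro i hi
    by_cases hiN : i ≤ N
    · exact Finset.single_le_sum (f := fun i : ℕ => ‖a (-(i : ℤ))‖) (fun _ _ => norm_nonneg _)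
        (Finset.mem_Icc.mpr ⟨hi, hiN⟩)
    · rw [hN _ (by omega), norm_zero]
      exact hA0
  refine ⟨N * (N * (A * (C * (N : ℝ) ^ n))), fun m hm => ?_⟩
  set B : ℝ := A * (C * ((m : ℝ) * N) ^ n) with hB
  have hB0 : 0 ≤ B := by positivity
  set G : ℕ × ℕ → ℕ → ℂ := fun p j => (p.1 : ℂ) ^ (n + 1) *
    (if (p.1 : ℤ) ∣ -(j : ℤ) then a (p.2 * (-(j : ℤ) / p.1)) else 0) * b j / (j : ℂ) ^ (n + 1)
    with hG
  have hsum : ∑ j ∈ Finset.Icc 1 (m * N),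
      heckeCoeff (n + 2) m a (-(j : ℤ)) * b j / (j : ℂ) ^ (n + 1) =
      ∑ p ∈ m.divisorsAntidiagonal, ∑ j ∈ Finset.Icc 1 (m * N), G p j := by
    rw [Finset.sum_comm]
    refine Finset.sum_congr rfl fun j _ => ?_
    rw [heckeCoeff_eq, Finset.sum_mul, Finset.sum_div]
  -- For ad = m a nonzero term needs j = al and dl ≤ N, hence l ≤ N and d ≤ N: at most N² terms in
  -- all. In each, a^{n+1} ≤ j^{n+1} cancels the denominator and j ≤ mN bounds the coefficient of
  -- the cusp form.
  have hterm : ∀ p ∈ m.divisorsAntidiagonal, ∀ j ∈ Finset.Icc 1 (m * N),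
      (¬ (∃ l ∈ Finset.Icc 1 N, j = p.1 * l ∧ p.2 ≤ N) → G p j = 0) ∧ ‖G p j‖ ≤ B := by
    intro p hp j hj
    obtain ⟨h1, h2⟩ := pos_of_mem_divisorsAntidiagonal hp
    have hpm : p.1 * p.2 = m := (Nat.mem_divisorsAntidiagonal.mp hp).1
    have h1' : (p.1 : ℤ) ≠ 0 := by exact_mod_cast h1.ne'
    obtain ⟨hj1, -⟩ := Finset.mem_Icc.mp hj
    by_cases hdvd : p.1 ∣ j
    · obtain ⟨l, rfl⟩ := hdvd
      have hl : 1 ≤ l := Nat.pos_of_ne_zero fun h => by simp [h] at hj1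
      have e : G p (p.1 * l) = (p.1 : ℂ) ^ (n + 1) * a (-((p.2 * l : ℕ) : ℤ)) * b (p.1 * l : ℕ) /
          ((p.1 * l : ℕ) : ℂ) ^ (n + 1) := by
        have hd : (p.1 : ℤ) ∣ -((p.1 * l : ℕ) : ℤ) := by
          push_cast
          exact (dvd_mul_right _ _).neg_right
        have e1 : (p.2 : ℤ) * (-((p.1 * l : ℕ) : ℤ) / p.1) = -((p.2 * l : ℕ) : ℤ) := by
          push_cast
          rw [← mul_neg, Int.mul_ediv_cancel_left _ h1', mul_neg]
        rw [hG]
        simp only [hd, if_true, e1]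
      by_cases hle : p.2 * l ≤ N
      · have hl' : l ≤ N := (Nat.le_mul_of_pos_left l h2).trans hle
        have hd' : p.2 ≤ N := (Nat.le_mul_of_pos_right p.2 hl).trans hle
        refine ⟨fun hno => (hno ⟨l, Finset.mem_Icc.mpr ⟨hl, hl'⟩, rfl, hd'⟩).elim, ?_⟩
        rw [e, norm_div, norm_mul, norm_mul, norm_pow, norm_pow, Complex.norm_natCast,
          Complex.norm_natCast]
        have h3 := haA (p.2 * l) (Nat.mul_pos h2 hl)
        have h4 := hb (p.1 * l) (Nat.mul_pos h1 hl)
        have h5 : p.1 * l ≤ m * N := by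
          rw [← hpm]
          exact Nat.mul_le_mul (Nat.le_mul_of_pos_right _ h2) hl'
        have h5' : ((p.1 * l : ℕ) : ℝ) ≤ m * N := by exact_mod_cast h5
        have h6 : (p.1 : ℝ) ≤ (p.1 * l : ℕ) := by
          exact_mod_cast Nat.le_mul_of_pos_right _ hl
        have h7 : (0 : ℝ) < ((p.1 * l : ℕ) : ℝ) := by exact_mod_cast Nat.mul_pos h1 hl
        rw [div_le_iff₀ (by positivity)]
        calc (p.1 : ℝ) ^ (n + 1) * ‖a (-((p.2 * l : ℕ) : ℤ))‖ * ‖b (p.1 * l : ℕ)‖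
            ≤ ((p.1 * l : ℕ) : ℝ) ^ (n + 1) * A * (C * ((m : ℝ) * N) ^ n) := by
              refine mul_le_mul (mul_le_mul (by gcongr) h3 (norm_nonneg _) (by positivity))
                (h4.trans (by gcongr)) (norm_nonneg _) (by positivity)
          _ = B * ((p.1 * l : ℕ) : ℝ) ^ (n + 1) := by
              rw [hB]
              ring
      · have : G p (p.1 * l) = 0 := by
          rw [e, hN _ (by omega)]
          simp
        exact ⟨fun _ => this, by rw [this, norm_zero]; exact hB0⟩
    · have : G p j = 0 := by
        have hd : ¬ ((p.1 : ℤ) ∣ -(j : ℤ)) := by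
          rw [dvd_neg]
          exact_mod_cast hdvd
        rw [hG]
        simp only [hd, if_false, mul_zero, zero_mul, zero_div]
      exact ⟨fun _ => this, by rw [this, norm_zero]; exact hB0⟩
  have hinner : ∀ p ∈ m.divisorsAntidiagonal,
      ‖∑ j ∈ Finset.Icc 1 (m * N), G p j‖ ≤ N * B := by
    intro p hp
    refine (norm_sum_le_card_mul (t := (Finset.Icc 1 N).image fun l => p.1 * l) hB0
      (fun j hj hjt => (hterm p hp j hj).1 ?_) fun j hj => (hterm p hp j hj).2).trans ?_
    · rintro ⟨l, hl, rfl, -⟩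
      exact hjt (Finset.mem_image_of_mem _ hl)
    · gcongr
      have := Finset.card_image_le (s := Finset.Icc 1 N) (f := fun l => p.1 * l)
      rwa [Nat.card_Icc, Nat.add_sub_cancel] at this
  rw [hsum]
  refine (norm_sum_le_card_mul (t := (Finset.Icc 1 N).image fun d => (m / d, d)) (B := N * B)
    (by positivity) (fun p hp hpt => Finset.sum_eq_zero fun j hj => (hterm p hp j hj).1 ?_)
    hinner).trans ?_
  · rintro ⟨l, -, -, hd⟩
    obtain ⟨h1, h2⟩ := pos_of_mem_divisorsAntidiagonal hp
    have hpm : p.1 * p.2 = m := (Nat.mem_divisorsAntidiagonal.mp hp).1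
    refine hpt (Finset.mem_image.mpr ⟨p.2, Finset.mem_Icc.mpr ⟨h2, hd⟩, ?_⟩)
    rw [← hpm, Nat.mul_div_cancel _ h2]
  · have hcard : (((Finset.Icc 1 N).image fun d => (m / d, d)).card : ℝ) ≤ N := by
      have := Finset.card_image_le (s := Finset.Icc 1 N) (f := fun d => (m / d, d))
      rw [Nat.card_Icc, Nat.add_sub_cancel] at this
      exact_mod_cast this
    refine (mul_le_mul_of_nonneg_right hcard (by positivity)).trans_eq ?_
    rw [hB, mul_pow]
    ring

/-- The trivial bound gives exponent (n + 2)/2, which is at most n precisely because n ≥ 2. -/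
theorem exists_coeff_bound_pow {n : ℕ} (hn : 2 ≤ n) {h : ℍ → ℂ}
    (hh : IsWeaklyHolomorphic (n + 2) h) (hcusp : ∀ j ≤ 0, qCoeff h j = 0) :
    ∃ C, 0 ≤ C ∧ ∀ m : ℕ, 1 ≤ m → ‖qCoeff h m‖ ≤ C * (m : ℝ) ^ n := by
  obtain ⟨C, hC, hb⟩ := exists_coeff_bound_of_cuspidal (k := n + 2) hh.hasQExpansion
    (by exact_mod_cast hh.modular) hcusp
  refine ⟨Real.sqrt C, Real.sqrt_nonneg _, fun m hm => ?_⟩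
  have hm1 : (1 : ℝ) ≤ m := by exact_mod_cast hm
  refine le_of_sq_le_sq ?_ (by positivity)
  rw [mul_pow, Real.sq_sqrt hC, ← pow_mul]
  refine (hb m hm).trans ?_
  gcongr
  omega

theorem HasWeakHeckeEigenvalues.coeff {n : ℕ} {f : ℍ → ℂ} {lam : ℕ → ℂ}
    (hlam : HasWeakHeckeEigenvalues n f lam) (hf : IsWeaklyHolomorphic (n + 2) f) {m : ℕ}
    (hm : 1 ≤ m) : ∃ p, IsWeaklyHolomorphic (-n) p ∧ ∀ j : ℤ,
      heckeCoeff (n + 2) m (qCoeff f) j - lam m * qCoeff f j = (j : ℂ) ^ (n + 1) * qCoeff p j := by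
  obtain ⟨p, hp, hpe⟩ := hlam m hm
  refine ⟨p, hp, fun j => ?_⟩
  have h1 := (hf.hasQExpansion.hecke (n + 2) m).sub (hf.hasQExpansion.const_mul (lam m))
  rw [hpe] at h1
  exact congrFun (h1.unique (hp.hasQExpansion.iterate_normalizedDeriv (n + 1))) j

/-- The candidates are E_{12j-n} Δ^{-j} and E_{n+2-12j} Δ^j. The two Eisenstein weights are even and
add up to 2, so one of them is positive. The exceptional weight 2 is avoided because its partner
then has weight 0 and the constant 1 serves. -/
theorem exists_leading_dual {n : ℕ} (hn : Even n) (j : ℕ) :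
    (∃ p, IsWeaklyHolomorphic (-n) p ∧ (∀ i < -(j : ℤ), qCoeff p i = 0) ∧ qCoeff p (-j) = 1) ∨
    ∃ h, IsWeaklyHolomorphic (n + 2) h ∧ (∀ i < (j : ℤ), qCoeff h i = 0) ∧ qCoeff h j = 1 := by
  obtain ⟨t, rfl⟩ := hn
  rcases lt_or_ge (12 * j) (t + t + 3) with hlt | hge
  · by_cases heq : 12 * j = t + t
    · left
      obtain ⟨F, hF, h1, h2⟩ := exists_leading_form (Or.inl rfl) (-(j : ℤ))
      refine ⟨F, ?_, h1, h2⟩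
      convert! hF using 1
      push_cast
      omega
    · right
      have hl : t + t + 2 - 12 * j = 0 ∨
          3 ≤ t + t + 2 - 12 * j ∧ Even (t + t + 2 - 12 * j) := by
        by_cases h0 : t + t + 2 - 12 * j = 0
        · exact Or.inl h0
        · exact Or.inr ⟨by omega, ⟨t + 1 - 6 * j, by omega⟩⟩
      obtain ⟨F, hF, h1, h2⟩ := exists_leading_form hl (j : ℤ)
      refine ⟨F, ?_, h1, h2⟩
      convert! hF using 1
      omega
  · left
    obtain ⟨F, hF, h1, h2⟩ := exists_leading_form (l := 12 * j - (t + t))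
      (Or.inr ⟨by omega, ⟨6 * j - t, by omega⟩⟩) (-(j : ℤ))
    refine ⟨F, ?_, h1, h2⟩
    convert! hF using 1
    omega

/-- T_m f - λ_m f has no pole, so neither has its Bol preimage p, which vanishes by its negative
weight. Thus f is a true eigenform, and one nonzero coefficient of f gives λ_m as a quotient of a
coefficient of T_m f. -/
theorem exists_eigenvalue_bound_of_cuspidal {n : ℕ} (hn : 2 ≤ n) {f : ℍ → ℂ} {lam : ℕ → ℂ}
    (hf : IsWeaklyHolomorphic (n + 2) f) (hcusp : ∀ m ≤ 0, qCoeff f m = 0)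
    (hfb : ¬ IsBolImage n f) (hlam : HasWeakHeckeEigenvalues n f lam) :
    ∃ C, ∀ m : ℕ, 1 ≤ m → ‖lam m‖ ≤ C * (m : ℝ) ^ n := by
  obtain ⟨i, hi⟩ : ∃ i, qCoeff f i ≠ 0 := by
    by_contra! h
    apply hfb
    have : HasQExpansion f 0 := by
      convert! hf.hasQExpansion
      exact (funext h).symm
    rw [this.eq hasQExpansion_zero]
    exact isBolImage_zero n
  have hi0 : 0 < i := not_le.mp fun h => hi (hcusp i h)
  obtain ⟨j, rfl⟩ := Int.eq_ofNat_of_zero_le hi0.le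
  have hj : 1 ≤ j := by omega
  obtain ⟨C, hC, hb⟩ := exists_coeff_bound_pow hn hf hcusp
  refine ⟨j * ((j : ℝ) ^ (n + 1) * (C * (j : ℝ) ^ n)) / ‖qCoeff f j‖, fun m hm => ?_⟩
  obtain ⟨p, hp, hco⟩ := hlam.coeff hf hm
  have hp0 : qCoeff p = 0 := by
    refine eq_zero_of_neg_weight (by omega) hp.hasQExpansion hp.modular fun i hi => ?_
    have h := hco i
    rw [heckeCoeff_eq_zero (N := 0) (fun k hk => hcusp k (by simpa using hk.le)) _ _
      (by simpa using hi), hcusp i hi.le, mul_zero, sub_zero] at h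
    have hi' : (i : ℂ) ≠ 0 := by exact_mod_cast hi.ne
    exact (mul_eq_zero.mp h.symm).resolve_left (pow_ne_zero _ hi')
  have h := hco j
  rw [hp0, Pi.zero_apply, mul_zero, sub_eq_zero] at h
  have h2 := norm_heckeCoeff_le hC hb hj hm
  rw [h, norm_mul] at h2
  rw [div_mul_eq_mul_div, le_div_iff₀ (norm_pos_iff.mpr hi)]
  exact h2

/-- The pairing Σ a_{-j}(f) a_j(h) / j^{n+1} kills Bol images, so its value on T_m f is λ_m times
its value on f. Since f begins at q^{-N} and h at q^N, that value is the single term D ≠ 0. -/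
theorem exists_eigenvalue_bound_of_pairing {n : ℕ} (hn : 2 ≤ n) {f h : ℍ → ℂ} {lam : ℕ → ℂ} {N : ℕ}
    (hN1 : 1 ≤ N) (hf : IsWeaklyHolomorphic (n + 2) f)
    (hN : ∀ m : ℤ, m < -N → qCoeff f m = 0) (hfN : qCoeff f (-N) ≠ 0)
    (hlam : HasWeakHeckeEigenvalues n f lam) (hh : IsWeaklyHolomorphic (n + 2) h)
    (hlow : ∀ i < (N : ℤ), qCoeff h i = 0) (hlead : qCoeff h N = 1) :
    ∃ C, ∀ m : ℕ, 1 ≤ m → ‖lam m‖ ≤ C * (m : ℝ) ^ n := by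
  have hcusp : ∀ j ≤ 0, qCoeff h j = 0 := fun j hj => hlow j (by omega)
  obtain ⟨C, hC, hb⟩ := exists_coeff_bound_pow hn hh hcusp
  obtain ⟨C', hC'⟩ := exists_bound_pairing hC hb hN
  have hN0 : (N : ℂ) ≠ 0 := by exact_mod_cast (by omega : N ≠ 0)
  set D : ℂ := qCoeff f (-N) / (N : ℂ) ^ (n + 1) with hD
  have hD0 : D ≠ 0 := div_ne_zero hfN (pow_ne_zero _ hN0)
  refine ⟨C' / ‖D‖, fun m hm => ?_⟩
  obtain ⟨p, hp, hco⟩ := hlam.coeff hf hm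
  have hpN : ∀ j : ℤ, j < -(m * N : ℕ) → qCoeff p j = 0 := by
    intro j hj
    have hmN : N ≤ m * N := Nat.le_mul_of_pos_left N hm
    have h := hco j
    rw [heckeCoeff_eq_zero hN _ _ hj, hN j (by omega), mul_zero, sub_zero] at h
    have hj' : (j : ℂ) ≠ 0 := by exact_mod_cast (by omega : j ≠ 0)
    exact (mul_eq_zero.mp h.symm).resolve_left (pow_ne_zero _ hj')
  have hzero := sum_qCoeff_mul_eq_zero hp hh hcusp hpN
  have hkey : ∑ j ∈ Finset.Icc 1 (m * N),
      heckeCoeff (n + 2) m (qCoeff f) (-(j : ℤ)) * qCoeff h j / (j : ℂ) ^ (n + 1) = lam m * D := by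
    have h1 : ∀ j ∈ Finset.Icc 1 (m * N),
        heckeCoeff (n + 2) m (qCoeff f) (-(j : ℤ)) * qCoeff h j / (j : ℂ) ^ (n + 1) =
        lam m * (qCoeff f (-(j : ℤ)) * qCoeff h j / (j : ℂ) ^ (n + 1)) +
          (-1) ^ (n + 1) * (qCoeff p (-(j : ℤ)) * qCoeff h j) := by
      intro j hj
      have hj0 : (j : ℂ) ≠ 0 := by
        have := (Finset.mem_Icc.mp hj).1
        exact_mod_cast (by omega : j ≠ 0)
      have h2 := hco (-(j : ℤ))
      push_cast at h2
      rw [neg_pow] at h2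
      field_simp
      linear_combination qCoeff h j * h2
    rw [Finset.sum_congr rfl h1, Finset.sum_add_distrib, ← Finset.mul_sum, ← Finset.mul_sum, hzero,
      mul_zero, add_zero, Finset.sum_eq_single N]
    · rw [hlead, mul_one]
    · intro j hj hjN
      rcases lt_or_gt_of_ne hjN with hlt | hgt
      · rw [hlow j (by omega)]
        simp
      · rw [hN _ (by omega)]
        simp
    · intro h
      exact (h (Finset.mem_Icc.mpr ⟨hN1, Nat.le_mul_of_pos_left N hm⟩)).elim
  have h3 := hC' m hm
  rw [hkey, norm_mul] at h3
  rw [div_mul_eq_mul_div, le_div_iff₀ (norm_pos_iff.mpr hD0)]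
  exact h3

theorem HasWeakHeckeEigenvalues.sub_bol {n : ℕ} {f g : ℍ → ℂ} {lam : ℕ → ℂ}
    (hlam : HasWeakHeckeEigenvalues n f lam) (hg : IsBolImage n g) :
    HasWeakHeckeEigenvalues n (fun z => f z - g z) lam := by
  intro m hm
  have h := (hlam m hm).sub ((hg.hecke hm).sub (hg.const_mul (lam m)))
  convert! h using 1
  funext z
  have e : hecke (n + 2) m (fun v => f v - g v) z =
      hecke (n + 2) m f z - hecke (n + 2) m g z := by
    simp only [hecke, Finset.sum_sub_distrib, mul_sub]
  rw [e]
  ring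

/-- Induction on the order of the pole. If some p in weight -n begins with q^{-(N+1)}, a multiple of
D^{n+1}p removes the leading term of f. The class, the eigenvalues and the zero constant term are
unaffected. Otherwise the dual cusp form exists and the pairing gives the bound directly. -/
theorem exists_eigenvalue_bound {n : ℕ} (hn : 2 ≤ n) (hn2 : Even n) {lam : ℕ → ℂ} (N : ℕ) :
    ∀ f : ℍ → ℂ, IsWeaklyHolomorphic (n + 2) f → qCoeff f 0 = 0 →
      (∀ m : ℤ, m < -N → qCoeff f m = 0) → ¬ IsBolImage n f → HasWeakHeckeEigenvalues n f lam →
      ∃ C, ∀ m : ℕ, 1 ≤ m → ‖lam m‖ ≤ C * (m : ℝ) ^ n := by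
  induction N with
  | zero =>
    intro f hf h0 hN hfb hlam
    refine exists_eigenvalue_bound_of_cuspidal hn hf (fun m hm => ?_) hfb hlam
    rcases hm.lt_or_eq with h | rfl
    · exact hN m (by simpa using h)
    · exact h0
  | succ N ih =>
    intro f hf h0 hN hfb hlam
    by_cases hfN : qCoeff f (-(N + 1 : ℕ)) = 0
    · refine ih f hf h0 (fun m hm => ?_) hfb hlam
      rcases eq_or_ne m (-(N + 1 : ℕ)) with rfl | hne
      · exact hfN
      · exact hN m (by push_cast at *; omega)
    rcases exists_leading_dual hn2 (N + 1) with ⟨p, hp, hlow, hlead⟩ | ⟨h, hh, hlow, hlead⟩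
    · have hN0 : ((-(N + 1 : ℕ) : ℤ) : ℂ) ≠ 0 := by
        exact_mod_cast (by omega : (-(N + 1 : ℕ) : ℤ) ≠ 0)
      set c : ℂ := qCoeff f (-(N + 1 : ℕ)) / ((-(N + 1 : ℕ) : ℤ) : ℂ) ^ (n + 1) with hc
      have hg : IsBolImage n fun z => c * 𝒟^[n + 1] p z := IsBolImage.const_mul ⟨p, hp, rfl⟩ c
      have hf' := hf.sub (hp.bol.const_mul c)
      have hco : ∀ j : ℤ, qCoeff (fun z => f z - c * 𝒟^[n + 1] p z) j =
          qCoeff f j - c * ((j : ℂ) ^ (n + 1) * qCoeff p j) := fun j =>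
        (hf.hasQExpansion.sub
          ((hp.hasQExpansion.iterate_normalizedDeriv (n + 1)).const_mul c)).qCoeff_eq j
      refine ih _ hf' ?_ (fun m hm => ?_) (fun hb => hfb ?_) (hlam.sub_bol hg)
      · rw [hco, h0]
        simp
      · rw [hco]
        rcases eq_or_ne m (-(N + 1 : ℕ)) with rfl | hne
        · rw [hlead, hc]
          field_simp
          ring
        · have hm' : m < -((N + 1 : ℕ) : ℤ) := by push_cast at *; omega
          rw [hN m hm', hlow m hm']
          simp
      · have := hb.sub (hg.const_mul (-1))
        convert! this using 1
        funext z
        ring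
    · exact exists_eigenvalue_bound_of_pairing hn (Nat.succ_le_succ N.zero_le) hf hN hfN hlam hh
        hlow hlead

/-- A nonzero class rules out odd n, where f = 0, and n = 0, where every form is a derivative. In
the remaining cases |λ_m| ≤ C m^n < m^{n+1} ≤ σ_{n+1}(m) once m > C. -/
theorem eventually_sigma_sub_ne_zero {n : ℕ} {f : ℍ → ℂ} {lam : ℕ → ℂ}
    (hf : IsWeaklyHolomorphic (n + 2) f) (h0 : qCoeff f 0 = 0) (hfb : ¬ IsBolImage n f)
    (hlam : HasWeakHeckeEigenvalues n f lam) :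
    ∀ᶠ m : ℕ in atTop, (ArithmeticFunction.sigma (n + 1) m : ℂ) - lam m ≠ 0 := by
  have hn2 : Even n := by
    by_contra hodd
    rw [Nat.not_even_iff_odd] at hodd
    have hk : Odd ((n : ℤ) + 2) := by
      obtain ⟨t, ht⟩ := hodd
      exact ⟨t + 1, by omega⟩
    apply hfb
    rw [hf.modular.eq_zero_of_odd hk]
    exact isBolImage_zero n
  have hn : 2 ≤ n := by
    by_contra hlt
    obtain rfl : n = 0 := by
      obtain ⟨t, ht⟩ := hn2
      omega
    obtain ⟨-, G, hG, hfG⟩ := IsWeaklyHolomorphic.exists_primitive (f := f) (by simpa using hf)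
    exact hfb ⟨G, by simpa using hG, by simpa using hfG⟩
  obtain ⟨N, hN⟩ := hf.hasQExpansion.1
  obtain ⟨C, hC⟩ := exists_eigenvalue_bound hn hn2 N.toNat f hf h0
    (fun m hm => hN m (by have := Int.self_le_toNat N; omega)) hfb hlam
  filter_upwards [eventually_gt_atTop ⌈C⌉₊, eventually_ge_atTop 1] with m hm hm1
  have hm0 : (0 : ℝ) < m := by exact_mod_cast hm1
  have hlt : C < m := (Nat.le_ceil C).trans_lt (by exact_mod_cast hm)
  intro heq
  have h1 := hC m hm1
  rw [← sub_eq_zero.mp heq, Complex.norm_natCast] at h1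
  have h2 : m ^ (n + 1) ≤ ArithmeticFunction.sigma (n + 1) m := by
    rw [ArithmeticFunction.sigma_apply]
    exact Finset.single_le_sum (f := fun d => d ^ (n + 1)) (fun _ _ => Nat.zero_le _)
      (Nat.mem_divisors_self m (by omega))
  have h3 : (m : ℝ) ^ (n + 1) ≤ ArithmeticFunction.sigma (n + 1) m := by exact_mod_cast h2
  have h4 : C * (m : ℝ) ^ n < (m : ℝ) ^ (n + 1) := by
    rw [pow_succ, mul_comm]
    exact mul_lt_mul_of_pos_left hlt (by positivity)
  linarith

end RealAnalyticCusp

end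

/-! ### The main theorem -/

open RealAnalyticCusp in
theorem mainTheorem8 (n : ℕ) (f g : ℍ → ℂ) (X : ℕ → ℕ → ℍ → ℂ) (lam : ℕ → ℂ)
    (hX : IsPrimitiveSystem n f g X) (hlam : HasWeakHeckeEigenvalues n f lam) :
    ∃ α : ℂ,
      (∀ r s : ℕ, r + s = n → IsConstantPart (X r s)
        (LaurentPolynomial.C (qCoeff f 0 / (n + 1)) * LaurentPolynomial.T 1 +
          LaurentPolynomial.C (α * (-1) ^ r * (n.choose r : ℂ)) *
            LaurentPolynomial.T (-(n : ℤ)))) ∧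
      (qCoeff f 0 = 0 → ∀ r s : ℕ, r + s = n → IsConstantPart (X r s)
        (LaurentPolynomial.C (α * (-1) ^ r * (n.choose r : ℂ)) *
          LaurentPolynomial.T (-(n : ℤ)))) ∧
      (∀ m : ℕ, 1 ≤ m →
        (∃ ψ φ : ℍ → ℂ, IsHeckeDefect n f g X lam m ψ φ) ∧
        ∀ ψ φ : ℍ → ℂ, IsHeckeDefect n f g X lam m ψ φ →
          ((ArithmeticFunction.sigma (n + 1) m : ℂ) - lam m) * α =
            qCoeff ψ 0 + conj (qCoeff φ 0)) ∧
      (qCoeff f 0 = 0 → ¬ IsBolImage n f →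
        ∀ᶠ m : ℕ in atTop, (ArithmeticFunction.sigma (n + 1) m : ℂ) - lam m ≠ 0 ∧
          ∀ ψ φ : ℍ → ℂ, IsHeckeDefect n f g X lam m ψ φ →
            α = (qCoeff ψ 0 + conj (qCoeff φ 0)) /
              ((ArithmeticFunction.sigma (n + 1) m : ℂ) - lam m)) := by
  obtain ⟨α, hα⟩ := hX.exists_zeroMode
  have hconst : ∀ r s : ℕ, r + s = n → IsConstantPart (X r s)
      (LaurentPolynomial.C (qCoeff f 0 / (n + 1)) * LaurentPolynomial.T 1 +
        LaurentPolynomial.C (α * (-1) ^ r * (n.choose r : ℂ)) *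
          LaurentPolynomial.T (-(n : ℤ))) := fun r s hrs =>
    isConstantPart_of_zeroMode_eq (hX.mem r s hrs).expansion _ _ _ _ fun y hy => by
      rw [hα r s hrs y hy, zpow_one]
  have hrel : ∀ m : ℕ, 1 ≤ m → ∀ ψ φ : ℍ → ℂ, IsHeckeDefect n f g X lam m ψ φ →
      ((ArithmeticFunction.sigma (n + 1) m : ℂ) - lam m) * α = qCoeff ψ 0 + conj (qCoeff φ 0) :=
    fun m hm ψ φ h => h.relation hX hm fun y hy => by
      rw [hα n 0 rfl y hy, Nat.choose_self, Nat.cast_one, mul_one]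
  refine ⟨α, hconst, fun h0 r s hrs => ?_, fun m hm =>
    ⟨hX.exists_defect hm (hlam m hm), hrel m hm⟩, fun h0 hf => ?_⟩
  · simpa [h0] using hconst r s hrs
  · filter_upwards [eventually_sigma_sub_ne_zero hX.hol_f h0 hf hlam, eventually_ge_atTop 1]
      with m hm hm1
    exact ⟨hm, fun ψ φ h => (eq_div_iff hm).mpr ((mul_comm _ _).trans (hrel m hm1 ψ φ h))⟩
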